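/- Consider a round sphere of radius $r>0$ and mass $m>0$ with center of mass at its center, rolling without slipping on a horizontal plane. Let $I$ be its inertia tensor, a positive definite symmetric $3\times 3$ matrix. Let $e_3$ be the vertical unit vector, $A\in\mathrm{SO}(3)$ the attitude of the sphere, $\omega\in\mathbb R^3$ the rotational velocity in body coordinates, $u=A^{-1}e_3$, and $p$ the point of contact. The rotational motion in the phase space $\mathrm{SO}(3)\times\mathbb R^3$ of the $(A,\omega)$ is given by $$\dot A z=A(\omega\times z)\quad(z\in\mathbb R^3),\qquad I\dot\omega-(I\omega)\times\omega=mr^2\bigl(\langle u,\dot\omega\rangle u-\dot\omega\bigr),$$ and the motion of the point of contact by $\dot p=r\,(A\omega)\times e_3$. The moment of the momentum around the point of contact and the kinetic energy, $$j=A\bigl(I\omega+mr^2\,u\times(\omega\times u)\bigr),\qquad T=\tfrac12\langle I\omega,\omega\rangle+\tfrac12 mr^2\langle u\times\omega,u\times\omega\rangle ,$$ are constants of motion. A regular level of $(j,T)$ is a nonempty level set of $(j,T):\mathrm{SO}(3)\times\mathbb R^3\to\mathbb R^3\times\mathbb R$ at each point of which the tangent map of $(j,T)$ has rank four. Suppose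 that two of the principal moments of inertia (the eigenvalues of $I$) are equal to each other. Then there is an axis such that $RIR^{-1}=I$ for every rotation $R$ about it. Fix any such axis, and let $\mathrm{SO}(2)$, the group of rotations $R$ about this axis, act on the phase space from the right by $(A,\omega)\mapsto(AR^{-1},R\omega)$. The reduced motion is the motion of the $\mathrm{SO}(2)$-orbits. Then the following hold. 1. There is a function $\tau(j,T)$, real analytic on the set of values of the regular levels of $(j,T)$, such that for every solution on the regular level with value $(j,T)$ the reduced motion is periodic with minimal period $\tau(j,T)>0$. In particular $A\omega$, and therefore also $\dot p$, is periodic with period $\tau(j,T)$. 2. On the regular levels the rotational motion is quasiperiodic on two-dimensional analytic tori, depending analytically on $j$ and $T$. That is, every point of a regular level lies in an open subset $M$ of $\mathrm{SO}(3)\times\mathbb R^3$ for which there are an open set $E\subset\mathbb R^3\times\mathbb R$ of values of regular levels, an analytic diffeomorphism $\Phi:(\mathbb R^2/\mathbb Z^2)\times E\to M$ and an analytic map $\nu:E\to\mathbb R^2$, such that $(j,T)=\varepsilon$ at $\Phi(x,\varepsilon)$ and the solution that starts at $\Phi(x,\varepsilon)$ is $t\mapsto\Phi(x+t\,\nu(\varepsilon),\varepsilon)$.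 3. For every solution on a regular level, the motion of the point of contact is the superposition of a straight line motion with constant velocity and a periodic motion with the same period: $p(t)=t\,w+q(t)$ with $w$ constant and $q(t+\tau(j,T))=q(t)$ for all $t$. -/

import Mathlib

open Matrix

attribute [local instance] Matrix.normedAddCommGroup Matrix.normedSpace

noncomputable section

namespace Chaplygin

/-- Vectors of three-space, in coordinates; `v ⬝ᵥ w` is the inner product, `v ⨯₃ w` the vector
product. -/
abbrev Vec : Type := Fin 3 → ℝ

/-- Real `3 × 3` matrices. -/
abbrev Mat : Type := Matrix (Fin 3) (Fin 3) ℝ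

/-- The vertical unit vector. -/
def e₃ : Vec := ![0, 0, 1]

/-- The antisymmetric matrix of the linear map `z ↦ w ⨯₃ z`, see `hat_mulVec`. -/
def hat (w : Vec) : Mat :=
  !![0, -w 2, w 1; w 2, 0, -w 0; -w 1, w 0, 0]

theorem hat_mulVec (w z : Vec) : hat w *ᵥ z = w ⨯₃ z := by
  ext i
  fin_cases i <;> simp [hat, cross_apply, Matrix.mulVec, dotProduct, Fin.sum_univ_three] <;> ring

/-- The rotation group `SO(3)`, as a set of matrices. -/
def SO3 : Set Mat := {A | A * Aᵀ = 1 ∧ A.det = 1}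

/-- The phase space `SO(3) × ℝ³` of the rotational motion, with points `(A, ω)`: `A` is the
attitude of the sphere and `ω` the rotational velocity vector in body coordinates. It is an
embedded analytic submanifold, of dimension six, of `Mat × Vec`. -/
def phaseSpace : Set (Mat × Vec) := {x | x.1 ∈ SO3}

/-- The vertical direction in body coordinates, `u = A⁻¹ e₃ = Aᵀ e₃`. -/
def vert (A : Mat) : Vec := Aᵀ *ᵥ e₃

/-- The moment of the momentum around the point of contact,
`j = A (I ω + m r² u × (ω × u))`. -/
def moment (I : Mat) (m r : ℝ) (x : Mat × Vec) : Vec :=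
  x.1 *ᵥ (I *ᵥ x.2 + (m * r ^ 2) • (vert x.1 ⨯₃ (x.2 ⨯₃ vert x.1)))

/-- The kinetic energy, `T = ½ ⟨I ω, ω⟩ + ½ m r² ⟨u × ω, u × ω⟩`. -/
def kineticEnergy (I : Mat) (m r : ℝ) (x : Mat × Vec) : ℝ :=
  1 / 2 * ((I *ᵥ x.2) ⬝ᵥ x.2) +
    1 / 2 * (m * r ^ 2) * ((vert x.1 ⨯₃ x.2) ⬝ᵥ (vert x.1 ⨯₃ x.2))

/-- The mapping `(j, T)`. -/
def momentEnergy (I : Mat) (m r : ℝ) (x : Mat × Vec) : Vec × ℝ :=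
  (moment I m r x, kineticEnergy I m r x)

/-- `x` is a regular point of the restriction of `(j, T)` to the phase space: the tangent map of
`(j, T)` at `x = (A, ω)` maps the tangent space, which consists of all `(A ∘ hat ν, η)`, onto
`ℝ³ × ℝ`. -/
def IsRegularPoint (I : Mat) (m r : ℝ) (x : Mat × Vec) : Prop :=
  ∀ c : Vec × ℝ, ∃ ν η : Vec, fderiv ℝ (momentEnergy I m r) x (x.1 * hat ν, η) = c

/-- The set of `(j, T)`-values of regular levels: the level set in the phase space is not empty
and consists of regular points. -/
def regularValues (I : Mat) (m r : ℝ) : Set (Vec × ℝ) :=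
  {c | (∃ x ∈ phaseSpace, momentEnergy I m r x = c) ∧
    ∀ x ∈ phaseSpace, momentEnergy I m r x = c → IsRegularPoint I m r x}

/-- `γ = (A, ω)` is a solution, defined for all times, of the equations of the rotational motion
of Chaplygin's sphere: `A' = A ∘ hat ω` and
`I ω' - (I ω) × ω = m r² (⟨u, ω'⟩ u - ω')`, with `u = A⁻¹ e₃`. -/
def IsRotationalMotion (I : Mat) (m r : ℝ) (γ : ℝ → Mat × Vec) : Prop :=
  (∀ t, γ t ∈ phaseSpace) ∧
  (∀ t, HasDerivAt (fun s => (γ s).1) ((γ t).1 * hat (γ t).2) t) ∧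
  ∀ t, ∃ ω' : Vec, HasDerivAt (fun s => (γ s).2) ω' t ∧
    I *ᵥ ω' - (I *ᵥ (γ t).2) ⨯₃ (γ t).2 =
      (m * r ^ 2) • ((vert (γ t).1 ⬝ᵥ ω') • vert (γ t).1 - ω')

/-- `p` is a motion of the point of contact that belongs to the rotational motion `γ = (A, ω)`:
`p' = r (A ω) × e₃`. -/
def IsContactMotion (r : ℝ) (γ : ℝ → Mat × Vec) (p : ℝ → Vec) : Prop :=
  ∀ t, HasDerivAt p (r • (((γ t).1 *ᵥ (γ t).2) ⨯₃ e₃)) t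

/-- The group `SO(2)` of the rotations about the axis spanned by `d`. -/
def rotationsAbout (d : Vec) : Set Mat := {R | R ∈ SO3 ∧ R *ᵥ d = d}

/-- The line spanned by `d` is an axis of dynamical symmetry: the inertia tensor is invariant
under all rotations about it. -/
def IsSymmetryAxis (I : Mat) (d : Vec) : Prop :=
  d ≠ 0 ∧ ∀ R ∈ rotationsAbout d, R * I * Rᵀ = I

/-- The orbit relation of the right `SO(2)`-action `(A, ω) ↦ (A R⁻¹, R ω)`, where `R` runs
through the rotations about `d`. -/
def rightSetoid (d : Vec) : Setoid (Mat × Vec) where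
  r x y := ∃ R ∈ rotationsAbout d, y = (x.1 * Rᵀ, R *ᵥ x.2)
  iseqv := by
    refine ⟨fun x => ⟨1, ⟨⟨by simp, by simp⟩, by simp⟩, by simp⟩, ?_, ?_⟩
    · rintro x y ⟨R, ⟨⟨h1, h2⟩, h3⟩, rfl⟩
      have h1' : Rᵀ * R = 1 := mul_eq_one_comm.mp h1
      refine ⟨Rᵀ, ⟨⟨by simpa using h1', by simpa using h2⟩, ?_⟩, ?_⟩
      · calc Rᵀ *ᵥ d = Rᵀ *ᵥ (R *ᵥ d) := by rw [h3]
          _ = d := by rw [Matrix.mulVec_mulVec, h1', Matrix.one_mulVec]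
      · simp [Matrix.mul_assoc, h1']
    · rintro x y z ⟨R, ⟨⟨h1, h2⟩, h3⟩, rfl⟩ ⟨S, ⟨⟨k1, k2⟩, k3⟩, rfl⟩
      refine ⟨S * R, ⟨⟨?_, by simp [h2, k2]⟩, ?_⟩, ?_⟩
      · rw [Matrix.transpose_mul, Matrix.mul_assoc, ← Matrix.mul_assoc R, h1, Matrix.one_mul, k1]
      · rw [← Matrix.mulVec_mulVec, h3, k3]
      · simp [Matrix.mul_assoc]

/-- The right `SO(2)`-reduced motion: the curve of the `SO(2)`-orbits of the points `γ t`. -/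
def reducedMotion (d : Vec) (γ : ℝ → Mat × Vec) (t : ℝ) : Quotient (rightSetoid d) :=
  Quotient.mk (rightSetoid d) (γ t)

/-- `f` is periodic and `τ` is its smallest positive period. -/
def IsMinimalPeriod {α : Type*} (f : ℝ → α) (τ : ℝ) : Prop :=
  0 < τ ∧ Function.Periodic f τ ∧ ∀ s, 0 < s → Function.Periodic f s → τ ≤ s

/-- The torus `ℝ² / ℤ²`. -/
abbrev Torus : Type := Fin 2 → UnitAddCircle

/-- The projection `ℝ² → ℝ² / ℤ²`. -/
def toTorus (x : Fin 2 → ℝ) : Torus := fun i => (x i : UnitAddCircle)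

/-- `Φ` is an analytic diffeomorphism from `(ℝ² / ℤ²) × E`, with `E` open in `ℝ³ × ℝ`, onto the
subset `M` of the phase space. Analyticity of `Φ` is that of its lift to `ℝ² × E`. The inverse
of `Φ` has components `Ψ`, with values in the torus, and `π`, with values in `E`; the circle
`ℝ / ℤ` is identified with the unit circle in `ℂ` by `x ↦ exp (2 π i x)`, and a mapping on the
submanifold `M` is analytic if it is near each point of `M` the restriction of an analytic
mapping on an open subset of `Mat × Vec`. -/
def IsTorusDiffeo (E : Set (Vec × ℝ)) (M : Set (Mat × Vec)) (Φ : Torus × (Vec × ℝ) → Mat × Vec) :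
    Prop :=
  Set.BijOn Φ (Set.univ ×ˢ E) M ∧
  AnalyticOnNhd ℝ (fun y : (Fin 2 → ℝ) × (Vec × ℝ) => Φ (toTorus y.1, y.2)) (Set.univ ×ˢ E) ∧
  ∃ (Ψ : Mat × Vec → Torus) (π : Mat × Vec → Vec × ℝ),
    (∀ θ, ∀ ε ∈ E, Ψ (Φ (θ, ε)) = θ ∧ π (Φ (θ, ε)) = ε) ∧
    (∀ i, AnalyticOn ℝ (fun x => (AddCircle.toCircle (Ψ x i) : ℂ)) M) ∧
    AnalyticOn ℝ π M

/-- Near the level through `x₀` the rotational motion is quasiperiodic on analytic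
two-dimensional tori that depend analytically on the parameters `(j, T)`: there are an open set
`E` of values of regular levels, an open subset `M` of the phase space that contains `x₀`, and an
analytic diffeomorphism `Φ : (ℝ² / ℤ²) × E → M` that maps `(ℝ² / ℤ²) × {ε}` into the level
`(j, T) = ε` and takes the linear motions `θ + t ν(ε)` on the torus, with `ν` analytic on `E`, to
the rotational motions in `M`. -/
def IsQuasiperiodicNear (I : Mat) (m r : ℝ) (x₀ : Mat × Vec) : Prop :=
  ∃ (E : Set (Vec × ℝ)) (M : Set (Mat × Vec)) (Φ : Torus × (Vec × ℝ) → Mat × Vec)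
    (ν : Vec × ℝ → (Fin 2 → ℝ)),
    IsOpen E ∧ E ⊆ regularValues I m r ∧
    (∃ U : Set (Mat × Vec), IsOpen U ∧ M = U ∩ phaseSpace) ∧ x₀ ∈ M ∧
    IsTorusDiffeo E M Φ ∧
    AnalyticOnNhd ℝ ν E ∧
    (∀ θ, ∀ ε ∈ E, momentEnergy I m r (Φ (θ, ε)) = ε) ∧
    ∀ θ, ∀ ε ∈ E, ∀ γ : ℝ → Mat × Vec, γ 0 = Φ (θ, ε) →
      (IsRotationalMotion I m r γ ↔ ∀ t : ℝ, γ t = Φ (θ + toTorus (t • ν ε), ε))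

end Chaplygin

end

/-! Write the inertia tensor as I = a + k d dᵀ with a unit axis d, and put μ = m r², W = A ω, n = A
d and N = ⟨ω, d⟩ n, the spin vector. In space coordinates the conservation law for j is linear in W
and N. Solving it gives W = J + N - C N, where J is a fixed linear image of j and C = diag(α, α, γ)
is positive (`velocity_eq`). Since ⟨N, W⟩ = ⟨N, N⟩, it follows that ⟨N, C N⟩ = ⟨N, J⟩. Since 2T =
⟨j, W⟩, the common value is a constant c(j, T) (`spinConst_eq`). Thus N lies on the intersection of
a plane with an ellipsoid. With H = ⟨J, C⁻¹ J⟩ this is a nondegenerate ellipse if and only if 0 < c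
< H, and for k ≠ 0 this is exactly regularity of the level
(`isRegularPoint_iff_mem_ellipticValues`).

The axis moves by n' = W × n, which makes N' = (|N|² / c) J × C N. The eccentric angle φ of the
ellipse satisfies dN/dφ = J × C N up to a constant frequency (`hasDerivAt_ellipse`), so dt/dφ is an
explicit positive periodic function of φ. Its integral over a full turn is the period τ. An
SO(2)-orbit is determined by (n, W), and on a fixed level, for a fixed sign of the spin, by N. Hence
τ is the minimal period of the reduced motion.

The remaining coordinate is the polar angle ψ, in the body, of the part of ω orthogonal to d. Its
rate is a function of N alone (`hasDerivAt_attitude`). Therefore ψ is linear in time plus a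
τ-periodic function. Normalized time along the ellipse and ψ without its periodic part are linear
angle coordinates on a two-torus (`isRotationalMotion_lift`, `lift_injective`). Analyticity in all
variables comes from analytic parametric integrals and the inverse function theorem. The attitude
solves a first-order equation on SO(3) with j as parameter, so solutions are unique
(`rotationalMotion_unique`) and every motion is one of those constructed.

The velocity of the point of contact is a function of W, hence τ-periodic; its mean gives the drift.
-/

open scoped ContDiff Topology

/-! ### Analytic dependence of integrals and inverse functions on parameters. -/

/-- Averages of `f` along a bounded continuous family of linear substitutions are analytic. -/
theorem HasFPowerSeriesOnBall.integral_comp_clm {E : Type*} [NormedAddCommGroup E]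
    [NormedSpace ℝ E] {f : E → ℝ} {p : FormalMultilinearSeries ℝ E ℝ} {r : ENNReal}
    (hf : HasFPowerSeriesOnBall f p 0 r) {D : ℝ → E →L[ℝ] E} (hD : Continuous D)
    (hD1 : ∀ s ∈ Set.uIoc (0 : ℝ) 1, ‖D s‖ ≤ 1) :
    AnalyticAt ℝ (fun y => ∫ s in (0 : ℝ)..1, f (D s y)) 0 := by
  have hcont : ∀ n, Continuous fun s => (p n).compContinuousLinearMap (fun _ : Fin n => D s) := by
    intro n
    exact ((ContinuousMultilinearMap.compContinuousLinearMapContinuousMultilinear ℝ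
      (fun _ : Fin n => E) (fun _ : Fin n => E) ℝ).cont.comp
        (continuous_pi fun _ => hD)).clm_apply continuous_const
  have hnorm : ∀ n, ∀ s ∈ Set.uIoc (0 : ℝ) 1,
      ‖(p n).compContinuousLinearMap (fun _ : Fin n => D s)‖ ≤ ‖p n‖ := by
    intro n s hs
    refine (ContinuousMultilinearMap.norm_compContinuousLinearMap_le _ _).trans ?_
    have : ∏ _i : Fin n, ‖D s‖ ≤ 1 := Finset.prod_le_one (fun _ _ => norm_nonneg _)
      (fun _ _ => hD1 s hs)
    exact mul_le_of_le_one_right (norm_nonneg _) this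
  -- The coefficients of the average are the averages of the substituted coefficients. As `‖D s‖ ≤
  -- 1`, they are no larger than those of `p`, so the radius of convergence does not shrink.
  let q : FormalMultilinearSeries ℝ E ℝ := fun n =>
    ∫ s in (0 : ℝ)..1, (p n).compContinuousLinearMap (fun _ : Fin n => D s)
  have hq : ∀ n, ‖q n‖ ≤ ‖p n‖ := by
    intro n
    simpa using intervalIntegral.norm_integral_le_of_norm_le_const (hnorm n)
  refine ⟨q, r, ?_, hf.r_pos, ?_⟩
  · refine hf.r_le.trans ?_
    refine ENNReal.le_of_forall_nnreal_lt fun r' hr' => ?_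
    obtain ⟨C, -, hC⟩ := p.norm_mul_pow_le_of_lt_radius hr'
    exact q.le_radius_of_bound C fun n =>
      (mul_le_mul_of_nonneg_right (hq n) (by positivity)).trans (hC n)
  · intro y hy
    have hy' : (‖y‖₊ : ENNReal) < p.radius := by
      refine lt_of_lt_of_le ?_ hf.r_le
      simpa [Metric.mem_eball, edist_zero_right, enorm] using hy
    have key : ∀ n, q n (fun _ => y) = ∫ s in (0 : ℝ)..1, p n (fun _ => D s y) := by
      intro n
      have := (ContinuousMultilinearMap.apply ℝ (fun _ : Fin n => E) ℝ
        (fun _ => y)).intervalIntegral_comp_comm 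
          ((hcont n).intervalIntegrable (μ := MeasureTheory.volume) 0 1)
      exact this.symm
    simp only [key, zero_add]
    refine intervalIntegral.hasSum_integral_of_dominated_convergence
      (fun n _ => ‖p n‖ * ‖y‖ ^ n) ?_ ?_ ?_ ?_ ?_
    · intro n
      refine Continuous.aestronglyMeasurable ?_
      exact (p n).cont.comp (continuous_pi fun _ => hD.clm_apply continuous_const)
    · intro n
      refine Filter.Eventually.of_forall fun s hs => ?_
      refine ((p n).le_opNorm _).trans ?_
      refine mul_le_mul_of_nonneg_left ?_ (norm_nonneg _)
      simp only [Finset.prod_const, Finset.card_univ, Fintype.card_fin]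
      refine pow_le_pow_left₀ (norm_nonneg _) ?_ n
      exact ((D s).le_opNorm y).trans (mul_le_of_le_one_left (norm_nonneg _) (hD1 s hs))
    · refine Filter.Eventually.of_forall fun s _ => ?_
      simpa using p.summable_norm_mul_pow hy'
    · exact intervalIntegrable_const
    · refine Filter.Eventually.of_forall fun s hs => ?_
      have hmem : D s y ∈ Metric.eball (0 : E) r := by
        rw [Metric.mem_eball, edist_zero_right] at hy ⊢
        refine lt_of_le_of_lt ?_ hy
        have : ‖D s y‖ ≤ ‖y‖ :=
          ((D s).le_opNorm y).trans (mul_le_of_le_one_left (norm_nonneg _) (hD1 s hs))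
        exact enorm_le_iff_norm_le.2 this
      simpa using hf.hasSum hmem

/-- A local parametric primitive of an analytic function is analytic. -/
theorem AnalyticAt.integral_from {P : Type*} [NormedAddCommGroup P] [NormedSpace ℝ P]
    {f : ℝ × P → ℝ} {x₀ : ℝ} {p₀ : P} (hf : AnalyticAt ℝ f (x₀, p₀)) :
    AnalyticAt ℝ (fun y : ℝ × P => ∫ s in x₀..y.1, f (s, y.2)) (x₀, p₀) := by
  have h0 : AnalyticAt ℝ (fun y : ℝ × P => f ((x₀, p₀) + y)) 0 := by
    refine AnalyticAt.fun_comp (g := f) ?_ (by fun_prop)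
    simpa using hf
  obtain ⟨p, r, hp⟩ := h0
  -- Rescaling writes the integral from `x₀` to `x` as `x - x₀` times an average over the unit
  -- interval; `D s` multiplies the first coordinate by `s` and keeps the parameter.
  let D : ℝ → (ℝ × P) →L[ℝ] (ℝ × P) := fun s =>
    s • (ContinuousLinearMap.inl ℝ ℝ P).comp (ContinuousLinearMap.fst ℝ ℝ P) +
      (ContinuousLinearMap.inr ℝ ℝ P).comp (ContinuousLinearMap.snd ℝ ℝ P)
  have hDa : ∀ s y, D s y = (s * y.1, y.2) := by
    intro s y; simp [D]
  have hD : Continuous D := by fun_prop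
  have hD1 : ∀ s ∈ Set.uIoc (0 : ℝ) 1, ‖D s‖ ≤ 1 := by
    intro s hs
    rw [Set.uIoc_of_le zero_le_one] at hs
    refine ContinuousLinearMap.opNorm_le_bound _ zero_le_one fun y => ?_
    rw [hDa, one_mul, Prod.norm_def, Prod.norm_def]
    refine max_le_max ?_ le_rfl
    rw [norm_mul, Real.norm_eq_abs, abs_of_pos hs.1]
    exact mul_le_of_le_one_left (norm_nonneg _) hs.2
  have h1 := hp.integral_comp_clm hD hD1
  have h2 : AnalyticAt ℝ (fun y : ℝ × P => (y.1 - x₀) *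
      ∫ s in (0 : ℝ)..1, f ((x₀, p₀) + D s (y - (x₀, p₀)))) (x₀, p₀) := by
    refine AnalyticAt.mul (analyticAt_fst.sub analyticAt_const) ?_
    refine AnalyticAt.fun_comp (g := fun y => ∫ s in (0 : ℝ)..1, f ((x₀, p₀) + D s y)) ?_
      (by fun_prop)
    simpa using h1
  convert h2 using 2 with y
  simp only [hDa]
  have := intervalIntegral.smul_integral_comp_add_mul (a := 0) (b := 1)
    (fun s => f (s, y.2)) (y.1 - x₀) x₀
  simp only [smul_eq_mul, mul_zero, add_zero, mul_one, add_sub_cancel] at this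
  rw [← this]
  congr 1
  refine intervalIntegral.integral_congr fun s _ => ?_
  simp [mul_comm]

/-- A parametric primitive of an analytic function is analytic. -/
theorem ContDiffAt.parametric_primitive {P : Type*} [NormedAddCommGroup P] [NormedSpace ℝ P]
    {f : ℝ × P → ℝ} {p₀ : P} (hf : ∀ x, ContDiffAt ℝ ω f (x, p₀)) (hc : ∀ᶠ p in 𝓝 p₀,
      Continuous fun s => f (s, p)) (x : ℝ) :
    ContDiffAt ℝ ω (fun y : ℝ × P => ∫ s in (0 : ℝ)..y.1, f (s, y.2)) (x, p₀) := by
  -- The endpoints at which the claim holds form a clopen set containing 0: a small move of the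
  -- endpoint adds only an integral that is already known to be analytic.
  let S : Set ℝ :=
    {x | AnalyticAt ℝ (fun y : ℝ × P => ∫ s in (0 : ℝ)..y.1, f (s, y.2)) (x, p₀)}
  have hloc : ∀ x : ℝ, ∀ᶠ x' in 𝓝 x, (x' ∈ S ↔ x ∈ S) := by
    intro x
    have h1 : AnalyticAt ℝ (fun y : ℝ × P => ∫ s in x..y.1, f (s, y.2)) (x, p₀) :=
      (hf x).analyticAt.integral_from
    have hcurve : Filter.Tendsto (fun x' : ℝ => (x', p₀)) (𝓝 x) (𝓝 (x, p₀)) :=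
      (Continuous.prodMk_left p₀).tendsto x
    filter_upwards [hcurve.eventually h1.eventually_analyticAt] with x' hx'
    have base : ∀ x₁ : ℝ, x₁ ∈ S → AnalyticAt ℝ
        (fun y : ℝ × P => ∫ s in (0 : ℝ)..x₁, f (s, y.2)) (x₁, p₀) := fun x₁ h =>
      AnalyticAt.fun_comp (g := fun y : ℝ × P => ∫ s in (0 : ℝ)..y.1, f (s, y.2))
        (f := fun y : ℝ × P => (x₁, y.2)) h
        (analyticAt_const.prod analyticAt_snd)
    have move : ∀ (x₁ x₂ : ℝ) (h : P → ℝ),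
        AnalyticAt ℝ (fun y : ℝ × P => h y.2) (x₁, p₀) →
        AnalyticAt ℝ (fun y : ℝ × P => h y.2) (x₂, p₀) := fun x₁ x₂ h hh =>
      AnalyticAt.fun_comp (g := fun y : ℝ × P => h y.2) (f := fun y : ℝ × P => (x₁, y.2)) hh
        (analyticAt_const.prod analyticAt_snd)
    have split : ∀ x₂ : ℝ, ∀ᶠ y : ℝ × P in 𝓝 (x₂, p₀),
        ∫ s in (0 : ℝ)..y.1, f (s, y.2) =
          (∫ s in (0 : ℝ)..x, f (s, y.2)) + ∫ s in x..y.1, f (s, y.2) := by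
      intro x₂
      have := (continuous_snd.tendsto (x₂, p₀)).eventually hc
      filter_upwards [this] with y hy
      exact (intervalIntegral.integral_add_adjacent_intervals
        (hy.intervalIntegrable _ _) (hy.intervalIntegrable _ _)).symm
    constructor
    · intro h
      have h3 : AnalyticAt ℝ (fun y : ℝ × P => ∫ s in (0 : ℝ)..x, f (s, y.2)) (x', p₀) := by
        refine (AnalyticAt.sub h hx').congr ?_
        filter_upwards [split x'] with y hy
        simp [hy]
      refine (AnalyticAt.add (move x' x (fun p => ∫ s in (0 : ℝ)..x, f (s, p)) h3) h1).congr ?_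
      filter_upwards [split x] with y hy
      simp [hy]
    · intro h
      refine (AnalyticAt.add (move x x' (fun p => ∫ s in (0 : ℝ)..x, f (s, p)) (base x h))
        hx').congr ?_
      filter_upwards [split x'] with y hy
      simp [hy]
  have hclopen : IsClopen S := by
    constructor
    · rw [← isOpen_compl_iff, isOpen_iff_mem_nhds]
      intro x hx
      filter_upwards [hloc x] with x' hx' using fun h => hx (hx'.1 h)
    · rw [isOpen_iff_mem_nhds]
      intro x hx
      filter_upwards [hloc x] with x' hx' using hx'.2 hx
  have hne : S.Nonempty := ⟨0, (hf 0).analyticAt.integral_from⟩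
  have : x ∈ S := by
    rw [hclopen.eq_univ hne]; trivial
  exact AnalyticAt.contDiffAt this

/-- The inverse of an analytic family of increasing bijections of `ℝ` is analytic. -/
theorem ContDiffAt.parametric_inverse {P : Type*} [NormedAddCommGroup P] [NormedSpace ℝ P]
    [CompleteSpace P] {F g : ℝ × P → ℝ} {x₀ : ℝ} {p₀ : P} {E : Set P} (hE : IsOpen E)
    (hp₀ : p₀ ∈ E) (hF : ContDiffAt ℝ ω F (x₀, p₀)) {b : ℝ} (hb : b ≠ 0)
    (hF' : HasDerivAt (fun x => F (x, p₀)) b x₀)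
    (hg : ∀ x, ∀ p ∈ E, g (F (x, p), p) = x) :
    ContDiffAt ℝ ω g (F (x₀, p₀), p₀) := by
  have hdiff : DifferentiableAt ℝ F (x₀, p₀) := hF.differentiableAt (by simp)
  let L : ℝ × P →L[ℝ] ℝ := fderiv ℝ F (x₀, p₀)
  have hL : HasFDerivAt F L (x₀, p₀) := hdiff.hasFDerivAt
  have hLb : L (1, 0) = b := by
    have h1 : HasDerivAt (fun x : ℝ => (x, p₀)) ((1 : ℝ), (0 : P)) x₀ :=
      (hasDerivAt_id x₀).prodMk (hasDerivAt_const x₀ p₀)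
    exact (hL.comp_hasDerivAt x₀ h1).unique hF'
  have hLs : ∀ y : ℝ × P, L y = b * y.1 + L (0, y.2) := by
    intro y
    have : y = y.1 • ((1 : ℝ), (0 : P)) + (0, y.2) := by ext <;> simp
    conv_lhs => rw [this, map_add, map_smul, hLb]
    simp [mul_comm]
  -- The inverse function theorem is applied to `(x, p) ↦ (F (x, p), p)`, whose derivative is
  -- triangular with diagonal entries `b` and the identity.
  let eqv : (ℝ × P) ≃L[ℝ] (ℝ × P) := ContinuousLinearEquiv.equivOfInverse
    (L.prod (ContinuousLinearMap.snd ℝ ℝ P))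
    ((b⁻¹ • (ContinuousLinearMap.fst ℝ ℝ P -
      L.comp ((ContinuousLinearMap.inr ℝ ℝ P).comp (ContinuousLinearMap.snd ℝ ℝ P)))).prod
        (ContinuousLinearMap.snd ℝ ℝ P))
    (by intro y; ext <;> simp [hLs y, hb]) (by
      intro y
      ext
      · simp only [ContinuousLinearMap.prod_apply]
        rw [hLs]
        simp [hb]
      · simp)
  let G : ℝ × P → ℝ × P := fun y => (F y, y.2)
  have hG : ContDiffAt ℝ ω G (x₀, p₀) := hF.prodMk contDiffAt_snd
  have hG' : HasFDerivAt G (eqv : (ℝ × P) →L[ℝ] (ℝ × P)) (x₀, p₀) :=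
    hL.prodMk hasFDerivAt_snd
  have hloc := hG.to_localInverse hG' (by simp)
  refine ContDiffAt.congr_of_eventuallyEq (contDiffAt_fst.comp _ hloc) ?_
  have hright : ∀ᶠ y in 𝓝 (G (x₀, p₀)), G (hG.localInverse hG' (by simp) y) = y :=
    (hG.hasStrictFDerivAt' hG' (by simp)).eventually_right_inverse
  have hmem : ∀ᶠ y : ℝ × P in 𝓝 (G (x₀, p₀)), y.2 ∈ E :=
    (continuous_snd.tendsto (G (x₀, p₀))).eventually (hE.mem_nhds hp₀)
  -- At the local inverse `z` of `y` one has `F z = y.1`, and `g` returns the first component of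
  -- `z`; hence `g` coincides with that component near the point.
  filter_upwards [hright, hmem] with y hy hyE
  set z := hG.localInverse hG' (by simp) y with hz
  have h2 : z.2 = y.2 := (congrArg Prod.snd hy : (G z).2 = y.2)
  have h1 : F z = y.1 := (congrArg Prod.fst hy : (G z).1 = y.1)
  have := hg z.1 y.2 hyE
  rw [← h2] at this
  simp only [Prod.mk.eta, h1] at this
  rw [h2] at this
  simpa using this

/-! ### Time and phase as primitives of periodic densities. -/

section PeriodicIntegrals

variable {P : Type*} {f h : ℝ × P → ℝ} {p : P}

/-- The integral of `f (·, p)` over the period `2π`. -/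
noncomputable def periodIntegral (f : ℝ × P → ℝ) (p : P) : ℝ :=
  ∫ s in (0 : ℝ)..(2 * Real.pi), f (s, p)

/-- The primitive of `f (·, p)`, normalized to increase by one over the period `2π`. -/
noncomputable def normalizedPrimitive (f : ℝ × P → ℝ) (y : ℝ × P) : ℝ :=
  (∫ s in (0 : ℝ)..y.1, f (s, y.2)) / periodIntegral f y.2

/-- The inverse of the normalized primitive. -/
noncomputable def normalizedInverse (f : ℝ × P → ℝ) (y : ℝ × P) : ℝ :=
  Function.invFun (fun x => normalizedPrimitive f (x, y.2)) y.1

/-- The periodic part of the primitive of `h`, in the time scale that belongs to `f`. -/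
noncomputable def periodicPart (f h : ℝ × P → ℝ) (y : ℝ × P) : ℝ :=
  (∫ s in (0 : ℝ)..y.1, h (s, y.2)) - periodIntegral h y.2 * normalizedPrimitive f y

theorem integral_add_two_pi (hc : Continuous fun s => h (s, p))
    (hper : Function.Periodic (fun s => h (s, p)) (2 * Real.pi)) (x : ℝ) :
    ∫ s in (0 : ℝ)..(x + 2 * Real.pi), h (s, p) =
      (∫ s in (0 : ℝ)..x, h (s, p)) + periodIntegral h p := by
  have h1 := hper.intervalIntegral_add_eq x 0
  rw [zero_add] at h1
  rw [periodIntegral, ← h1]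
  exact (intervalIntegral.integral_add_adjacent_intervals
    (hc.intervalIntegrable _ _) (hc.intervalIntegrable _ _)).symm

theorem periodIntegral_pos (hc : Continuous fun s => f (s, p)) (hpos : ∀ s, 0 < f (s, p)) :
    0 < periodIntegral f p :=
  intervalIntegral.intervalIntegral_pos_of_pos (hc.intervalIntegrable _ _) hpos (by positivity)

theorem normalizedPrimitive_add_two_pi (hc : Continuous fun s => f (s, p))
    (hpos : ∀ s, 0 < f (s, p)) (hper : Function.Periodic (fun s => f (s, p)) (2 * Real.pi))
    (x : ℝ) : normalizedPrimitive f (x + 2 * Real.pi, p) = normalizedPrimitive f (x, p) + 1 := by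
  have := (periodIntegral_pos hc hpos).ne'
  simp only [normalizedPrimitive]
  rw [integral_add_two_pi hc hper, add_div, div_self this]

theorem periodicPart_add_two_pi (hc : Continuous fun s => f (s, p))
    (hpos : ∀ s, 0 < f (s, p)) (hper : Function.Periodic (fun s => f (s, p)) (2 * Real.pi))
    (hhc : Continuous fun s => h (s, p))
    (hhper : Function.Periodic (fun s => h (s, p)) (2 * Real.pi)) (x : ℝ) :
    periodicPart f h (x + 2 * Real.pi, p) = periodicPart f h (x, p) := by
  simp only [periodicPart]
  rw [normalizedPrimitive_add_two_pi hc hpos hper, integral_add_two_pi hhc hhper]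
  ring

theorem hasDerivAt_normalizedPrimitive (hc : Continuous fun s => f (s, p)) (x : ℝ) :
    HasDerivAt (fun x => normalizedPrimitive f (x, p)) (f (x, p) / periodIntegral f p) x := by
  simp only [normalizedPrimitive]
  exact (intervalIntegral.integral_hasDerivAt_right (hc.intervalIntegrable 0 x)
    (hc.stronglyMeasurableAtFilter _ _) hc.continuousAt).div_const _

theorem hasDerivAt_periodicPart (hc : Continuous fun s => f (s, p))
    (hhc : Continuous fun s => h (s, p)) (x : ℝ) :
    HasDerivAt (fun x => periodicPart f h (x, p))
      (h (x, p) - periodIntegral h p * (f (x, p) / periodIntegral f p)) x := by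
  simp only [periodicPart]
  exact (intervalIntegral.integral_hasDerivAt_right (hhc.intervalIntegrable 0 x)
    (hhc.stronglyMeasurableAtFilter _ _) hhc.continuousAt).sub
      ((hasDerivAt_normalizedPrimitive hc x).const_mul _)

theorem strictMono_normalizedPrimitive (hc : Continuous fun s => f (s, p))
    (hpos : ∀ s, 0 < f (s, p)) : StrictMono fun x => normalizedPrimitive f (x, p) := by
  refine strictMono_of_deriv_pos fun x => ?_
  rw [(hasDerivAt_normalizedPrimitive hc x).deriv]
  exact div_pos (hpos x) (periodIntegral_pos hc hpos)

theorem surjective_normalizedPrimitive (hc : Continuous fun s => f (s, p))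
    (hpos : ∀ s, 0 < f (s, p)) (hper : Function.Periodic (fun s => f (s, p)) (2 * Real.pi)) :
    Function.Surjective fun x => normalizedPrimitive f (x, p) := by
  have hcont : Continuous fun x => normalizedPrimitive f (x, p) :=
    continuous_iff_continuousAt.2 fun x => (hasDerivAt_normalizedPrimitive hc x).continuousAt
  have hzero : normalizedPrimitive f (0, p) = 0 := by simp [normalizedPrimitive]
  -- The integer values are attained at the multiples of the period; the intermediate value theorem
  -- supplies all others.
  have hint : ∀ n : ℤ, normalizedPrimitive f (n * (2 * Real.pi), p) = n := by
    intro n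
    induction n with
    | zero => simpa using hzero
    | succ n ih =>
      have := normalizedPrimitive_add_two_pi hc hpos hper (n * (2 * Real.pi))
      push_cast at ih ⊢
      rw [add_mul, one_mul, this, ih]
    | pred n ih =>
      have := normalizedPrimitive_add_two_pi hc hpos hper ((-(n : ℝ) - 1) * (2 * Real.pi))
      push_cast at ih ⊢
      rw [show (-(n : ℝ) - 1) * (2 * Real.pi) + 2 * Real.pi = -(n : ℝ) * (2 * Real.pi) by ring,
        ih] at this
      linarith
  intro y
  have h1 := hint ⌊y⌋
  have h2 := hint (⌊y⌋ + 1)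
  obtain ⟨x, hx⟩ := mem_range_of_exists_le_of_exists_ge hcont
    ⟨_, h1.trans_le (Int.floor_le y)⟩ ⟨_, ((Int.lt_floor_add_one y).le.trans_eq (by
      rw [h2]; push_cast; rfl))⟩
  exact ⟨x, hx⟩

theorem normalizedInverse_normalizedPrimitive (hc : Continuous fun s => f (s, p))
    (hpos : ∀ s, 0 < f (s, p)) (x : ℝ) :
    normalizedInverse f (normalizedPrimitive f (x, p), p) = x :=
  Function.leftInverse_invFun (strictMono_normalizedPrimitive hc hpos).injective x

theorem normalizedPrimitive_normalizedInverse (hc : Continuous fun s => f (s, p))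
    (hpos : ∀ s, 0 < f (s, p)) (hper : Function.Periodic (fun s => f (s, p)) (2 * Real.pi))
    (x : ℝ) : normalizedPrimitive f (normalizedInverse f (x, p), p) = x :=
  Function.rightInverse_invFun (surjective_normalizedPrimitive hc hpos hper) x

theorem normalizedInverse_add_one (hc : Continuous fun s => f (s, p))
    (hpos : ∀ s, 0 < f (s, p)) (hper : Function.Periodic (fun s => f (s, p)) (2 * Real.pi))
    (x : ℝ) : normalizedInverse f (x + 1, p) = normalizedInverse f (x, p) + 2 * Real.pi := by
  apply (strictMono_normalizedPrimitive hc hpos).injective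
  simp only
  rw [normalizedPrimitive_normalizedInverse hc hpos hper,
    normalizedPrimitive_add_two_pi hc hpos hper,
    normalizedPrimitive_normalizedInverse hc hpos hper]

theorem hasDerivAt_normalizedInverse (hc : Continuous fun s => f (s, p))
    (hpos : ∀ s, 0 < f (s, p)) (hper : Function.Periodic (fun s => f (s, p)) (2 * Real.pi))
    (x : ℝ) : HasDerivAt (fun x => normalizedInverse f (x, p))
      (periodIntegral f p / f (normalizedInverse f (x, p), p)) x := by
  have hmono := strictMono_normalizedPrimitive hc hpos
  have hinv : Function.RightInverse (fun x => normalizedInverse f (x, p))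
      (fun x => normalizedPrimitive f (x, p)) := fun x =>
    normalizedPrimitive_normalizedInverse hc hpos hper x
  have hcont : Continuous fun x => normalizedInverse f (x, p) := by
    let e : ℝ ≃o ℝ := StrictMono.orderIsoOfRightInverse _ hmono _ hinv
    exact e.symm.continuous
  have h1 := hasDerivAt_normalizedPrimitive hc (normalizedInverse f (x, p))
  have h2 := h1.of_local_left_inverse hcont.continuousAt
    (div_pos (hpos _) (periodIntegral_pos hc hpos)).ne'
    (Filter.Eventually.of_forall fun y => hinv y)
  rwa [inv_div] at h2

variable [NormedAddCommGroup P] [NormedSpace ℝ P]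

theorem contDiffAt_periodIntegral (hf : ∀ x, ContDiffAt ℝ ω h (x, p))
    (hc : ∀ᶠ p in 𝓝 p, Continuous fun s => h (s, p)) :
    ContDiffAt ℝ ω (periodIntegral h) p := by
  have := ContDiffAt.parametric_primitive hf hc (2 * Real.pi)
  exact ContDiffAt.comp p (f := fun p : P => (2 * Real.pi, p)) this (by fun_prop)

theorem contDiffAt_normalizedPrimitive (hf : ∀ x, ContDiffAt ℝ ω f (x, p))
    (hc : ∀ᶠ p in 𝓝 p, Continuous fun s => f (s, p)) (hpos : ∀ s, 0 < f (s, p)) (x : ℝ) :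
    ContDiffAt ℝ ω (normalizedPrimitive f) (x, p) := by
  refine (ContDiffAt.parametric_primitive hf hc x).div ?_
    (periodIntegral_pos hc.self_of_nhds hpos).ne'
  exact ContDiffAt.comp (x, p) (f := fun y : ℝ × P => y.2)
    (contDiffAt_periodIntegral hf hc) contDiffAt_snd

theorem contDiffAt_periodicPart (hf : ∀ x, ContDiffAt ℝ ω f (x, p))
    (hc : ∀ᶠ p in 𝓝 p, Continuous fun s => f (s, p)) (hpos : ∀ s, 0 < f (s, p))
    (hh : ∀ x, ContDiffAt ℝ ω h (x, p))
    (hhc : ∀ᶠ p in 𝓝 p, Continuous fun s => h (s, p)) (x : ℝ) :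
    ContDiffAt ℝ ω (periodicPart f h) (x, p) := by
  refine (ContDiffAt.parametric_primitive hh hhc x).sub
    (ContDiffAt.mul ?_ (contDiffAt_normalizedPrimitive hf hc hpos x))
  exact ContDiffAt.comp (x, p) (f := fun y : ℝ × P => y.2)
    (contDiffAt_periodIntegral hh hhc) contDiffAt_snd

theorem contDiffAt_normalizedInverse [CompleteSpace P] {E : Set P} (hE : IsOpen E) (hp : p ∈ E)
    (hf : ∀ x, ContDiffAt ℝ ω f (x, p))
    (hc : ∀ p ∈ E, Continuous fun s => f (s, p)) (hpos : ∀ p ∈ E, ∀ s, 0 < f (s, p))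
    (hper : Function.Periodic (fun s => f (s, p)) (2 * Real.pi)) (x : ℝ) :
    ContDiffAt ℝ ω (normalizedInverse f) (x, p) := by
  have h1 := contDiffAt_normalizedPrimitive hf
    (Filter.eventually_of_mem (hE.mem_nhds hp) hc) (hpos p hp) (normalizedInverse f (x, p))
  have h2 := ContDiffAt.parametric_inverse hE hp h1
    (div_pos (hpos p hp _) (periodIntegral_pos (hc p hp) (hpos p hp))).ne'
    (hasDerivAt_normalizedPrimitive (hc p hp) _) (g := normalizedInverse f)
    (fun x p hp => normalizedInverse_normalizedPrimitive (hc p hp) (hpos p hp) x)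
  rwa [normalizedPrimitive_normalizedInverse (hc p hp) (hpos p hp) hper] at h2

end PeriodicIntegrals

/-! ### Vector algebra and rotations. -/

namespace Chaplygin

theorem cross_zero (v w : Vec) : (v ⨯₃ w) 0 = v 1 * w 2 - v 2 * w 1 := by simp [cross_apply]

theorem cross_one (v w : Vec) : (v ⨯₃ w) 1 = v 2 * w 0 - v 0 * w 2 := by simp [cross_apply]

theorem cross_two (v w : Vec) : (v ⨯₃ w) 2 = v 0 * w 1 - v 1 * w 0 := by simp [cross_apply]

theorem dot_eq (v w : Vec) : v ⬝ᵥ w = v 0 * w 0 + v 1 * w 1 + v 2 * w 2 := by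
  simp [dotProduct, Fin.sum_univ_three]

theorem vec_ext {v w : Vec} (h0 : v 0 = w 0) (h1 : v 1 = w 1) (h2 : v 2 = w 2) : v = w := by
  ext i
  fin_cases i
  exacts [h0, h1, h2]

theorem transpose_mul_self {A : Mat} (hA : A ∈ SO3) : Aᵀ * A = 1 := mul_eq_one_comm.mp hA.1

theorem transpose_mulVec_mulVec {A : Mat} (hA : A ∈ SO3) (v : Vec) : Aᵀ *ᵥ (A *ᵥ v) = v := by
  rw [mulVec_mulVec, transpose_mul_self hA, one_mulVec]

theorem mulVec_transpose_mulVec {A : Mat} (hA : A ∈ SO3) (v : Vec) : A *ᵥ (Aᵀ *ᵥ v) = v := by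
  rw [mulVec_mulVec, hA.1, one_mulVec]

theorem transpose_mem_SO3 {A : Mat} (hA : A ∈ SO3) : Aᵀ ∈ SO3 :=
  ⟨by simpa using transpose_mul_self hA, by simpa using hA.2⟩

theorem mul_mem_SO3 {A B : Mat} (hA : A ∈ SO3) (hB : B ∈ SO3) : A * B ∈ SO3 := by
  refine ⟨?_, by simp [hA.2, hB.2]⟩
  rw [transpose_mul, Matrix.mul_assoc, ← Matrix.mul_assoc B, hB.1, Matrix.one_mul, hA.1]

theorem mulVec_dotProduct (A : Mat) (v w : Vec) : (A *ᵥ v) ⬝ᵥ w = v ⬝ᵥ (Aᵀ *ᵥ w) := by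
  rw [dotProduct_mulVec, vecMul_transpose]

theorem mulVec_dotProduct_mulVec {A : Mat} (hA : A ∈ SO3) (v w : Vec) :
    (A *ᵥ v) ⬝ᵥ (A *ᵥ w) = v ⬝ᵥ w := by
  rw [mulVec_dotProduct, transpose_mulVec_mulVec hA]

/-- For every matrix the cross product of two images is the cofactor matrix applied to the cross
product. On SO(3) the cofactor matrix of `A` is `A` itself. -/
theorem mulVec_cross_mulVec {A : Mat} (hA : A ∈ SO3) (v w : Vec) :
    (A *ᵥ v) ⨯₃ (A *ᵥ w) = A *ᵥ (v ⨯₃ w) := by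
  have hadj : A.adjugate = Aᵀ := by
    have h1 : A.adjugate * A = 1 := by rw [adjugate_mul, hA.2, one_smul]
    calc A.adjugate = A.adjugate * (A * Aᵀ) := by rw [hA.1, Matrix.mul_one]
      _ = Aᵀ := by rw [← Matrix.mul_assoc, h1, Matrix.one_mul]
  have key : (A *ᵥ v) ⨯₃ (A *ᵥ w) = A.adjugateᵀ *ᵥ (v ⨯₃ w) := by
    rw [adjugate_fin_three]
    ext i
    fin_cases i <;>
      simp [cross_apply, Matrix.mulVec, dotProduct, Fin.sum_univ_three] <;> ring
  rw [key, hadj, transpose_transpose]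

/-- Column by column this is `mulVec_cross_mulVec`. It converts an angular velocity in the body into
one in space. -/
theorem mul_hat {A : Mat} (hA : A ∈ SO3) (v : Vec) : A * hat v = hat (A *ᵥ v) * A := by
  ext1 i j
  have h := congrFun (mulVec_cross_mulVec hA v (Pi.single j 1)) i
  rw [← hat_mulVec, ← hat_mulVec, mulVec_mulVec, mulVec_mulVec] at h
  simpa [mulVec_single] using h.symm

theorem dot_self_pos {v : Vec} (hv : v ≠ 0) : 0 < v ⬝ᵥ v := by
  have h0 : 0 ≤ v ⬝ᵥ v := Finset.sum_nonneg fun i _ => mul_self_nonneg _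
  exact lt_of_le_of_ne h0 fun h => hv (dotProduct_self_eq_zero.1 h.symm)

theorem vert_dot_self {A : Mat} (hA : A ∈ SO3) : vert A ⬝ᵥ vert A = 1 := by
  rw [vert, mulVec_dotProduct_mulVec (transpose_mem_SO3 hA)]
  simp [e₃, dotProduct, Fin.sum_univ_three]

theorem mulVec_vert {A : Mat} (hA : A ∈ SO3) : A *ᵥ vert A = e₃ := mulVec_transpose_mulVec hA _

theorem vert_dot {A : Mat} (w : Vec) : vert A ⬝ᵥ w = (A *ᵥ w) 2 := by
  rw [vert, mulVec_dotProduct, transpose_transpose]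
  simp [e₃, dotProduct, Fin.sum_univ_three]

/-! ### The spin vector and the two quadrics that contain it. -/

/-- The inertia tensor with axis of symmetry `d` and principal moments `a`, `a`, `a + k`. -/
def axialInertia (a k : ℝ) (d : Vec) : Mat := a • (1 : Mat) + k • vecMulVec d d

theorem axialInertia_mulVec (a k : ℝ) (d v : Vec) :
    axialInertia a k d *ᵥ v = a • v + (k * (d ⬝ᵥ v)) • d := by
  rw [axialInertia, add_mulVec, smul_mulVec, one_mulVec, smul_mulVec, vecMulVec_mulVec]
  simp [smul_smul]

theorem double_cross (u w : Vec) : u ⨯₃ (w ⨯₃ u) = (u ⬝ᵥ u) • w - (u ⬝ᵥ w) • u := by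
  ext i
  fin_cases i <;> simp [cross_apply, dotProduct, Fin.sum_univ_three] <;> ring

/-- In space coordinates the vertical is constant, so the moment becomes linear in `A ω` and the
spin vector. -/
theorem moment_eq {a k m r : ℝ} {d : Vec} {x : Mat × Vec} (hx : x ∈ phaseSpace) :
    moment (axialInertia a k d) m r x =
      a • (x.1 *ᵥ x.2) + (k * (d ⬝ᵥ x.2)) • (x.1 *ᵥ d) +
        (m * r ^ 2) • (x.1 *ᵥ x.2 - (x.1 *ᵥ x.2) 2 • e₃) := by
  rw [moment, axialInertia_mulVec, double_cross, vert_dot_self hx, vert_dot]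
  simp only [mulVec_add, mulVec_smul, mulVec_sub, mulVec_vert hx, one_smul]

/-- The energy is half the quadratic form of the symmetric operator that takes the angular velocity
to the moment; Lagrange's identity rewrites |u × ω|² as |ω|² - ⟨u, ω⟩². -/
theorem kineticEnergy_eq {a k m r : ℝ} {d : Vec} {x : Mat × Vec} (hx : x ∈ phaseSpace) :
    2 * kineticEnergy (axialInertia a k d) m r x =
      moment (axialInertia a k d) m r x ⬝ᵥ (x.1 *ᵥ x.2) := by
  have h1 : (vert x.1 ⨯₃ x.2) ⬝ᵥ (vert x.1 ⨯₃ x.2) =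
      x.2 ⬝ᵥ x.2 - ((x.1 *ᵥ x.2) 2) ^ 2 := by
    rw [cross_dot_cross, vert_dot_self hx, vert_dot, dotProduct_comm x.2 (vert x.1), vert_dot]
    ring
  have h2 : e₃ ⬝ᵥ (x.1 *ᵥ x.2) = (x.1 *ᵥ x.2) 2 := by
    simp [e₃, dotProduct, Fin.sum_univ_three]
  rw [moment_eq hx, kineticEnergy, h1, axialInertia_mulVec]
  simp only [add_dotProduct, smul_dotProduct, sub_dotProduct, mulVec_dotProduct_mulVec hx,
    smul_eq_mul, h2]
  ring

/-- The linear map `v ↦ (α v₀, α v₁, γ v₂)`. -/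
def diagMul (α γ : ℝ) (v : Vec) : Vec := ![α * v 0, α * v 1, γ * v 2]

@[simp] theorem diagMul_zero (α γ : ℝ) (v : Vec) : diagMul α γ v 0 = α * v 0 := rfl

@[simp] theorem diagMul_one (α γ : ℝ) (v : Vec) : diagMul α γ v 1 = α * v 1 := rfl

@[simp] theorem diagMul_two (α γ : ℝ) (v : Vec) : diagMul α γ v 2 = γ * v 2 := rfl

@[simp] theorem e₃_zero : e₃ 0 = 0 := rfl

@[simp] theorem e₃_one : e₃ 1 = 0 := rfl

@[simp] theorem e₃_two : e₃ 2 = 1 := rfl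

/-- The angular velocity of the sphere with vanishing spin that belongs to the moment `j`. -/
noncomputable def spinlessVelocity (a μ : ℝ) (j : Vec) : Vec := diagMul (a + μ)⁻¹ a⁻¹ j

/-- The horizontal weight of the quadratic form that defines the level curves. -/
noncomputable def horWeight (a k μ : ℝ) : ℝ := 1 + k / (a + μ)

/-- The vertical weight of the quadratic form that defines the level curves. -/
noncomputable def verWeight (a k : ℝ) : ℝ := 1 + k / a

/-- The common value of the linear and of the quadratic form on the spin vector. -/
noncomputable def spinConst (a k μ : ℝ) (c : Vec × ℝ) : ℝ :=
  (c.1 ⬝ᵥ spinlessVelocity a μ c.1 - 2 * c.2) / k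

/-- The spin vector `⟨ω, d⟩ A d`. -/
def spin (d : Vec) (x : Mat × Vec) : Vec := (d ⬝ᵥ x.2) • (x.1 *ᵥ d)

variable {a k m r : ℝ} {d : Vec} {x : Mat × Vec}

theorem horWeight_pos {μ : ℝ} (ha : 0 < a) (hμ : 0 < μ) (hb : 0 < a + k) :
    0 < horWeight a k μ := by
  have : 0 < a + μ := by positivity
  rw [horWeight, one_add_div this.ne']
  exact div_pos (by linarith) this

theorem verWeight_pos (ha : 0 < a) (hb : 0 < a + k) : 0 < verWeight a k := by
  rw [verWeight, one_add_div ha.ne']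
  exact div_pos hb ha

/-- Here `moment_eq` is solved for `A ω`. The weights are 1 plus `k` over the diagonal entries `a +
μ` and `a`. The spin vector is split off because the rest, J - C N, turns out to be orthogonal to
it. -/
theorem velocity_eq (ha : 0 < a) (hμ : 0 < m * r ^ 2) (hx : x ∈ phaseSpace) :
    x.1 *ᵥ x.2 = spinlessVelocity a (m * r ^ 2) (moment (axialInertia a k d) m r x) +
      spin d x - diagMul (horWeight a k (m * r ^ 2)) (verWeight a k) (spin d x) := by
  have h1 : a + m * r ^ 2 ≠ 0 := by positivity
  have h2 : a ≠ 0 := ha.ne'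
  rw [moment_eq hx]
  generalize x.1 *ᵥ x.2 = W
  rw [spin]
  generalize x.1 *ᵥ d = n
  generalize m * r ^ 2 = μ at *
  ext i
  fin_cases i <;> simp [spinlessVelocity, horWeight, verWeight] <;> field_simp <;>
    ring

theorem moment_of_velocity (ha : 0 < a) (hμ : 0 < m * r ^ 2) (hx : x ∈ phaseSpace) {j : Vec}
    (h : x.1 *ᵥ x.2 = spinlessVelocity a (m * r ^ 2) j + spin d x -
      diagMul (horWeight a k (m * r ^ 2)) (verWeight a k) (spin d x)) :
    moment (axialInertia a k d) m r x = j := by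
  have h1 := (velocity_eq (k := k) (d := d) ha hμ hx).symm.trans h
  have h3 : a + m * r ^ 2 ≠ 0 := by positivity
  have h4 : a ≠ 0 := ha.ne'
  have h2 : spinlessVelocity a (m * r ^ 2) (moment (axialInertia a k d) m r x) =
    spinlessVelocity a (m * r ^ 2) j := by
    simpa using h1
  ext i
  have h5 := congrFun h2 i
  fin_cases i <;> simpa [spinlessVelocity, h3, h4] using h5

theorem spin_dot_velocity (hd : d ⬝ᵥ d = 1) (hx : x ∈ phaseSpace) :
    spin d x ⬝ᵥ (x.1 *ᵥ x.2) = spin d x ⬝ᵥ spin d x := by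
  simp only [spin, smul_dotProduct, dotProduct_smul, mulVec_dotProduct_mulVec hx, hd, smul_eq_mul]
  ring

/-- Pairing `velocity_eq` with the spin vector N and using ⟨N, A ω⟩ = ⟨N, N⟩ leaves an equation
without the velocity. Together with `spinConst_eq` it places N on a plane and on an ellipsoid. -/
theorem spin_dot_diagMul_spin (hd : d ⬝ᵥ d = 1) (ha : 0 < a) (hμ : 0 < m * r ^ 2)
    (hx : x ∈ phaseSpace) :
    spin d x ⬝ᵥ diagMul (horWeight a k (m * r ^ 2)) (verWeight a k) (spin d x) =
      spin d x ⬝ᵥ spinlessVelocity a (m * r ^ 2) (moment (axialInertia a k d) m r x) := by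
  have h1 := spin_dot_velocity hd hx
  rw [velocity_eq (k := k) (d := d) ha hμ hx, dotProduct_sub, dotProduct_add] at h1
  linarith

/-- Pairing `velocity_eq` with j gives 2T = ⟨j, J⟩ - k ⟨N, J⟩, so for `k ≠ 0` the energy fixes the
plane of the spin vector. -/
theorem spinConst_eq (hk : k ≠ 0) (ha : 0 < a) (hμ : 0 < m * r ^ 2) (hx : x ∈ phaseSpace) :
    spinConst a k (m * r ^ 2) (momentEnergy (axialInertia a k d) m r x) =
      spin d x ⬝ᵥ spinlessVelocity a (m * r ^ 2) (moment (axialInertia a k d) m r x) := by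
  have h1 : a + m * r ^ 2 ≠ 0 := by positivity
  have h2 : a ≠ 0 := ha.ne'
  rw [spinConst, momentEnergy]
  simp only
  rw [kineticEnergy_eq hx, velocity_eq (k := k) (d := d) ha hμ hx, div_eq_iff hk]
  generalize moment (axialInertia a k d) m r x = j
  generalize spin d x = N
  generalize m * r ^ 2 = μ at *
  simp [spinlessVelocity, horWeight, verWeight, dotProduct, Fin.sum_univ_three]
  field_simp
  ring

theorem energy_of_spinConst (hk : k ≠ 0) (ha : 0 < a) (hμ : 0 < m * r ^ 2) (hx : x ∈ phaseSpace)
    {c : Vec × ℝ} (h1 : moment (axialInertia a k d) m r x = c.1)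
    (h2 : spin d x ⬝ᵥ spinlessVelocity a (m * r ^ 2) c.1 = spinConst a k (m * r ^ 2) c) :
    momentEnergy (axialInertia a k d) m r x = c := by
  have h3 := spinConst_eq (d := d) hk ha hμ hx
  rw [h1, h2, spinConst, spinConst, momentEnergy, div_left_inj' hk] at h3
  simp only [h1] at h3
  rw [momentEnergy]
  exact Prod.ext h1 (by simp only; linarith)

end Chaplygin

/-! ### Calculus for vector and matrix valued functions. -/

namespace Chaplygin

section Calculus

variable {F : Type*} [NormedAddCommGroup F] [NormedSpace ℝ F] {n : WithTop ℕ∞} {y : F}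

theorem contDiffAt_vec {f : F → Vec} :
    ContDiffAt ℝ n f y ↔ ∀ i, ContDiffAt ℝ n (fun x => f x i) y :=
  contDiffAt_pi

theorem contDiffAt_mat {f : F → Mat} :
    ContDiffAt ℝ n f y ↔ ∀ i j, ContDiffAt ℝ n (fun x => f x i j) y := by
  have h1 : ContDiffAt ℝ n f y ↔ ∀ i, ContDiffAt ℝ n (fun x => f x i) y :=
    contDiffAt_pi (ι := Fin 3)
  rw [h1]
  exact forall_congr' fun i => contDiffAt_pi (ι := Fin 3)

theorem hasDerivAt_mat {f : ℝ → Mat} {f' : Mat} {t : ℝ} :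
    HasDerivAt f f' t ↔ ∀ i j, HasDerivAt (fun x => f x i j) (f' i j) t := by
  have h1 : HasDerivAt f f' t ↔ ∀ i, HasDerivAt (fun x => f x i) (f' i) t :=
    hasDerivAt_pi (ι := Fin 3)
  rw [h1]
  exact forall_congr' fun i => hasDerivAt_pi (ι := Fin 3)

theorem contDiffAt_dot {f g : F → Vec} (hf : ContDiffAt ℝ n f y) (hg : ContDiffAt ℝ n g y) :
    ContDiffAt ℝ n (fun x => f x ⬝ᵥ g x) y := by
  simp only [dotProduct]
  exact ContDiffAt.sum fun i _ => (contDiffAt_vec.1 hf i).mul (contDiffAt_vec.1 hg i)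

theorem contDiffAt_mulVec {A : F → Mat} {f : F → Vec} (hA : ContDiffAt ℝ n A y)
    (hf : ContDiffAt ℝ n f y) : ContDiffAt ℝ n (fun x => A x *ᵥ f x) y := by
  rw [contDiffAt_vec]
  intro i
  simp only [mulVec, dotProduct]
  exact ContDiffAt.sum fun j _ => (contDiffAt_mat.1 hA i j).mul (contDiffAt_vec.1 hf j)

theorem contDiffAt_mul {A B : F → Mat} (hA : ContDiffAt ℝ n A y) (hB : ContDiffAt ℝ n B y) :
    ContDiffAt ℝ n (fun x => A x * B x) y := by
  rw [contDiffAt_mat]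
  intro i j
  simp only [Matrix.mul_apply]
  exact ContDiffAt.sum fun k _ => (contDiffAt_mat.1 hA i k).mul (contDiffAt_mat.1 hB k j)

theorem contDiffAt_transpose {A : F → Mat} (hA : ContDiffAt ℝ n A y) :
    ContDiffAt ℝ n (fun x => (A x)ᵀ) y :=
  contDiffAt_mat.2 fun i j => contDiffAt_mat.1 hA j i

theorem contDiffAt_cross {f g : F → Vec} (hf : ContDiffAt ℝ n f y) (hg : ContDiffAt ℝ n g y) :
    ContDiffAt ℝ n (fun x => f x ⨯₃ g x) y := by
  rw [contDiffAt_vec] at *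
  have h : ∀ i j, ContDiffAt ℝ n (fun x => f x i * g x j) y := fun i j => (hf i).mul (hg j)
  intro i
  fin_cases i <;> simp only [cross_apply] <;> exact (h _ _).sub (h _ _)

theorem contDiffAt_diagMul {α γ : F → ℝ} {f : F → Vec} (hα : ContDiffAt ℝ n α y)
    (hγ : ContDiffAt ℝ n γ y) (hf : ContDiffAt ℝ n f y) :
    ContDiffAt ℝ n (fun x => diagMul (α x) (γ x) (f x)) y := by
  rw [contDiffAt_vec] at *
  intro i
  fin_cases i
  exacts [hα.mul (hf 0), hα.mul (hf 1), hγ.mul (hf 2)]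

theorem contDiffAt_hat {f : F → Vec} (hf : ContDiffAt ℝ n f y) :
    ContDiffAt ℝ n (fun x => hat (f x)) y := by
  rw [contDiffAt_vec] at hf
  rw [contDiffAt_mat]
  intro i j
  fin_cases i <;> fin_cases j
  exacts [contDiffAt_const, (hf 2).neg, hf 1, hf 2, contDiffAt_const, (hf 0).neg, (hf 1).neg, hf 0,
    contDiffAt_const]

variable {f g : ℝ → Vec} {f' g' : Vec} {A B : ℝ → Mat} {A' B' : Mat} {t : ℝ}

theorem hasDerivAt_dot (hf : HasDerivAt f f' t) (hg : HasDerivAt g g' t) :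
    HasDerivAt (fun s => f s ⬝ᵥ g s) (f' ⬝ᵥ g t + f t ⬝ᵥ g') t := by
  rw [hasDerivAt_pi] at hf hg
  simp only [dotProduct, ← Finset.sum_add_distrib]
  exact HasDerivAt.fun_sum fun i _ => (hf i).mul (hg i)

theorem hasDerivAt_mulVec (hA : HasDerivAt A A' t) (hf : HasDerivAt f f' t) :
    HasDerivAt (fun s => A s *ᵥ f s) (A' *ᵥ f t + A t *ᵥ f') t := by
  rw [hasDerivAt_pi] at hf ⊢
  rw [hasDerivAt_mat] at hA
  intro i
  simp only [mulVec, dotProduct, Pi.add_apply, ← Finset.sum_add_distrib]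
  exact HasDerivAt.fun_sum fun j _ => (hA i j).mul (hf j)

theorem hasDerivAt_mul (hA : HasDerivAt A A' t) (hB : HasDerivAt B B' t) :
    HasDerivAt (fun s => A s * B s) (A' * B t + A t * B') t := by
  rw [hasDerivAt_mat] at *
  intro i j
  simp only [Matrix.mul_apply, Matrix.add_apply, ← Finset.sum_add_distrib]
  exact HasDerivAt.fun_sum fun k _ => (hA i k).mul (hB k j)

theorem hasDerivAt_transpose (hA : HasDerivAt A A' t) :
    HasDerivAt (fun s => (A s)ᵀ) A'ᵀ t :=
  hasDerivAt_mat.2 fun i j => hasDerivAt_mat.1 hA j i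

theorem hasDerivAt_cross (hf : HasDerivAt f f' t) (hg : HasDerivAt g g' t) :
    HasDerivAt (fun s => f s ⨯₃ g s) (f' ⨯₃ g t + f t ⨯₃ g') t := by
  rw [hasDerivAt_pi] at *
  have h : ∀ i j, HasDerivAt (fun s => f s i * g s j) (f' i * g t j + f t i * g' j) t :=
    fun i j => (hf i).mul (hg j)
  intro i
  fin_cases i
  · exact ((h 1 2).sub (h 2 1)).congr_deriv (by simp [cross_apply]; ring)
  · exact ((h 2 0).sub (h 0 2)).congr_deriv (by simp [cross_apply]; ring)
  · exact ((h 0 1).sub (h 1 0)).congr_deriv (by simp [cross_apply]; ring)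

theorem hasDerivAt_diagMul (α γ : ℝ) (hf : HasDerivAt f f' t) :
    HasDerivAt (fun s => diagMul α γ (f s)) (diagMul α γ f') t := by
  rw [hasDerivAt_pi] at *
  intro i
  fin_cases i
  exacts [(hf 0).const_mul α, (hf 1).const_mul α, (hf 2).const_mul γ]

end Calculus

/-! ### Derivatives of moment and energy, regular points, and the equations of motion. -/

theorem contDiff_momentEnergy (I : Mat) (m r : ℝ) {n : WithTop ℕ∞} :
    ContDiff ℝ n (momentEnergy I m r) := by
  rw [contDiff_iff_contDiffAt]
  intro x
  have hA : ContDiffAt ℝ n (fun x : Mat × Vec => x.1) x := contDiffAt_fst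
  have hw : ContDiffAt ℝ n (fun x : Mat × Vec => x.2) x := contDiffAt_snd
  have hu : ContDiffAt ℝ n (fun x : Mat × Vec => vert x.1) x :=
    contDiffAt_mulVec (contDiffAt_transpose hA) contDiffAt_const
  have hI := contDiffAt_mulVec (contDiffAt_const (c := I)) hw
  refine ContDiffAt.prodMk ?_ ?_
  · exact contDiffAt_mulVec hA (hI.add
      ((contDiffAt_cross hu (contDiffAt_cross hw hu)).const_smul (m * r ^ 2)))
  · exact (contDiffAt_const.mul (contDiffAt_dot hI hw)).add (contDiffAt_const.mul
      (contDiffAt_dot (contDiffAt_cross hu hw) (contDiffAt_cross hu hw)))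

/-- The derivative of the moment, in body coordinates relative to the moving frame. -/
def momentRate (I : Mat) (m r : ℝ) (x : Mat × Vec) (ν η : Vec) : Vec :=
  ν ⨯₃ (I *ᵥ x.2 + (m * r ^ 2) • (vert x.1 ⨯₃ (x.2 ⨯₃ vert x.1))) +
    (I *ᵥ η + (m * r ^ 2) • ((vert x.1 ⨯₃ ν) ⨯₃ (x.2 ⨯₃ vert x.1) +
      vert x.1 ⨯₃ (η ⨯₃ vert x.1 + x.2 ⨯₃ (vert x.1 ⨯₃ ν))))

section Derivatives

variable {I : Mat} {m r : ℝ} {A : ℝ → Mat} {w : ℝ → Vec} {ν η : Vec} {t : ℝ}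

theorem hasDerivAt_vert (hA : HasDerivAt A (A t * hat ν) t) :
    HasDerivAt (fun s => vert (A s)) (vert (A t) ⨯₃ ν) t := by
  refine (hasDerivAt_mulVec (hasDerivAt_transpose hA) (hasDerivAt_const t e₃)).congr_deriv ?_
  have h : (hat ν)ᵀ = -hat ν := by
    ext i j
    fin_cases i <;> fin_cases j <;> simp [hat]
  rw [transpose_mul, h, mulVec_zero, add_zero, ← mulVec_mulVec, neg_mulVec, hat_mulVec,
    cross_anticomm, vert]

theorem hasDerivAt_moment (hA : HasDerivAt A (A t * hat ν) t) (hw : HasDerivAt w η t) :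
    HasDerivAt (fun s => moment I m r (A s, w s)) (A t *ᵥ momentRate I m r (A t, w t) ν η) t := by
  have hu := hasDerivAt_vert hA
  refine (hasDerivAt_mulVec hA ((hasDerivAt_mulVec (hasDerivAt_const t I) hw).add
    ((hasDerivAt_cross hu (hasDerivAt_cross hw hu)).const_smul (m * r ^ 2)))).congr_deriv ?_
  simp only [momentRate, mulVec_add, ← mulVec_mulVec, hat_mulVec, zero_mulVec, zero_add,
    Pi.add_apply, Pi.smul_apply, map_add]

/-- For `k = 0` the energy on the phase space is a function of the moment, and its rate is the
pairing of ω with the rate of the moment. The correction with the factor `k` is what can make moment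
and energy independent. -/
theorem hasDerivAt_energy {a k : ℝ} {d : Vec} (hA : HasDerivAt A (A t * hat ν) t)
    (hw : HasDerivAt w η t) :
    HasDerivAt (fun s => kineticEnergy (axialInertia a k d) m r (A s, w s))
      (w t ⬝ᵥ momentRate (axialInertia a k d) m r (A t, w t) ν η -
        k * (d ⬝ᵥ w t) * (w t ⬝ᵥ (ν ⨯₃ d))) t := by
  have hu := hasDerivAt_vert hA
  have hc := hasDerivAt_cross hu hw
  refine (((hasDerivAt_dot (hasDerivAt_mulVec (hasDerivAt_const t (axialInertia a k d)) hw)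
    hw).const_mul (1 / 2)).add ((hasDerivAt_dot hc hc).const_mul
      (1 / 2 * (m * r ^ 2)))).congr_deriv ?_
  simp only [momentRate, axialInertia_mulVec, zero_mulVec, zero_add]
  generalize vert (A t) = u
  generalize w t = w
  simp only [dot_eq, cross_zero, cross_one, cross_two, Pi.add_apply, Pi.smul_apply, smul_eq_mul]
  ring

end Derivatives

variable {a k m r : ℝ} {d : Vec} {x : Mat × Vec}

theorem fderiv_momentEnergy (x : Mat × Vec) (ν η : Vec) :
    fderiv ℝ (momentEnergy (axialInertia a k d) m r) x (x.1 * hat ν, η) =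
      (x.1 *ᵥ momentRate (axialInertia a k d) m r x ν η,
        x.2 ⬝ᵥ momentRate (axialInertia a k d) m r x ν η -
          k * (d ⬝ᵥ x.2) * (x.2 ⬝ᵥ (ν ⨯₃ d))) := by
  have h0 : HasDerivAt (fun t : ℝ => x + t • (x.1 * hat ν, η)) (x.1 * hat ν, η) 0 := by
    exact (((hasDerivAt_id (0 : ℝ)).smul_const (x.1 * hat ν, η)).const_add x).congr_deriv
      (one_smul _ _)
  have hd : DifferentiableAt ℝ (momentEnergy (axialInertia a k d) m r)
      (x + (0 : ℝ) • (x.1 * hat ν, η)) :=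
    (contDiff_momentEnergy _ m r (n := 1)).differentiable (by simp) _
  have h1 := hd.hasFDerivAt.comp_hasDerivAt 0 h0
  rw [zero_smul, add_zero] at h1
  refine h1.unique ?_
  have hA : HasDerivAt (fun t : ℝ => x.1 + t • (x.1 * hat ν))
      ((fun t : ℝ => x.1 + t • (x.1 * hat ν)) 0 * hat ν) 0 := by
    refine (((hasDerivAt_id (0 : ℝ)).smul_const (x.1 * hat ν)).const_add x.1).congr_deriv ?_
    simp
  have hw : HasDerivAt (fun t : ℝ => x.2 + t • η) η 0 := by
    simpa only [one_smul, id] using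
      ((hasDerivAt_id (0 : ℝ)).smul_const η).const_add x.2
  have h2 := hasDerivAt_moment (I := axialInertia a k d) (m := m) (r := r) hA hw
  have h3 := hasDerivAt_energy (a := a) (k := k) (d := d) (m := m) (r := r) hA hw
  simp only [zero_smul, add_zero, Prod.mk.eta] at h2 h3
  exact h2.prodMk h3

/-- The part of the rate of the moment that is linear in the angular acceleration. -/
def effectiveInertia (a k m r : ℝ) (d u : Vec) : Vec →ₗ[ℝ] Vec where
  toFun η := axialInertia a k d *ᵥ η + (m * r ^ 2) • (u ⨯₃ (η ⨯₃ u))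
  map_add' v w := by
    simp only [mulVec_add, map_add, LinearMap.add_apply, smul_add]; abel
  map_smul' c v := by
    simp [mulVec_smul, smul_comm c]

/-- The operator is positive definite: its form is a |d × η|² + (a + k) ⟨d, η⟩² + μ |u × η|². -/
theorem effectiveInertia_surjective (ha : 0 < a) (hb : 0 < a + k) (hμ : 0 < m * r ^ 2)
    (hd : d ⬝ᵥ d = 1) (u : Vec) : Function.Surjective (effectiveInertia a k m r d u) := by
  rw [← LinearMap.injective_iff_surjective, ← LinearMap.ker_eq_bot, LinearMap.ker_eq_bot']
  intro η hη
  by_contra hne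
  have h0 : η ⬝ᵥ effectiveInertia a k m r d u η = 0 := by rw [hη, dotProduct_zero]
  have h1 : η ⬝ᵥ effectiveInertia a k m r d u η =
      a * (η ⬝ᵥ η - (d ⬝ᵥ η) ^ 2) + (a + k) * (d ⬝ᵥ η) ^ 2 +
        (m * r ^ 2) * ((u ⨯₃ η) ⬝ᵥ (u ⨯₃ η)) := by
    simp only [effectiveInertia, LinearMap.coe_mk, AddHom.coe_mk, axialInertia_mulVec]
    simp only [dot_eq, cross_zero, cross_one, cross_two, Pi.add_apply, Pi.smul_apply, smul_eq_mul]
    ring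
  have h2 : η ⬝ᵥ η - (d ⬝ᵥ η) ^ 2 = (d ⨯₃ η) ⬝ᵥ (d ⨯₃ η) := by
    rw [cross_dot_cross, hd, dotProduct_comm η d]; ring
  have h3 : 0 ≤ (d ⨯₃ η) ⬝ᵥ (d ⨯₃ η) := Finset.sum_nonneg fun i _ => mul_self_nonneg _
  have h4 : 0 ≤ (u ⨯₃ η) ⬝ᵥ (u ⨯₃ η) := Finset.sum_nonneg fun i _ => mul_self_nonneg _
  have h5 := dot_self_pos hne
  have h6 : 0 < (d ⨯₃ η) ⬝ᵥ (d ⨯₃ η) + (d ⬝ᵥ η) ^ 2 := by linarith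
  rw [h1, h2] at h0
  rcases h3.lt_or_eq with h | h
  · nlinarith [mul_pos ha h, mul_nonneg hμ.le h4, mul_nonneg hb.le (sq_nonneg (d ⬝ᵥ η))]
  · have h7 : 0 < (d ⬝ᵥ η) ^ 2 := by linarith
    nlinarith [mul_pos hb h7, mul_nonneg hμ.le h4]

/-- A variation `η` of ω can give the moment any prescribed rate. What remains is whether the
correction term in the rate of the energy, which is linear in `ν` with coefficient k ⟨d, ω⟩ (d × ω),
can be nonzero. -/
theorem isRegularPoint_iff (ha : 0 < a) (hb : 0 < a + k) (hμ : 0 < m * r ^ 2)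
    (hd : d ⬝ᵥ d = 1) (hx : x ∈ phaseSpace) :
    IsRegularPoint (axialInertia a k d) m r x ↔ k ≠ 0 ∧ d ⬝ᵥ x.2 ≠ 0 ∧ d ⨯₃ x.2 ≠ 0 := by
  simp only [IsRegularPoint, fderiv_momentEnergy]
  have hcyc : ∀ ν : Vec, x.2 ⬝ᵥ (ν ⨯₃ d) = ν ⬝ᵥ (d ⨯₃ x.2) := fun ν => by
    rw [triple_product_permutation]
  constructor
  · intro h
    by_contra hcon
    -- A variation that fixes the moment changes the energy only through the correction term.
    obtain ⟨ν, η, he⟩ := h (0, 1)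
    have h1 : x.1 *ᵥ momentRate (axialInertia a k d) m r x ν η = 0 := congrArg Prod.fst he
    have h2 := congrArg Prod.snd he
    have h3 : momentRate (axialInertia a k d) m r x ν η = 0 := by
      rw [← transpose_mulVec_mulVec hx (momentRate _ m r x ν η), h1, mulVec_zero]
    have h4 : k * (d ⬝ᵥ x.2) * (x.2 ⬝ᵥ (ν ⨯₃ d)) = 0 := by
      rw [hcyc]
      by_cases hk : k = 0
      · simp [hk]
      by_cases hs : d ⬝ᵥ x.2 = 0
      · simp [hs]
      have : d ⨯₃ x.2 = 0 := by tauto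
      simp [this]
    simp only [h3, dotProduct_zero] at h2
    linarith
  · rintro ⟨hk, hs, hx0⟩ ⟨c1, c2⟩
    have hn : (d ⨯₃ x.2) ⬝ᵥ (d ⨯₃ x.2) ≠ 0 := (dot_self_pos hx0).ne'
    -- The factor is chosen so that the correction term supplies the energy rate still missing once
    -- the moment rate is `c1`.
    set ν : Vec := ((x.2 ⬝ᵥ (x.1ᵀ *ᵥ c1) - c2) / (k * (d ⬝ᵥ x.2) *
      ((d ⨯₃ x.2) ⬝ᵥ (d ⨯₃ x.2)))) • (d ⨯₃ x.2) with hν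
    obtain ⟨η, hη⟩ := effectiveInertia_surjective ha hb hμ hd (vert x.1)
      (x.1ᵀ *ᵥ c1 - momentRate (axialInertia a k d) m r x ν 0)
    have h1 : momentRate (axialInertia a k d) m r x ν η = x.1ᵀ *ᵥ c1 := by
      have : momentRate (axialInertia a k d) m r x ν η =
          momentRate (axialInertia a k d) m r x ν 0 +
            effectiveInertia a k m r d (vert x.1) η := by
        simp only [momentRate, effectiveInertia, LinearMap.coe_mk, AddHom.coe_mk, mulVec_zero,
          map_add, map_zero, LinearMap.zero_apply, smul_add, zero_add]
        abel
      rw [this, hη]; abel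
    refine ⟨ν, η, ?_⟩
    rw [h1, mulVec_transpose_mulVec hx, hcyc, hν, smul_dotProduct, smul_eq_mul]
    refine Prod.ext rfl ?_
    simp only
    field_simp
    ring

/-- Given the kinematic equation, the dynamical equation says exactly that the rate of the moment
vanishes; comparing the two forms uses ⟨u, u⟩ = 1. -/
theorem isRotationalMotion_iff {γ : ℝ → Mat × Vec} :
    IsRotationalMotion (axialInertia a k d) m r γ ↔
      (∀ t, γ t ∈ phaseSpace) ∧
      (∀ t, HasDerivAt (fun s => (γ s).1) ((γ t).1 * hat (γ t).2) t) ∧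
      (∀ t, DifferentiableAt ℝ (fun s => (γ s).2) t) ∧
      ∀ t, moment (axialInertia a k d) m r (γ t) = moment (axialInertia a k d) m r (γ 0) := by
  have key : ∀ (x : Mat × Vec) (η : Vec), x ∈ phaseSpace →
      (momentRate (axialInertia a k d) m r x x.2 η = 0 ↔
      axialInertia a k d *ᵥ η - (axialInertia a k d *ᵥ x.2) ⨯₃ x.2 =
      (m * r ^ 2) • ((vert x.1 ⬝ᵥ η) • vert x.1 - η)) := by
    intro x η hx
    have h1 : momentRate (axialInertia a k d) m r x x.2 η =
        (axialInertia a k d *ᵥ η - (axialInertia a k d *ᵥ x.2) ⨯₃ x.2) -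
          (m * r ^ 2) • ((vert x.1 ⬝ᵥ η) • vert x.1 - (vert x.1 ⬝ᵥ vert x.1) • η) := by
      simp only [momentRate, axialInertia_mulVec]
      generalize vert x.1 = u
      apply vec_ext <;> simp only [dot_eq, cross_zero, cross_one, cross_two, Pi.add_apply,
        Pi.sub_apply, Pi.smul_apply, smul_eq_mul] <;> ring
    rw [h1, vert_dot_self hx, one_smul, sub_eq_zero]
  constructor
  · rintro ⟨h1, h2, h3⟩
    refine ⟨h1, h2, fun t => (h3 t).choose_spec.1.differentiableAt, fun t => ?_⟩
    refine is_const_of_deriv_eq_zero (f := fun t => moment (axialInertia a k d) m r (γ t))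
      ?_ ?_ t 0
    all_goals
      intro t
      obtain ⟨η, hη, he⟩ := h3 t
      have h4 := hasDerivAt_moment (I := axialInertia a k d) (m := m) (r := r) (h2 t) hη
      rw [(key (γ t) η (h1 t)).2 he, mulVec_zero] at h4
    · exact h4.differentiableAt
    · exact h4.deriv
  · rintro ⟨h1, h2, h3, h4⟩
    refine ⟨h1, h2, fun t => ⟨_, (h3 t).hasDerivAt, ?_⟩⟩
    rw [← key _ _ (h1 t)]
    have h5 := hasDerivAt_moment (I := axialInertia a k d) (m := m) (r := r) (h2 t)
      (h3 t).hasDerivAt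
    have h6 : (fun s => moment (axialInertia a k d) m r ((γ s).1, (γ s).2)) =
        fun _ => moment (axialInertia a k d) m r (γ 0) := funext h4
    rw [h6] at h5
    have h7 := h5.unique (hasDerivAt_const t _)
    have h8 := transpose_mulVec_mulVec (h1 t) (momentRate (axialInertia a k d) m r
      ((γ t).1, (γ t).2) (γ t).2 (deriv (fun s => (γ s).2) t))
    rw [h7, mulVec_zero] at h8
    exact h8.symm

end Chaplygin

/-! ### Normal form of the inertia tensor and the SO(2)-orbits. -/

namespace Chaplygin

theorem eq_axialInertia_of_eigenvalues {I : Mat} (hI : I.IsHermitian) {i k : Fin 3} (hik : i ≠ k)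
    (h : hI.eigenvalues i = hI.eigenvalues k) :
    ∃ (a b : ℝ) (d : Vec), d ⬝ᵥ d = 1 ∧ I = axialInertia a b d := by
  -- `l` is the third index; its eigenvector spans the axis, and the other two share the eigenvalue.
  obtain ⟨l, hl⟩ : ∃ l : Fin 3, ∀ j, j ≠ l → j = i ∨ j = k := by
    have : ∀ i k : Fin 3, i ≠ k → ∃ l : Fin 3, ∀ j, j ≠ l → j = i ∨ j = k := by decide
    exact this i k hik
  let b := hI.eigenvectorBasis
  have hdot : ∀ j j', (b j).ofLp ⬝ᵥ (b j').ofLp = if j' = j then 1 else 0 := by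
    intro j j'
    have := orthonormal_iff_ite.1 b.orthonormal j' j
    simpa [EuclideanSpace.inner_eq_star_dotProduct] using this
  refine ⟨hI.eigenvalues i, hI.eigenvalues l - hI.eigenvalues i, (b l).ofLp, by simp [hdot], ?_⟩
  apply (Matrix.toEuclideanLin (𝕜 := ℝ) (m := Fin 3) (n := Fin 3)).injective
  refine b.toBasis.ext fun j => ?_
  have h1 : I *ᵥ (b j).ofLp = hI.eigenvalues j • (b j).ofLp := hI.mulVec_eigenvectorBasis j
  rw [b.coe_toBasis]
  apply WithLp.ofLp_injective
  simp only [toLpLin_apply, h1, axialInertia_mulVec, hdot]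
  by_cases hj : j = l
  · subst hj
    simp [← add_smul]
  · have : hI.eigenvalues j = hI.eigenvalues i := by
      rcases hl j hj with rfl | rfl
      exacts [rfl, h.symm]
    simp [hj, this]

theorem isSymmetryAxis_axialInertia (a k : ℝ) {d : Vec} (hd : d ⬝ᵥ d = 1) :
    IsSymmetryAxis (axialInertia a k d) d := by
  refine ⟨fun h => by simp [h] at hd, fun R hR => ?_⟩
  rw [axialInertia, Matrix.mul_add, Matrix.add_mul]
  simp only [Matrix.mul_smul, Matrix.smul_mul, Matrix.mul_one, hR.1.1]
  rw [mul_vecMulVec, hR.2, vecMulVec_mul, vecMul_transpose, hR.2]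

theorem rotationsAbout_smul {c : ℝ} (hc : c ≠ 0) (d : Vec) :
    rotationsAbout (c • d) = rotationsAbout d := by
  ext R
  simp only [rotationsAbout, Set.mem_ofPred_eq, mulVec_smul]
  rw [smul_right_inj hc]

theorem eq_hat_of_transpose_eq_neg {M : Mat} (h : Mᵀ = -M) : M = hat ![M 2 1, M 0 2, M 1 0] := by
  have h' : ∀ i j, M j i = -M i j := fun i j => congrFun (congrFun h i) j
  have h0 : ∀ i, M i i = 0 := fun i => by linarith [h' i i]
  ext i j
  fin_cases i <;> fin_cases j <;> simp [hat, h0]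
  exacts [h' 1 0, h' 2 1, h' 0 2]

/-- By Rodrigues' formula the matrix is the rotation about `d` through a right angle. -/
theorem quarterTurn_mem {d : Vec} (hd : d ⬝ᵥ d = 1) :
    vecMulVec d d + hat d ∈ rotationsAbout d := by
  rw [dot_eq] at hd
  refine ⟨⟨?_, ?_⟩, ?_⟩
  · ext i j
    fin_cases i <;> fin_cases j <;>
      simp [Matrix.mul_apply, Fin.sum_univ_three, hat, vecMulVec_apply] <;>
      first
      | linear_combination (d 0 ^ 2 + 1) * hd
      | linear_combination (d 1 ^ 2 + 1) * hd
      | linear_combination (d 2 ^ 2 + 1) * hd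
      | linear_combination (d 0 * d 1) * hd
      | linear_combination (d 0 * d 2) * hd
      | linear_combination (d 1 * d 2) * hd
  · simp [det_fin_three, hat, vecMulVec_apply]
    linear_combination (d 0 * d 0 + d 1 * d 1 + d 2 * d 2 + 1) * hd
  · rw [add_mulVec, hat_mulVec, cross_self, vecMulVec_mulVec, dot_eq, hd]
    simp

/-- Commuting with the quarter turn R suffices. From R² = 2 d dᵀ - 1, the tensor commutes with d dᵀ,
hence also with `hat d`. The first relation makes `d` an eigenvector. The second makes `I * hat d`
antisymmetric, say `hat v`; then `v` is parallel to `d`, and `I` is a scalar on the plane orthogonal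
to `d`. -/
theorem eq_axialInertia_of_quarterTurn {I : Mat} (hI : Iᵀ = I) {d : Vec} (hd : d ⬝ᵥ d = 1)
    (h : ∀ R ∈ rotationsAbout d, R * I * Rᵀ = I) : ∃ a k : ℝ, I = axialInertia a k d := by
  have hcomm : ∀ R ∈ rotationsAbout d, R * I = I * R := by
    intro R hR
    conv_rhs => rw [← h R hR]
    rw [Matrix.mul_assoc, transpose_mul_self hR.1, Matrix.mul_one]
  set R := vecMulVec d d + hat d with hRdef
  have hR : R ∈ rotationsAbout d := quarterTurn_mem hd
  have h1 := hcomm R hR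
  have hsq : R * R = (2 : ℝ) • vecMulVec d d - 1 := by
    have hd' := hd
    rw [dot_eq] at hd'
    ext i j
    fin_cases i <;> fin_cases j <;>
      simp [R, Matrix.mul_apply, Fin.sum_univ_three, hat, vecMulVec_apply] <;>
      first
      | linear_combination (d 0 ^ 2 - 1) * hd'
      | linear_combination (d 1 ^ 2 - 1) * hd'
      | linear_combination (d 2 ^ 2 - 1) * hd'
      | linear_combination (d 0 * d 1) * hd'
      | linear_combination (d 0 * d 2) * hd'
      | linear_combination (d 1 * d 2) * hd'
  have h2 : vecMulVec d d * I = I * vecMulVec d d := by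
    have h3 : R * R * I = I * (R * R) := by
      rw [Matrix.mul_assoc, h1, ← Matrix.mul_assoc, h1, Matrix.mul_assoc]
    rw [hsq, Matrix.sub_mul, Matrix.mul_sub, Matrix.one_mul, Matrix.mul_one, sub_left_inj,
      Matrix.smul_mul, Matrix.mul_smul] at h3
    exact smul_right_injective _ two_ne_zero h3
  have h3 : hat d * I = I * hat d := by
    have := h1
    rw [hRdef, Matrix.add_mul, Matrix.mul_add, h2] at this
    exact add_left_cancel this
  have hId : I *ᵥ d = (d ⬝ᵥ (I *ᵥ d)) • d := by
    have := congrArg (· *ᵥ d) h2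
    simp only [← mulVec_mulVec, vecMulVec_mulVec, hd] at this
    simpa using this.symm
  have hanti : (I * hat d)ᵀ = -(I * hat d) := by
    have : (hat d)ᵀ = -hat d := by
      ext i j; fin_cases i <;> fin_cases j <;> simp [hat]
    rw [transpose_mul, hI, this, Matrix.neg_mul, h3]
  set v : Vec := ![(I * hat d) 2 1, (I * hat d) 0 2, (I * hat d) 1 0] with hv
  have hIv : I * hat d = hat v := eq_hat_of_transpose_eq_neg hanti
  have hIv' : ∀ z, I *ᵥ (d ⨯₃ z) = v ⨯₃ z := fun z => by
    rw [← hat_mulVec, mulVec_mulVec, hIv, hat_mulVec]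
  have hvd : v ⨯₃ d = 0 := by rw [← hIv', cross_self, mulVec_zero]
  have hv2 : v = (d ⬝ᵥ v) • d := by
    have h4 : d ⨯₃ (v ⨯₃ d) = (d ⬝ᵥ d) • v - (d ⬝ᵥ v) • d := double_cross d v
    rw [hvd, map_zero, hd, one_smul] at h4
    exact sub_eq_zero.1 h4.symm
  refine ⟨d ⬝ᵥ v, d ⬝ᵥ (I *ᵥ d) - d ⬝ᵥ v, ?_⟩
  rw [← Matrix.mulVec_injective.eq_iff]
  funext z
  have h5 : z = (d ⬝ᵥ z) • d + d ⨯₃ (z ⨯₃ d) := by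
    rw [double_cross, hd, one_smul]; abel
  have h6 : I *ᵥ z = (d ⬝ᵥ z) • (I *ᵥ d) + v ⨯₃ (z ⨯₃ d) := by
    conv_lhs => rw [h5]
    rw [mulVec_add, mulVec_smul, hIv']
  have h7 : v ⨯₃ (z ⨯₃ d) = (d ⬝ᵥ v) • (z - (d ⬝ᵥ z) • d) := by
    conv_lhs => rw [hv2]
    rw [map_smul, LinearMap.smul_apply, double_cross, hd, one_smul]
  have h8 : (d ⬝ᵥ z) • (I *ᵥ d) = ((d ⬝ᵥ z) * (d ⬝ᵥ (I *ᵥ d))) • d := by rw [mul_smul, ← hId]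
  rw [h6, h7, h8, axialInertia_mulVec]
  module

/-- An inertia tensor with an axis of symmetry, in normal form. -/
theorem exists_axialInertia {I : Mat} (hI : I.PosDef) {d : Vec} (hd : IsSymmetryAxis I d) :
    ∃ (a k : ℝ) (n : Vec), n ⬝ᵥ n = 1 ∧ 0 < a ∧ 0 < a + k ∧ I = axialInertia a k n ∧
      rotationsAbout n = rotationsAbout d := by
  have hpos := dot_self_pos hd.1
  set c : ℝ := (Real.sqrt (d ⬝ᵥ d))⁻¹ with hc
  have hc0 : c ≠ 0 := by positivity
  have hn : (c • d) ⬝ᵥ (c • d) = 1 := by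
    rw [smul_dotProduct, dotProduct_smul, smul_eq_mul, smul_eq_mul, ← mul_assoc, hc, ← mul_inv,
      Real.mul_self_sqrt hpos.le, inv_mul_cancel₀ hpos.ne']
  have hrot := rotationsAbout_smul hc0 d
  obtain ⟨a, k, hak⟩ := eq_axialInertia_of_quarterTurn (by simpa using hI.isHermitian.eq) hn
    (fun R hR => hd.2 R (hrot ▸ hR))
  set n := c • d
  -- Positivity tested on a vector orthogonal to `n` gives `0 < a`, and on `n` itself `0 < a + k`.
  have hq : ∀ z : Vec, z ≠ 0 → 0 < z ⬝ᵥ (I *ᵥ z) := fun z hz => by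
    simpa using hI.dotProduct_mulVec_pos hz
  refine ⟨a, k, n, hn, ?_, ?_, hak, hrot⟩
  · have : ∃ z : Vec, n ⬝ᵥ z = 0 ∧ z ≠ 0 := by
      by_cases h : n 0 = 0 ∧ n 1 = 0
      · exact ⟨![1, 0, 0], by rw [dot_eq]; simp [h.1], fun h => by simpa using congrFun h 0⟩
      · refine ⟨![-n 1, n 0, 0], by rw [dot_eq]; simp; ring, fun h' => h ?_⟩
        have h0 := congrFun h' 0
        have h1 := congrFun h' 1
        simp at h0 h1
        exact ⟨h1, h0⟩
    obtain ⟨z, hz, hz0⟩ := this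
    have := hq z hz0
    rw [hak, axialInertia_mulVec, hz] at this
    simp only [mul_zero, zero_smul, add_zero, dotProduct_smul, smul_eq_mul] at this
    exact pos_of_mul_pos_left this (dot_self_pos hz0).le
  · have := hq n (fun h => by simp [h] at hn)
    rw [hak, axialInertia_mulVec, hn] at this
    simp only [dotProduct_add, dotProduct_smul, hn, smul_eq_mul] at this
    linarith

/-- The vectors A n and A ω are invariant under the action. Conversely, if they agree at both times,
the product of the inverse of one attitude with the other fixes `n` and carries one point to the
other. -/
theorem reducedMotion_eq_iff {n d : Vec} (hn : rotationsAbout n = rotationsAbout d)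
    {γ : ℝ → Mat × Vec} (hγ : ∀ t, γ t ∈ phaseSpace) (s t : ℝ) :
    reducedMotion d γ s = reducedMotion d γ t ↔
      (γ s).1 *ᵥ n = (γ t).1 *ᵥ n ∧ (γ s).1 *ᵥ (γ s).2 = (γ t).1 *ᵥ (γ t).2 := by
  rw [reducedMotion, reducedMotion, Quotient.eq]
  constructor
  · rintro ⟨R, hR, h⟩
    rw [← hn] at hR
    rw [h]
    constructor
    · conv_rhs => rw [← hR.2]
      rw [← mulVec_mulVec, transpose_mulVec_mulVec hR.1]
    · simp only
      rw [← mulVec_mulVec, transpose_mulVec_mulVec hR.1]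
  · rintro ⟨h1, h2⟩
    have hs := hγ s
    have ht := hγ t
    refine ⟨(γ t).1ᵀ * (γ s).1, ?_, ?_⟩
    · rw [← hn]
      refine ⟨mul_mem_SO3 (transpose_mem_SO3 ht) hs, ?_⟩
      rw [← mulVec_mulVec, h1, transpose_mulVec_mulVec ht]
    · refine Prod.ext ?_ ?_
      · simp only
        rw [transpose_mul, transpose_transpose, ← Matrix.mul_assoc, hs.1, Matrix.one_mul]
      · simp only
        rw [← mulVec_mulVec, h2, transpose_mulVec_mulVec ht]

end Chaplygin

/-! ### The ellipse of spin vectors and its eccentric angle. -/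

namespace Chaplygin

/-- The dual quadratic form `⟨J, C⁻¹ J⟩` for `C = diag (α, α, γ)`. -/
noncomputable def dualForm (α γ : ℝ) (J : Vec) : ℝ := J ⬝ᵥ diagMul α⁻¹ γ⁻¹ J

/-- The frequency of the linear map `v ↦ J × C v` on the plane orthogonal to `J`. -/
noncomputable def planeFrequency (α γ : ℝ) (J : Vec) : ℝ := α * √(γ * dualForm α γ J)

/-- A unit vector orthogonal to `J`, with respect to the quadratic form `⟨v, C v⟩`. -/
noncomputable def axisOne (α γ : ℝ) (e J : Vec) : Vec :=
  (√((J ⨯₃ e) ⬝ᵥ diagMul α γ (J ⨯₃ e)))⁻¹ • (J ⨯₃ e)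

/-- The vector that completes `axisOne` to an orthonormal basis of the plane orthogonal to `J`. -/
noncomputable def axisTwo (α γ : ℝ) (e J : Vec) : Vec :=
  (planeFrequency α γ J)⁻¹ • (J ⨯₃ diagMul α γ (axisOne α γ e J))

/-- The radius of the intersection of the plane `⟨N, J⟩ = c` with the ellipsoid `⟨N, C N⟩ = c`. -/
noncomputable def ellipseRadius (α γ : ℝ) (J : Vec) (c : ℝ) : ℝ := √(c - c ^ 2 / dualForm α γ J)

/-- The intersection of the plane `⟨N, J⟩ = c` with the ellipsoid `⟨N, C N⟩ = c`. -/
noncomputable def ellipse (α γ : ℝ) (e J : Vec) (c φ : ℝ) : Vec :=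
  (c / dualForm α γ J) • diagMul α⁻¹ γ⁻¹ J +
    (ellipseRadius α γ J c * Real.cos φ) • axisOne α γ e J +
    (ellipseRadius α γ J c * Real.sin φ) • axisTwo α γ e J

section Ellipse

variable {α γ : ℝ} {e J : Vec} {c : ℝ}

theorem diagMul_add (v w : Vec) : diagMul α γ (v + w) = diagMul α γ v + diagMul α γ w := by
  apply vec_ext <;> simp <;> ring

theorem diagMul_sub (v w : Vec) : diagMul α γ (v - w) = diagMul α γ v - diagMul α γ w := by
  apply vec_ext <;> simp <;> ring

theorem diagMul_smul (s : ℝ) (v : Vec) : diagMul α γ (s • v) = s • diagMul α γ v := by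
  apply vec_ext <;> simp <;> ring

theorem diagMul_dot (v w : Vec) : diagMul α γ v ⬝ᵥ w = v ⬝ᵥ diagMul α γ w := by
  simp only [dot_eq, diagMul_zero, diagMul_one, diagMul_two]; ring

theorem diagMul_inv (hα : 0 < α) (hγ : 0 < γ) (v : Vec) :
    diagMul α γ (diagMul α⁻¹ γ⁻¹ v) = v := by
  apply vec_ext <;> simp [hα.ne', hγ.ne']

theorem diagMul_form_pos (hα : 0 < α) (hγ : 0 < γ) {v : Vec} (hv : v ≠ 0) :
    0 < v ⬝ᵥ diagMul α γ v := by
  have h := dot_self_pos hv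
  rw [dot_eq] at h ⊢
  simp only [diagMul_zero, diagMul_one, diagMul_two]
  have h1 : 0 < min α γ := lt_min hα hγ
  nlinarith [mul_pos h1 h, mul_nonneg (sub_nonneg.2 (min_le_left α γ)) (mul_self_nonneg (v 0)),
    mul_nonneg (sub_nonneg.2 (min_le_left α γ)) (mul_self_nonneg (v 1)),
    mul_nonneg (sub_nonneg.2 (min_le_right α γ)) (mul_self_nonneg (v 2))]

theorem dualForm_pos (hα : 0 < α) (hγ : 0 < γ) (hJ : J ≠ 0) : 0 < dualForm α γ J :=
  diagMul_form_pos (inv_pos.2 hα) (inv_pos.2 hγ) hJ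

theorem planeFrequency_pos (hα : 0 < α) (hγ : 0 < γ) (hJ : J ≠ 0) : 0 < planeFrequency α γ J := by
  have := dualForm_pos hα hγ hJ
  rw [planeFrequency]; positivity

theorem planeFrequency_sq (hα : 0 < α) (hγ : 0 < γ) (hJ : J ≠ 0) :
    planeFrequency α γ J * planeFrequency α γ J = α ^ 2 * γ * dualForm α γ J := by
  have := dualForm_pos hα hγ hJ
  have h := Real.mul_self_sqrt (show 0 ≤ γ * dualForm α γ J by positivity)
  rw [planeFrequency]
  linear_combination α ^ 2 * h

/-- The map v ↦ J × C v is skew for the form ⟨v, C v⟩, so on the plane orthogonal to J it is a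
frequency times a quarter turn. The squared frequency is det C · ⟨J, C⁻¹ J⟩. -/
theorem cross_diagMul_cross_diagMul (hα : 0 < α) (hγ : 0 < γ) {v : Vec} (hv : J ⬝ᵥ v = 0) :
    J ⨯₃ diagMul α γ (J ⨯₃ diagMul α γ v) = -(α ^ 2 * γ * dualForm α γ J) • v := by
  have hα' := hα.ne'
  have hγ' := hγ.ne'
  rw [dot_eq] at hv
  apply vec_ext <;>
    simp only [dualForm, dot_eq, cross_zero, cross_one, cross_two, diagMul_zero, diagMul_one,
      diagMul_two, Pi.smul_apply, smul_eq_mul] <;> field_simp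
  · linear_combination γ * J 0 * hv
  · linear_combination γ * J 1 * hv
  · linear_combination α * J 2 * hv

theorem ne_zero_of_cross_ne_zero (hJe : J ⨯₃ e ≠ 0) : J ≠ 0 := fun h => hJe (by simp [h])

theorem dot_axisOne : J ⬝ᵥ axisOne α γ e J = 0 := by
  rw [axisOne, dotProduct_smul, dot_self_cross, smul_zero]

theorem dot_axisTwo : J ⬝ᵥ axisTwo α γ e J = 0 := by
  rw [axisTwo, dotProduct_smul, dot_self_cross, smul_zero]

theorem axisOne_form (hα : 0 < α) (hγ : 0 < γ) (hJe : J ⨯₃ e ≠ 0) :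
    axisOne α γ e J ⬝ᵥ diagMul α γ (axisOne α γ e J) = 1 := by
  have h := diagMul_form_pos hα hγ hJe
  rw [axisOne, diagMul_smul, smul_dotProduct, dotProduct_smul, smul_eq_mul, smul_eq_mul,
    ← mul_assoc, ← mul_inv, Real.mul_self_sqrt h.le, inv_mul_cancel₀ h.ne']

theorem cross_axisOne (hα : 0 < α) (hγ : 0 < γ) (hJe : J ⨯₃ e ≠ 0) :
    J ⨯₃ diagMul α γ (axisOne α γ e J) = planeFrequency α γ J • axisTwo α γ e J := by
  have h := planeFrequency_pos hα hγ (ne_zero_of_cross_ne_zero hJe)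
  rw [axisTwo, smul_smul, mul_inv_cancel₀ h.ne', one_smul]

theorem cross_axisTwo (hα : 0 < α) (hγ : 0 < γ) (hJe : J ⨯₃ e ≠ 0) :
    J ⨯₃ diagMul α γ (axisTwo α γ e J) = -planeFrequency α γ J • axisOne α γ e J := by
  have h := planeFrequency_pos hα hγ (ne_zero_of_cross_ne_zero hJe)
  rw [axisTwo, diagMul_smul, map_smul, cross_diagMul_cross_diagMul hα hγ dot_axisOne,
    ← planeFrequency_sq hα hγ (ne_zero_of_cross_ne_zero hJe), smul_smul]
  congr 1
  field_simp

theorem axisOne_axisTwo : axisOne α γ e J ⬝ᵥ diagMul α γ (axisTwo α γ e J) = 0 := by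
  rw [← diagMul_dot, axisTwo, dotProduct_smul, dot_cross_self, smul_zero]

theorem axisTwo_axisOne : axisTwo α γ e J ⬝ᵥ diagMul α γ (axisOne α γ e J) = 0 := by
  rw [dotProduct_comm, diagMul_dot, axisOne_axisTwo]

/-- Skewness of v ↦ J × C v transfers the normalization from the first axis to the second. -/
theorem axisTwo_form (hα : 0 < α) (hγ : 0 < γ) (hJe : J ⨯₃ e ≠ 0) :
    axisTwo α γ e J ⬝ᵥ diagMul α γ (axisTwo α γ e J) = 1 := by
  have h := planeFrequency_pos hα hγ (ne_zero_of_cross_ne_zero hJe)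
  have h1 : planeFrequency α γ J * (axisTwo α γ e J ⬝ᵥ diagMul α γ (axisTwo α γ e J)) =
      planeFrequency α γ J := by
    have h2 : diagMul α γ (axisTwo α γ e J) ⬝ᵥ (J ⨯₃ diagMul α γ (axisOne α γ e J)) =
        -(diagMul α γ (axisOne α γ e J) ⬝ᵥ (J ⨯₃ diagMul α γ (axisTwo α γ e J))) := by
      simp only [dot_eq, cross_zero, cross_one, cross_two]; ring
    rw [cross_axisOne hα hγ hJe, cross_axisTwo hα hγ hJe, dotProduct_smul, dotProduct_smul,
      diagMul_dot, diagMul_dot, axisOne_form hα hγ hJe] at h2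
    simpa using h2
  exact mul_left_cancel₀ h.ne' (h1.trans (mul_one _).symm)

theorem axisOne_dot : axisOne α γ e J ⬝ᵥ J = 0 := by rw [dotProduct_comm, dot_axisOne]

theorem axisTwo_dot : axisTwo α γ e J ⬝ᵥ J = 0 := by rw [dotProduct_comm, dot_axisTwo]

theorem ellipse_dot (hα : 0 < α) (hγ : 0 < γ) (hJ : J ≠ 0) (φ : ℝ) :
    ellipse α γ e J c φ ⬝ᵥ J = c := by
  have h := dualForm_pos hα hγ hJ
  rw [ellipse, add_dotProduct, add_dotProduct, smul_dotProduct, smul_dotProduct, smul_dotProduct,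
    axisOne_dot, axisTwo_dot, dotProduct_comm, ← dualForm, smul_eq_mul, div_mul_cancel₀ _ h.ne']
  simp

theorem diagMul_ellipse (hα : 0 < α) (hγ : 0 < γ) (φ : ℝ) :
    diagMul α γ (ellipse α γ e J c φ) = (c / dualForm α γ J) • J +
      (ellipseRadius α γ J c * Real.cos φ) • diagMul α γ (axisOne α γ e J) +
        (ellipseRadius α γ J c * Real.sin φ) • diagMul α γ (axisTwo α γ e J) := by
  rw [ellipse, diagMul_add, diagMul_add, diagMul_smul, diagMul_smul, diagMul_smul,
    diagMul_inv hα hγ]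

theorem ellipse_axisOne (hα : 0 < α) (hγ : 0 < γ) (hJe : J ⨯₃ e ≠ 0) (φ : ℝ) :
    ellipse α γ e J c φ ⬝ᵥ diagMul α γ (axisOne α γ e J) =
      ellipseRadius α γ J c * Real.cos φ := by
  rw [← diagMul_dot, diagMul_ellipse hα hγ]
  simp only [add_dotProduct, smul_dotProduct, smul_eq_mul, diagMul_dot, dot_axisOne,
    axisOne_form hα hγ hJe, axisTwo_axisOne]
  ring

theorem ellipse_axisTwo (hα : 0 < α) (hγ : 0 < γ) (hJe : J ⨯₃ e ≠ 0) (φ : ℝ) :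
    ellipse α γ e J c φ ⬝ᵥ diagMul α γ (axisTwo α γ e J) =
      ellipseRadius α γ J c * Real.sin φ := by
  rw [← diagMul_dot, diagMul_ellipse hα hγ]
  simp only [add_dotProduct, smul_dotProduct, smul_eq_mul, diagMul_dot, dot_axisTwo,
    axisTwo_form hα hγ hJe, axisOne_axisTwo]
  ring

/-- The centre (c / H) C⁻¹ J of the section has C-length squared c² / H, and the radius accounts for
the rest of c; the rest is positive because 0 < c < H. -/
theorem ellipseRadius_sq (hα : 0 < α) (hγ : 0 < γ) (hJ : J ≠ 0) (hc : 0 < c)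
    (hcH : c < dualForm α γ J) : 0 < ellipseRadius α γ J c ∧
      ellipseRadius α γ J c ^ 2 = c - c ^ 2 / dualForm α γ J := by
  have h := dualForm_pos hα hγ hJ
  have h1 : 0 < c - c ^ 2 / dualForm α γ J := by
    rw [sub_pos, div_lt_iff₀ h, sq]
    exact mul_lt_mul_of_pos_left hcH hc
  exact ⟨Real.sqrt_pos.2 h1, Real.sq_sqrt h1.le⟩

theorem ellipse_form (hα : 0 < α) (hγ : 0 < γ) (hJe : J ⨯₃ e ≠ 0) (hc : 0 < c)
    (hcH : c < dualForm α γ J) (φ : ℝ) :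
    ellipse α γ e J c φ ⬝ᵥ diagMul α γ (ellipse α γ e J c φ) = c := by
  have hJ := ne_zero_of_cross_ne_zero hJe
  have h := (dualForm_pos hα hγ hJ).ne'
  rw [diagMul_ellipse hα hγ]
  simp only [dotProduct_add, dotProduct_smul, ellipse_dot hα hγ hJ, ellipse_axisOne hα hγ hJe,
    ellipse_axisTwo hα hγ hJe, smul_eq_mul]
  have h1 := (ellipseRadius_sq hα hγ hJ hc hcH).2
  have h2 := Real.sin_sq_add_cos_sq φ
  have h3 : c / dualForm α γ J * c = c ^ 2 / dualForm α γ J := by ring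
  rw [h3]
  linear_combination (ellipseRadius α γ J c) ^ 2 * h2 + h1

/-- The map v ↦ J × C v annihilates the centre and turns one axis into the other. The tangent
therefore has the direction of `spinField`, and the motion of the spin vector only reparametrizes
the angle. -/
theorem hasDerivAt_ellipse (hα : 0 < α) (hγ : 0 < γ) (hJe : J ⨯₃ e ≠ 0) (φ : ℝ) :
    HasDerivAt (ellipse α γ e J c)
      ((planeFrequency α γ J)⁻¹ • (J ⨯₃ diagMul α γ (ellipse α γ e J c φ))) φ := by
  have h := (planeFrequency_pos hα hγ (ne_zero_of_cross_ne_zero hJe)).ne'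
  have h1 : HasDerivAt (ellipse α γ e J c)
      ((ellipseRadius α γ J c * -Real.sin φ) • axisOne α γ e J +
        (ellipseRadius α γ J c * Real.cos φ) • axisTwo α γ e J) φ :=
    ((((Real.hasDerivAt_cos φ).const_mul _).smul_const _).const_add _).add
      (((Real.hasDerivAt_sin φ).const_mul _).smul_const _)
  refine h1.congr_deriv ?_
  rw [diagMul_ellipse hα hγ]
  simp only [map_add, map_smul, cross_self, cross_axisOne hα hγ hJe, cross_axisTwo hα hγ hJe,
    smul_add, smul_smul, smul_zero, zero_add]
  rw [add_comm]
  congr 2 <;> field_simp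

theorem exists_cos_sin {x y R : ℝ} (hR : 0 < R) (h : x ^ 2 + y ^ 2 = R ^ 2) :
    ∃ φ, R * Real.cos φ = x ∧ R * Real.sin φ = y := by
  have hn : ‖(⟨x, y⟩ : ℂ)‖ = R := by
    rw [Complex.norm_def, Complex.normSq_mk, ← sq, ← sq, h, Real.sqrt_sq hR.le]
  have hz : (⟨x, y⟩ : ℂ) ≠ 0 := fun h0 => by rw [h0, norm_zero] at hn; exact hR.ne hn
  refine ⟨Complex.arg ⟨x, y⟩, ?_, ?_⟩
  · rw [Complex.cos_arg hz, hn]; field_simp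
  · rw [Complex.sin_arg, hn]; field_simp

/-- With b the second axis, the product C b × (b × M) is expanded in two ways, once after
recognizing b × M as a multiple of J. -/
theorem eq_combination (hα : 0 < α) (hγ : 0 < γ) (hJe : J ⨯₃ e ≠ 0) {M : Vec} (hM : J ⬝ᵥ M = 0) :
    M = (M ⬝ᵥ diagMul α γ (axisOne α γ e J)) • axisOne α γ e J +
      (M ⬝ᵥ diagMul α γ (axisTwo α γ e J)) • axisTwo α γ e J := by
  have h := (planeFrequency_pos hα hγ (ne_zero_of_cross_ne_zero hJe)).ne'
  set x := M ⬝ᵥ diagMul α γ (axisOne α γ e J)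
  set y := M ⬝ᵥ diagMul α γ (axisTwo α γ e J)
  have h1 : planeFrequency α γ J • (axisTwo α γ e J ⨯₃ M) = -x • J := by
    rw [← LinearMap.smul_apply, ← map_smul, ← cross_axisOne hα hγ hJe, cross_cross_eq_smul_sub_smul,
      hM, zero_smul, zero_sub, neg_smul, dotProduct_comm]
  have h2 : planeFrequency α γ J • (diagMul α γ (axisTwo α γ e J) ⨯₃ (axisTwo α γ e J ⨯₃ M)) =
      planeFrequency α γ J • (y • axisTwo α γ e J - M) := by
    rw [cross_cross_eq_smul_sub_smul', axisTwo_form hα hγ hJe,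
      one_smul, dotProduct_comm]
  rw [← map_smul, h1, map_smul, ← cross_anticomm, cross_axisTwo hα hγ hJe] at h2
  have h3 : planeFrequency α γ J • M = planeFrequency α γ J • (x • axisOne α γ e J +
      y • axisTwo α γ e J) := by
    rw [smul_add, smul_smul, smul_smul]
    rw [smul_sub, smul_smul] at h2
    have h4 : -x • -(-planeFrequency α γ J • axisOne α γ e J) =
      -((planeFrequency α γ J * x) • axisOne α γ e J) := by module
    rw [h4] at h2
    rw [eq_sub_iff_add_eq] at h2
    rw [← h2]; abel
  exact smul_right_injective _ h h3

theorem exists_ellipse_eq (hα : 0 < α) (hγ : 0 < γ) (hJe : J ⨯₃ e ≠ 0) (hc : 0 < c)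
    (hcH : c < dualForm α γ J) {N : Vec} (h1 : N ⬝ᵥ J = c) (h2 : N ⬝ᵥ diagMul α γ N = c) :
    ∃ φ, ellipse α γ e J c φ = N := by
  have hJ := ne_zero_of_cross_ne_zero hJe
  have hH := (dualForm_pos hα hγ hJ).ne'
  obtain ⟨hR, hR2⟩ := ellipseRadius_sq hα hγ hJ hc hcH
  set M := N - (c / dualForm α γ J) • diagMul α⁻¹ γ⁻¹ J with hM
  have hJM : J ⬝ᵥ M = 0 := by
    rw [hM, dotProduct_sub, dotProduct_smul, ← dualForm, smul_eq_mul, div_mul_cancel₀ _ hH,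
      dotProduct_comm, h1, sub_self]
  have hcomb := eq_combination hα hγ hJe hJM
  set x := M ⬝ᵥ diagMul α γ (axisOne α γ e J)
  set y := M ⬝ᵥ diagMul α γ (axisTwo α γ e J)
  have hMM : M ⬝ᵥ diagMul α γ M = x ^ 2 + y ^ 2 := by
    rw [hcomb, diagMul_add, diagMul_smul, diagMul_smul]
    simp only [dotProduct_add, add_dotProduct, dotProduct_smul, smul_dotProduct,
      axisOne_form hα hγ hJe, axisTwo_form hα hγ hJe, axisOne_axisTwo, axisTwo_axisOne, smul_eq_mul]
    ring
  have hMM' : M ⬝ᵥ diagMul α γ M = c - c ^ 2 / dualForm α γ J := by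
    have h3 : diagMul α γ M = diagMul α γ N - (c / dualForm α γ J) • J := by
      rw [hM, diagMul_sub, diagMul_smul, diagMul_inv hα hγ]
    rw [h3, dotProduct_sub, dotProduct_smul, dotProduct_comm M J, hJM, hM, sub_dotProduct, h2,
      smul_dotProduct, ← diagMul_dot, diagMul_inv hα hγ, dotProduct_comm J N, h1]
    simp only [smul_eq_mul]
    ring
  obtain ⟨φ, hx, hy⟩ := exists_cos_sin hR (hMM.symm.trans (hMM'.trans hR2.symm))
  refine ⟨φ, ?_⟩
  rw [ellipse, hx, hy, add_assoc, ← hcomb, hM]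
  abel

theorem cos_sin_of_ellipse_eq (hα : 0 < α) (hγ : 0 < γ) (hJe : J ⨯₃ e ≠ 0) (hc : 0 < c)
    (hcH : c < dualForm α γ J) {φ ψ : ℝ} (h : ellipse α γ e J c φ = ellipse α γ e J c ψ) :
    Real.cos φ = Real.cos ψ ∧ Real.sin φ = Real.sin ψ := by
  have hR := (ellipseRadius_sq hα hγ (ne_zero_of_cross_ne_zero hJe) hc hcH).1
  have h1 := ellipse_axisOne (c := c) hα hγ hJe φ
  have h2 := ellipse_axisTwo (c := c) hα hγ hJe φ
  rw [h, ellipse_axisOne hα hγ hJe] at h1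
  rw [h, ellipse_axisTwo hα hγ hJe] at h2
  exact ⟨(mul_left_cancel₀ hR.ne' h1).symm, (mul_left_cancel₀ hR.ne' h2).symm⟩

theorem ellipse_ne_zero (hα : 0 < α) (hγ : 0 < γ) (hJ : J ≠ 0) (hc : 0 < c) (φ : ℝ) :
    ellipse α γ e J c φ ≠ 0 := fun h => by
  have := ellipse_dot (e := e) (c := c) hα hγ hJ φ
  rw [h, zero_dotProduct] at this
  exact hc.ne this

/-- This identity turns the upper bound c < H into nonvanishing of the transverse part of the
angular velocity. -/
theorem transverse_form (hα : 0 < α) (hγ : 0 < γ) {N : Vec} (h1 : N ⬝ᵥ J = c)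
    (h2 : N ⬝ᵥ diagMul α γ N = c) :
    (J - diagMul α γ N) ⬝ᵥ diagMul α⁻¹ γ⁻¹ (J - diagMul α γ N) = dualForm α γ J - c := by
  have h3 : diagMul α⁻¹ γ⁻¹ (diagMul α γ N) = N := by
    apply vec_ext <;> simp [hα.ne', hγ.ne']
  rw [diagMul_sub, h3, dotProduct_sub, sub_dotProduct, ← dualForm, sub_dotProduct,
    dotProduct_comm J N, h1, diagMul_dot, diagMul_inv hα hγ, h1, diagMul_dot, h2]
  ring

theorem ellipse_periodic (α γ : ℝ) (e J : Vec) (c : ℝ) :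
    Function.Periodic (ellipse α γ e J c) (2 * Real.pi) := fun φ => by
  simp [ellipse]

end Ellipse

section Smooth

variable {F : Type*} [NormedAddCommGroup F] [NormedSpace ℝ F] {n : WithTop ℕ∞} {y : F}
  {α γ : ℝ} {e : Vec} {J : F → Vec} {c φ : F → ℝ}

theorem contDiffAt_dualForm (hJ : ContDiffAt ℝ n J y) :
    ContDiffAt ℝ n (fun x => dualForm α γ (J x)) y :=
  contDiffAt_dot hJ (contDiffAt_diagMul contDiffAt_const contDiffAt_const hJ)

theorem contDiffAt_planeFrequency (hα : 0 < α) (hγ : 0 < γ) (hJ : ContDiffAt ℝ n J y)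
    (h0 : J y ≠ 0) : ContDiffAt ℝ n (fun x => planeFrequency α γ (J x)) y :=
  contDiffAt_const.mul ((contDiffAt_const.mul (contDiffAt_dualForm hJ)).sqrt
    (mul_pos hγ (dualForm_pos hα hγ h0)).ne')

theorem contDiffAt_axisOne (hα : 0 < α) (hγ : 0 < γ) (hJ : ContDiffAt ℝ n J y)
    (h0 : J y ⨯₃ e ≠ 0) : ContDiffAt ℝ n (fun x => axisOne α γ e (J x)) y := by
  have h1 := contDiffAt_cross hJ (contDiffAt_const (c := e))
  have h2 := diagMul_form_pos hα hγ h0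
  exact (((contDiffAt_dot h1 (contDiffAt_diagMul contDiffAt_const contDiffAt_const h1)).sqrt
    h2.ne').inv (Real.sqrt_pos.2 h2).ne').smul h1

theorem contDiffAt_axisTwo (hα : 0 < α) (hγ : 0 < γ) (hJ : ContDiffAt ℝ n J y)
    (h0 : J y ⨯₃ e ≠ 0) : ContDiffAt ℝ n (fun x => axisTwo α γ e (J x)) y := by
  have h1 := ne_zero_of_cross_ne_zero h0
  exact ((contDiffAt_planeFrequency hα hγ hJ h1).inv (planeFrequency_pos hα hγ h1).ne').smul
    (contDiffAt_cross hJ (contDiffAt_diagMul contDiffAt_const contDiffAt_const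
      (contDiffAt_axisOne hα hγ hJ h0)))

theorem contDiffAt_ellipseRadius (hα : 0 < α) (hγ : 0 < γ) (hJ : ContDiffAt ℝ n J y)
    (hc : ContDiffAt ℝ n c y) (h0 : J y ≠ 0) (h1 : 0 < c y) (h2 : c y < dualForm α γ (J y)) :
    ContDiffAt ℝ n (fun x => ellipseRadius α γ (J x) (c x)) y := by
  refine (hc.sub ((hc.pow 2).div (contDiffAt_dualForm hJ) (dualForm_pos hα hγ h0).ne')).sqrt ?_
  have h3 := (ellipseRadius_sq hα hγ h0 h1 h2).2
  simp only [Pi.div_apply]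
  rw [← h3]
  exact (pow_pos (ellipseRadius_sq hα hγ h0 h1 h2).1 2).ne'

theorem contDiffAt_ellipse (hα : 0 < α) (hγ : 0 < γ) (hJ : ContDiffAt ℝ n J y)
    (hc : ContDiffAt ℝ n c y) (hφ : ContDiffAt ℝ n φ y) (h0 : J y ⨯₃ e ≠ 0) (h1 : 0 < c y)
    (h2 : c y < dualForm α γ (J y)) :
    ContDiffAt ℝ n (fun x => ellipse α γ e (J x) (c x) (φ x)) y := by
  have h3 := ne_zero_of_cross_ne_zero h0
  have hR := contDiffAt_ellipseRadius hα hγ hJ hc h3 h1 h2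
  exact (((hc.div (contDiffAt_dualForm hJ) (dualForm_pos hα hγ h3).ne').smul
    (contDiffAt_diagMul contDiffAt_const contDiffAt_const hJ)).add
      ((hR.mul hφ.cos).smul (contDiffAt_axisOne hα hγ hJ h0))).add
        ((hR.mul hφ.sin).smul (contDiffAt_axisTwo hα hγ hJ h0))

end Smooth

end Chaplygin

/-! ### Reconstruction of attitude and angular velocity from spin vector and phase. -/

namespace Chaplygin

/-- The matrix with columns `u`, `v`, `w`. -/
def colMat (u v w : Vec) : Mat := of fun i => ![u i, v i, w i]

theorem colMat_mulVec (u v w z : Vec) : colMat u v w *ᵥ z = z 0 • u + z 1 • v + z 2 • w := by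
  ext i
  simp [colMat, mulVec, dotProduct, Fin.sum_univ_three]
  ring

theorem mul_colMat (M : Mat) (u v w : Vec) :
    M * colMat u v w = colMat (M *ᵥ u) (M *ᵥ v) (M *ᵥ w) := by
  ext i j
  fin_cases j <;> simp [colMat, Matrix.mul_apply, mulVec, dotProduct, Fin.sum_univ_three]

theorem colMat_mul_hat (u v w : Vec) : colMat u v w * hat e₃ = colMat v (-u) 0 := by
  ext i j
  fin_cases j <;> simp [colMat, Matrix.mul_apply, Fin.sum_univ_three, hat]

theorem transpose_colMat_mulVec (u v w z : Vec) :
    (colMat u v w)ᵀ *ᵥ z = ![u ⬝ᵥ z, v ⬝ᵥ z, w ⬝ᵥ z] := by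
  ext i
  fin_cases i <;> simp [colMat, mulVec, dotProduct, Fin.sum_univ_three]

theorem colMat_injective {M : Mat} {u v w : Vec} (h0 : M *ᵥ ![1, 0, 0] = u)
    (h1 : M *ᵥ ![0, 1, 0] = v) (h2 : M *ᵥ ![0, 0, 1] = w) : M = colMat u v w := by
  subst h0 h1 h2
  ext i j
  fin_cases j <;> simp [colMat, mulVec, dotProduct, Fin.sum_univ_three]

/-- The frame with first vector `v` and third vector `n`. -/
def frame (v n : Vec) : Mat := colMat v (n ⨯₃ v) n

theorem frame_mem_SO3 {v n : Vec} (hv : v ⬝ᵥ v = 1) (hn : n ⬝ᵥ n = 1) (hvn : v ⬝ᵥ n = 0) :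
    frame v n ∈ SO3 := by
  have hnv : n ⬝ᵥ v = 0 := by rw [dotProduct_comm, hvn]
  have h2 : (n ⨯₃ v) ⬝ᵥ (n ⨯₃ v) = 1 := by rw [cross_dot_cross, hv, hn, hvn]; simp
  constructor
  · rw [← mul_eq_one_comm, frame, mul_colMat]
    simp only [transpose_colMat_mulVec, hv, hn, hvn, hnv, h2, dot_cross_self, dot_self_cross,
      dotProduct_comm (n ⨯₃ v) v, dotProduct_comm (n ⨯₃ v) n]
    ext i j
    fin_cases i <;> fin_cases j <;> simp [colMat]
  · have h3 : (frame v n).det = (n ⨯₃ v) ⬝ᵥ (n ⨯₃ v) := by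
      rw [frame, dot_eq, cross_zero, cross_one, cross_two, det_fin_three]
      simp [colMat, cross_zero, cross_one, cross_two]
      ring
    rw [h3, h2]

/-- The rotation about the third axis. -/
noncomputable def zRot (ψ : ℝ) : Mat :=
  !![Real.cos ψ, -Real.sin ψ, 0; Real.sin ψ, Real.cos ψ, 0; 0, 0, 1]

theorem zRot_mem_SO3 (ψ : ℝ) : zRot ψ ∈ SO3 := by
  have h := Real.sin_sq_add_cos_sq ψ
  constructor
  · ext i j
    fin_cases i <;> fin_cases j <;>
      simp [zRot, Matrix.mul_apply, Fin.sum_univ_three] <;>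
      first
      | linear_combination h
      | ring
  · simp [zRot, det_fin_three]
    linear_combination h

theorem zRot_transpose_mulVec_e₃ (ψ : ℝ) : (zRot ψ)ᵀ *ᵥ e₃ = e₃ := by
  apply vec_ext <;> simp [zRot, mulVec, dotProduct, Fin.sum_univ_three]

theorem hasDerivAt_zRot_transpose {ψ : ℝ → ℝ} {ψ' t : ℝ} (h : HasDerivAt ψ ψ' t) :
    HasDerivAt (fun s => (zRot (ψ s))ᵀ) (-ψ' • (hat e₃ * (zRot (ψ t))ᵀ)) t := by
  have hc := h.cos
  have hs := h.sin
  have hm : -ψ' • (hat e₃ * (zRot (ψ t))ᵀ) =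
      !![-Real.sin (ψ t) * ψ', Real.cos (ψ t) * ψ', 0;
        -(Real.cos (ψ t) * ψ'), -Real.sin (ψ t) * ψ', 0; 0, 0, 0] := by
    ext i j
    rw [Matrix.smul_apply, Matrix.mul_apply, Fin.sum_univ_three]
    fin_cases i <;> fin_cases j <;> simp [zRot, hat] <;> ring
  rw [hm, hasDerivAt_mat]
  intro i j
  fin_cases i <;> fin_cases j
  exacts [hc, hs, hasDerivAt_const _ _, hs.neg, hc, hasDerivAt_const _ _, hasDerivAt_const _ _,
    hasDerivAt_const _ _, hasDerivAt_const _ _]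

theorem hasDerivAt_colMat {u v w : ℝ → Vec} {u' v' w' : Vec} {t : ℝ} (hu : HasDerivAt u u' t)
    (hv : HasDerivAt v v' t) (hw : HasDerivAt w w' t) :
    HasDerivAt (fun s => colMat (u s) (v s) (w s)) (colMat u' v' w') t := by
  rw [hasDerivAt_pi] at hu hv hw
  rw [hasDerivAt_mat]
  intro i j
  fin_cases j
  exacts [hu i, hv i, hw i]

theorem contDiffAt_colMat {F : Type*} [NormedAddCommGroup F] [NormedSpace ℝ F] {k : WithTop ℕ∞}
    {y : F} {u v w : F → Vec} (hu : ContDiffAt ℝ k u y) (hv : ContDiffAt ℝ k v y)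
    (hw : ContDiffAt ℝ k w y) : ContDiffAt ℝ k (fun x => colMat (u x) (v x) (w x)) y := by
  rw [contDiffAt_vec] at hu hv hw
  rw [contDiffAt_mat]
  intro i j
  fin_cases j
  exacts [hu i, hv i, hw i]

theorem contDiffAt_zRot {F : Type*} [NormedAddCommGroup F] [NormedSpace ℝ F] {k : WithTop ℕ∞}
    {y : F} {ψ : F → ℝ} (h : ContDiffAt ℝ k ψ y) : ContDiffAt ℝ k (fun x => zRot (ψ x)) y := by
  rw [contDiffAt_mat]
  intro i j
  fin_cases i <;> fin_cases j
  exacts [h.cos, h.sin.neg, contDiffAt_const, h.sin, h.cos, contDiffAt_const, contDiffAt_const,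
    contDiffAt_const, contDiffAt_const]

/-- The derivative of an orthonormal frame in a rotating system. -/
theorem hasDerivAt_frame_mul_zRot {v n : ℝ → Vec} {ψ : ℝ → ℝ} {v' W : Vec} {t : ℝ}
    (hv1 : ∀ s, v s ⬝ᵥ v s = 1) (hn1 : ∀ s, n s ⬝ᵥ n s = 1) (hvn : ∀ s, v s ⬝ᵥ n s = 0)
    (hn : HasDerivAt n (W ⨯₃ n t) t) (hv : HasDerivAt v v' t)
    (hψ : HasDerivAt ψ (n t ⬝ᵥ (v t ⨯₃ v') - W ⬝ᵥ n t) t) :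
    HasDerivAt (fun s => frame (v s) (n s) * (zRot (ψ s))ᵀ)
      (hat W * (frame (v t) (n t) * (zRot (ψ t))ᵀ)) t := by
  have h1 : v' ⬝ᵥ v t + v t ⬝ᵥ v' = 0 := by
    have h := hasDerivAt_dot hv hv
    simp only [hv1] at h
    exact h.unique (hasDerivAt_const t _)
  have h2 : v' ⬝ᵥ n t + v t ⬝ᵥ (W ⨯₃ n t) = 0 := by
    have h := hasDerivAt_dot hv hn
    simp only [hvn] at h
    exact h.unique (hasDerivAt_const t _)
  set p := n t ⬝ᵥ (v t ⨯₃ v') - W ⬝ᵥ n t with hp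
  have hF := frame_mem_SO3 (hv1 t) (hn1 t) (hvn t)
  -- Orthonormality forces the components along `v` and `n` to be those of W × v; along n × v there
  -- is the excess `p`. The frame thus turns with W and an extra rate `p` about `n`, which the
  -- factor `zRot` with phase rate `p` removes.
  have hv' : v' = W ⨯₃ v t + p • (n t ⨯₃ v t) := by
    have h3 := mulVec_transpose_mulVec hF (v' - W ⨯₃ v t)
    rw [frame, transpose_colMat_mulVec, colMat_mulVec] at h3
    have h4 : v t ⬝ᵥ (v' - W ⨯₃ v t) = 0 := by
      rw [dotProduct_sub, dot_cross_self, dotProduct_comm]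
      rw [dotProduct_comm (v t)] at h1
      linarith
    have h5 : n t ⬝ᵥ (v' - W ⨯₃ v t) = 0 := by
      have : n t ⬝ᵥ (W ⨯₃ v t) = -(v t ⬝ᵥ (W ⨯₃ n t)) := by
        simp only [dot_eq, cross_zero, cross_one, cross_two]; ring
      rw [dotProduct_sub, this, dotProduct_comm]
      linarith
    have h6 : (n t ⨯₃ v t) ⬝ᵥ (v' - W ⨯₃ v t) = p := by
      have h7 : (n t ⨯₃ v t) ⬝ᵥ v' = n t ⬝ᵥ (v t ⨯₃ v') := by
        simp only [dot_eq, cross_zero, cross_one, cross_two]; ring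
      rw [dotProduct_sub, cross_dot_cross, h7, hv1, dotProduct_comm (n t) (v t), hvn, hp,
        dotProduct_comm W]
      ring
    simp only [h4, h5, h6, cons_val_zero, cons_val_one, cons_val, zero_smul, zero_add,
      add_zero] at h3
    rw [h3]; abel
  have hframe : HasDerivAt (fun s => frame (v s) (n s))
      (hat W * frame (v t) (n t) + p • (frame (v t) (n t) * hat e₃)) t := by
    refine (hasDerivAt_colMat hv (hasDerivAt_cross hn hv) hn).congr_deriv ?_
    have h8 : n t ⨯₃ (n t ⨯₃ v t) = -v t := by
      rw [cross_cross_eq_smul_sub_smul', hn1, dotProduct_comm, hvn]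
      simp
    have h9 : (W ⨯₃ n t) ⨯₃ v t + n t ⨯₃ v' = W ⨯₃ (n t ⨯₃ v t) - p • v t := by
      rw [hv', map_add, map_smul, h8, leibniz_cross W]
      module
    rw [h9, frame, mul_colMat, colMat_mul_hat, hat_mulVec, hat_mulVec, hat_mulVec, hv']
    ext i j
    fin_cases j <;> simp [colMat]
    ring
  refine (hasDerivAt_mul hframe (hasDerivAt_zRot_transpose hψ)).congr_deriv ?_
  rw [Matrix.add_mul, Matrix.smul_mul, Matrix.mul_smul, Matrix.mul_assoc, Matrix.mul_assoc,
    neg_smul]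
  abel

/-- The component of the angular velocity orthogonal to the spin vector `N`. -/
def transverse (α γ : ℝ) (J N : Vec) : Vec := J - diagMul α γ N

/-- The signed length of the spin vector. -/
noncomputable def spinSpeed (σ : ℝ) (N : Vec) : ℝ := σ * √(N ⬝ᵥ N)

/-- The velocity of the spin vector. -/
noncomputable def spinField (α γ : ℝ) (J : Vec) (c : ℝ) (N : Vec) : Vec :=
  ((N ⬝ᵥ N) / c) • (J ⨯₃ diagMul α γ N)

/-- The angular velocity of the transverse part of the angular velocity in the body. -/
noncomputable def precessionRate (α γ σ : ℝ) (J : Vec) (c : ℝ) (N : Vec) : ℝ :=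
  N ⬝ᵥ (transverse α γ J N ⨯₃ -diagMul α γ (spinField α γ J c N)) /
    (spinSpeed σ N * (transverse α γ J N ⬝ᵥ transverse α γ J N)) - spinSpeed σ N

/-- The attitude with spin vector `N` and phase `ψ` of the transverse angular velocity. -/
noncomputable def attitude (α γ σ : ℝ) (Q : Mat) (J N : Vec) (ψ : ℝ) : Mat :=
  frame ((√(transverse α γ J N ⬝ᵥ transverse α γ J N))⁻¹ • transverse α γ J N)
    ((spinSpeed σ N)⁻¹ • N) * (zRot ψ)ᵀ * Qᵀ

/-- The point of the phase space with spin vector `N` and phase `ψ` of the transverse angular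
velocity. -/
noncomputable def statePoint (α γ σ : ℝ) (Q : Mat) (J N : Vec) (ψ : ℝ) : Mat × Vec :=
  (attitude α γ σ Q J N ψ, (attitude α γ σ Q J N ψ)ᵀ *ᵥ (J + N - diagMul α γ N))

section State

variable {α γ σ c : ℝ} {Q : Mat} {J N d : Vec}

theorem spinSpeed_mul_self (hσ : σ * σ = 1) : spinSpeed σ N * spinSpeed σ N = N ⬝ᵥ N := by
  have h : 0 ≤ N ⬝ᵥ N := Finset.sum_nonneg fun i _ => mul_self_nonneg _
  have h1 := Real.mul_self_sqrt h
  rw [spinSpeed]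
  linear_combination (√(N ⬝ᵥ N)) ^ 2 * hσ + h1

theorem spinSpeed_ne_zero (hσ : σ * σ = 1) (hN : N ≠ 0) : spinSpeed σ N ≠ 0 := by
  intro h
  have h1 := spinSpeed_mul_self (N := N) hσ
  rw [h, zero_mul] at h1
  exact (dot_self_pos hN).ne h1

theorem normalize_dot_self {v : Vec} (hv : v ≠ 0) :
    ((√(v ⬝ᵥ v))⁻¹ • v) ⬝ᵥ ((√(v ⬝ᵥ v))⁻¹ • v) = 1 := by
  have h := dot_self_pos hv
  rw [smul_dotProduct, dotProduct_smul, smul_eq_mul, smul_eq_mul, ← mul_assoc, ← mul_inv,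
    Real.mul_self_sqrt h.le, inv_mul_cancel₀ h.ne']

theorem axis_dot_self (hσ : σ * σ = 1) (hN : N ≠ 0) :
    ((spinSpeed σ N)⁻¹ • N) ⬝ᵥ ((spinSpeed σ N)⁻¹ • N) = 1 := by
  have h := dot_self_pos hN
  rw [smul_dotProduct, dotProduct_smul, smul_eq_mul, smul_eq_mul, ← mul_assoc, ← mul_inv,
    spinSpeed_mul_self hσ, inv_mul_cancel₀ h.ne']

theorem transverse_dot (h1 : N ⬝ᵥ J = c) (h2 : N ⬝ᵥ diagMul α γ N = c) :
    transverse α γ J N ⬝ᵥ N = 0 := by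
  rw [transverse, dotProduct_comm, dotProduct_sub, h1, h2, sub_self]

theorem state_frame_mem (hσ : σ * σ = 1) (hN : N ≠ 0) (hV : transverse α γ J N ≠ 0)
    (h : transverse α γ J N ⬝ᵥ N = 0) :
    frame ((√(transverse α γ J N ⬝ᵥ transverse α γ J N))⁻¹ • transverse α γ J N)
      ((spinSpeed σ N)⁻¹ • N) ∈ SO3 :=
  frame_mem_SO3 (normalize_dot_self hV) (axis_dot_self hσ hN)
    (by rw [smul_dotProduct, dotProduct_smul, h]; simp)

theorem attitude_mem (hQ : Q ∈ SO3) (hσ : σ * σ = 1) (hN : N ≠ 0) (hV : transverse α γ J N ≠ 0)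
    (h : transverse α γ J N ⬝ᵥ N = 0) (ψ : ℝ) : attitude α γ σ Q J N ψ ∈ SO3 :=
  mul_mem_SO3 (mul_mem_SO3 (state_frame_mem hσ hN hV h) (transpose_mem_SO3 (zRot_mem_SO3 ψ)))
    (transpose_mem_SO3 hQ)

theorem attitude_mulVec_axis (hQ : Q ∈ SO3) (hQd : Q *ᵥ e₃ = d) (ψ : ℝ) :
    attitude α γ σ Q J N ψ *ᵥ d = (spinSpeed σ N)⁻¹ • N := by
  rw [attitude, ← hQd, ← mulVec_mulVec, ← mulVec_mulVec, transpose_mulVec_mulVec hQ,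
    zRot_transpose_mulVec_e₃, frame, colMat_mulVec]
  simp

theorem statePoint_velocity (hQ : Q ∈ SO3) (hσ : σ * σ = 1) (hN : N ≠ 0)
    (hV : transverse α γ J N ≠ 0) (h : transverse α γ J N ⬝ᵥ N = 0) (ψ : ℝ) :
    (statePoint α γ σ Q J N ψ).1 *ᵥ (statePoint α γ σ Q J N ψ).2 =
      J + N - diagMul α γ N :=
  mulVec_transpose_mulVec (attitude_mem hQ hσ hN hV h ψ) _

theorem velocity_eq_transverse_add : J + N - diagMul α γ N = transverse α γ J N + N := by
  rw [transverse]; abel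

theorem axis_dot_statePoint (hQ : Q ∈ SO3) (hQd : Q *ᵥ e₃ = d) (hσ : σ * σ = 1) (hN : N ≠ 0)
    (h : transverse α γ J N ⬝ᵥ N = 0) (ψ : ℝ) :
    d ⬝ᵥ (statePoint α γ σ Q J N ψ).2 = spinSpeed σ N := by
  have h1 := spinSpeed_ne_zero hσ hN
  rw [statePoint]
  simp only
  rw [← mulVec_dotProduct, attitude_mulVec_axis hQ hQd, velocity_eq_transverse_add, smul_dotProduct,
    dotProduct_add, dotProduct_comm, h, zero_add, ← spinSpeed_mul_self hσ, smul_eq_mul]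
  field_simp

theorem spin_statePoint (hQ : Q ∈ SO3) (hQd : Q *ᵥ e₃ = d) (hσ : σ * σ = 1) (hN : N ≠ 0)
    (h : transverse α γ J N ⬝ᵥ N = 0) (ψ : ℝ) :
    spin d (statePoint α γ σ Q J N ψ) = N := by
  have h1 := spinSpeed_ne_zero hσ hN
  rw [spin, axis_dot_statePoint hQ hQd hσ hN h]
  simp only [statePoint]
  rw [attitude_mulVec_axis hQ hQd, smul_smul, mul_inv_cancel₀ h1, one_smul]

/-- This shows what ψ means: it is the polar angle of the angular velocity in the body frame `Q`,
and so can be read off from the point. -/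
theorem statePoint_bodyVelocity (hQ : Q ∈ SO3) (hσ : σ * σ = 1) (hN : N ≠ 0)
    (hV : transverse α γ J N ≠ 0) (h : transverse α γ J N ⬝ᵥ N = 0) (ψ : ℝ) :
    Qᵀ *ᵥ (statePoint α γ σ Q J N ψ).2 =
      ![√(transverse α γ J N ⬝ᵥ transverse α γ J N) * Real.cos ψ,
        √(transverse α γ J N ⬝ᵥ transverse α γ J N) * Real.sin ψ, spinSpeed σ N] := by
  have h1 := spinSpeed_ne_zero hσ hN
  have h2 := dot_self_pos hV
  have h3 := Real.sqrt_pos.2 h2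
  have h4 := Real.mul_self_sqrt h2.le
  have h5 := spinSpeed_mul_self (N := N) hσ
  have h6 : N ⬝ᵥ transverse α γ J N = 0 := by rw [dotProduct_comm, h]
  rw [statePoint, attitude, velocity_eq_transverse_add]
  simp only [transpose_mul, transpose_transpose]
  rw [← mulVec_mulVec, transpose_mulVec_mulVec hQ, ← mulVec_mulVec, frame, transpose_colMat_mulVec]
  set V := transverse α γ J N
  have e1 : ((√(V ⬝ᵥ V))⁻¹ • V) ⬝ᵥ (V + N) = √(V ⬝ᵥ V) := by
    rw [smul_dotProduct, dotProduct_add, h, add_zero, smul_eq_mul]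
    field_simp
    linarith
  have e2 : (((spinSpeed σ N)⁻¹ • N) ⨯₃ ((√(V ⬝ᵥ V))⁻¹ • V)) ⬝ᵥ (V + N) = 0 := by
    simp only [dot_eq, cross_zero, cross_one, cross_two, Pi.smul_apply, Pi.add_apply, smul_eq_mul]
    ring
  have e3 : ((spinSpeed σ N)⁻¹ • N) ⬝ᵥ (V + N) = spinSpeed σ N := by
    rw [smul_dotProduct, dotProduct_add, h6, zero_add, smul_eq_mul, ← h5]
    field_simp
  rw [e1, e2, e3]
  apply vec_ext <;> simp [zRot, mulVec, dotProduct, Fin.sum_univ_three] <;> ring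

/-- A point of the phase space is determined by its spin vector, the velocity and the phase of the
transverse angular velocity. -/
theorem eq_statePoint {x : Mat × Vec} (hx : x ∈ phaseSpace) (hQ : Q ∈ SO3) (hQd : Q *ᵥ e₃ = d)
    (hσ : σ * σ = 1) (hN : N ≠ 0) (hV : transverse α γ J N ≠ 0)
    (hvel : x.1 *ᵥ x.2 = J + N - diagMul α γ N) (hspin : spin d x = N) {ψ : ℝ}
    (hbody : Qᵀ *ᵥ x.2 =
      ![√(transverse α γ J N ⬝ᵥ transverse α γ J N) * Real.cos ψ,
        √(transverse α γ J N ⬝ᵥ transverse α γ J N) * Real.sin ψ, spinSpeed σ N]) :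
    x = statePoint α γ σ Q J N ψ := by
  have h1 := spinSpeed_ne_zero hσ hN
  have h2 := dot_self_pos hV
  have h3 := Real.sqrt_pos.2 h2
  have hR := zRot_mem_SO3 ψ
  set V := transverse α γ J N with hVdef
  set ρ := √(V ⬝ᵥ V) with hρ
  set s := spinSpeed σ N with hs
  have hds : d ⬝ᵥ x.2 = s := by
    rw [← hQd, mulVec_dotProduct, hbody, dot_eq]
    simp
  have hAd : x.1 *ᵥ d = s⁻¹ • N := by
    rw [← hspin, spin, hds, smul_smul, inv_mul_cancel₀ h1, one_smul]
  -- It suffices that `B` is the frame of the transverse and spin directions. The first and third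
  -- columns are compared directly; the second is their cross product.
  set B := x.1 * Q * zRot ψ with hB
  have hBmem : B ∈ SO3 := mul_mem_SO3 (mul_mem_SO3 hx hQ) hR
  have hRe3 : zRot ψ *ᵥ e₃ = e₃ := by
    conv_lhs => rw [← zRot_transpose_mulVec_e₃ ψ]
    exact mulVec_transpose_mulVec hR _
  have hB3 : B *ᵥ e₃ = s⁻¹ • N := by
    rw [hB, ← mulVec_mulVec, ← mulVec_mulVec, hRe3, hQd, hAd]
  have hB1 : B *ᵥ ![1, 0, 0] = ρ⁻¹ • V := by
    have h4 : zRot ψ *ᵥ ![1, 0, 0] = ρ⁻¹ • (Qᵀ *ᵥ x.2 - s • e₃) := by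
      rw [hbody]
      apply vec_ext <;> simp [zRot, mulVec, dotProduct, Fin.sum_univ_three, h3.ne', e₃]
    rw [hB, ← mulVec_mulVec, ← mulVec_mulVec, h4]
    simp only [mulVec_smul, mulVec_sub, mulVec_transpose_mulVec hQ, hQd, hvel, hAd, smul_smul,
      mul_inv_cancel₀ h1, one_smul, velocity_eq_transverse_add, add_sub_cancel_right, hVdef]
  have hB2 : B *ᵥ ![0, 1, 0] = (s⁻¹ • N) ⨯₃ (ρ⁻¹ • V) := by
    rw [← hB3, ← hB1, mulVec_cross_mulVec hBmem]
    congr 1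
    apply vec_ext <;> simp [cross_zero, cross_one, cross_two]
  have hBF : B = frame (ρ⁻¹ • V) (s⁻¹ • N) := colMat_injective hB1 hB2 hB3
  have hA : x.1 = attitude α γ σ Q J N ψ := by
    rw [attitude, ← hVdef, ← hρ, ← hs, ← hBF, hB, Matrix.mul_assoc (x.1 * Q), hR.1, Matrix.mul_one,
      Matrix.mul_assoc, hQ.1, Matrix.mul_one]
  refine Prod.ext hA ?_
  rw [statePoint]
  simp only
  rw [← hA, ← hvel, transpose_mulVec_mulVec hx]

/-- One rule serves both unit vectors of the frame: the axis with the sign `σ` of the spin, the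
transverse direction with sign 1. -/
theorem hasDerivAt_normalize_smul {v : ℝ → Vec} {v' : Vec} {t s : ℝ} (hs : s * s = v t ⬝ᵥ v t)
    (hs0 : s ≠ 0) {σ : ℝ} (hσ : σ * σ = 1) (hst : spinSpeed σ (v t) = s) (hv : HasDerivAt v v' t) :
    HasDerivAt (fun τ => (spinSpeed σ (v τ))⁻¹ • v τ)
      (s⁻¹ • (v' - ((v t ⬝ᵥ v') / (v t ⬝ᵥ v t)) • v t)) t := by
  have h0 : v t ⬝ᵥ v t ≠ 0 := by rw [← hs]; exact mul_ne_zero hs0 hs0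
  have hsq : √(v t ⬝ᵥ v t) = σ * s := by
    rw [← hst, spinSpeed, ← mul_assoc, hσ, one_mul]
  have hσ0 : σ ≠ 0 := fun h => by simp [h] at hσ
  have h1 : HasDerivAt (fun τ => spinSpeed σ (v τ)) ((v t ⬝ᵥ v') / s) t := by
    refine (((hasDerivAt_dot hv hv).sqrt h0).const_mul σ).congr_deriv ?_
    rw [hsq, dotProduct_comm v']
    field_simp
    ring
  have h2 : spinSpeed σ (v t) ≠ 0 := by rw [hst]; exact hs0
  refine ((h1.inv h2).smul hv).congr_deriv ?_
  rw [hst, ← hs]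
  ext i
  simp only [Pi.add_apply, Pi.smul_apply, Pi.sub_apply, smul_eq_mul, Pi.inv_apply, hst]
  field_simp
  ring

/-- If the spin vector and the phase obey the reduced equations, then the attitude turns with the
angular velocity. -/
theorem hasDerivAt_attitude {N : ℝ → Vec} {ψ : ℝ → ℝ} {t : ℝ} (hσ : σ * σ = 1) (hc : c ≠ 0)
    (hN0 : ∀ s, N s ≠ 0) (hV0 : ∀ s, transverse α γ J (N s) ≠ 0) (h1 : ∀ s, N s ⬝ᵥ J = c)
    (h2 : ∀ s, N s ⬝ᵥ diagMul α γ (N s) = c) (hN : HasDerivAt N (spinField α γ J c (N t)) t)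
    (hψ : HasDerivAt ψ (precessionRate α γ σ J c (N t)) t) :
    HasDerivAt (fun s => attitude α γ σ Q J (N s) (ψ s))
      (hat (J + N t - diagMul α γ (N t)) * attitude α γ σ Q J (N t) (ψ t)) t := by
  have hVN : ∀ s, transverse α γ J (N s) ⬝ᵥ N s = 0 := fun s => transverse_dot (h1 s) (h2 s)
  have hs0 := spinSpeed_ne_zero hσ (hN0 t)
  have hs := spinSpeed_mul_self (N := N t) hσ
  have hNN := (dot_self_pos (hN0 t)).ne'
  have hVV := dot_self_pos (hV0 t)
  have hρ := Real.sqrt_pos.2 hVV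
  have hV : HasDerivAt (fun s => transverse α γ J (N s))
      (-diagMul α γ (spinField α γ J c (N t))) t := by
    have := (hasDerivAt_const t J).sub (hasDerivAt_diagMul α γ hN)
    rwa [zero_sub] at this
  have hn' := hasDerivAt_normalize_smul hs hs0 hσ rfl hN
  have hv' := hasDerivAt_normalize_smul (σ := 1) (v := fun τ => transverse α γ J (N τ))
    (s := √(transverse α γ J (N t) ⬝ᵥ transverse α γ J (N t)))
    (Real.mul_self_sqrt hVV.le) hρ.ne' (one_mul 1) (one_mul _) hV
  simp only [spinSpeed, one_mul] at hv'
  have hn : HasDerivAt (fun τ => (spinSpeed σ (N τ))⁻¹ • N τ)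
      ((J + N t - diagMul α γ (N t)) ⨯₃ ((spinSpeed σ (N t))⁻¹ • N t)) t := by
    refine hn'.congr_deriv ?_
    rw [map_smul]
    congr 1
    have h3 := h1 t
    have h4 := h2 t
    generalize N t = N at *
    -- Since ⟨N, J⟩ and ⟨N, C N⟩ both equal c, the product (J × C N) × N is -c (J - C N). Hence the
    -- factor |N|² / c in `spinField` makes the normalized spin vector turn with the angular
    -- velocity.
    have h5 : (N ⬝ᵥ N) • (J ⨯₃ diagMul α γ N) - (N ⬝ᵥ (J ⨯₃ diagMul α γ N)) • N =
        c • ((J - diagMul α γ N) ⨯₃ N) := by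
      have h6 : N ⨯₃ ((J ⨯₃ diagMul α γ N) ⨯₃ N) =
          (N ⬝ᵥ N) • (J ⨯₃ diagMul α γ N) - (N ⬝ᵥ (J ⨯₃ diagMul α γ N)) • N := double_cross _ _
      rw [← h6, cross_cross_eq_smul_sub_smul, dotProduct_comm J, h3, dotProduct_comm, h4,
        ← smul_sub, map_smul, ← cross_anticomm, ← LinearMap.neg_apply, ← map_neg, neg_sub]
    rw [velocity_eq_transverse_add, map_add, LinearMap.add_apply, cross_self, add_zero, transverse,
      ← smul_right_inj hc, ← h5, spinField, dotProduct_smul, smul_eq_mul]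
    rw [smul_sub, smul_smul, smul_smul]
    congr 2 <;> field_simp
  have hmain := hasDerivAt_frame_mul_zRot (ψ := ψ) (fun s => normalize_dot_self (hV0 s))
    (fun s => axis_dot_self hσ (hN0 s)) (fun s => by
      rw [smul_dotProduct, dotProduct_smul, hVN]; simp) hn hv' (by
      refine hψ.congr_deriv ?_
      have e1 : (J + N t - diagMul α γ (N t)) ⬝ᵥ ((spinSpeed σ (N t))⁻¹ • N t) =
          spinSpeed σ (N t) := by
        rw [velocity_eq_transverse_add, dotProduct_smul, add_dotProduct, hVN, zero_add, ← hs,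
          smul_eq_mul]
        field_simp
      rw [e1, precessionRate]
      congr 1
      set V := transverse α γ J (N t)
      set V' := -diagMul α γ (spinField α γ J c (N t))
      set ρ := √(V ⬝ᵥ V)
      have hρ2 : ρ * ρ = V ⬝ᵥ V := Real.mul_self_sqrt hVV.le
      simp only [map_smul, map_sub, LinearMap.smul_apply, cross_self, smul_zero, sub_zero,
        smul_dotProduct, dotProduct_smul, smul_eq_mul, ← hρ2]
      field_simp)
  have h3 := hasDerivAt_mul hmain (hasDerivAt_const t Qᵀ)
  rw [Matrix.mul_zero, add_zero, Matrix.mul_assoc] at h3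
  exact h3

end State

theorem exists_frame {d : Vec} (hd : d ⬝ᵥ d = 1) : ∃ Q ∈ SO3, Q *ᵥ e₃ = d := by
  obtain ⟨z, hz, hz0⟩ : ∃ z : Vec, z ⬝ᵥ d = 0 ∧ z ≠ 0 := by
    by_cases h : d 0 = 0 ∧ d 1 = 0
    · exact ⟨![1, 0, 0], by rw [dot_eq]; simp [h.1], fun h => by simpa using congrFun h 0⟩
    · refine ⟨![-d 1, d 0, 0], by rw [dot_eq]; simp; ring, fun h' => h ?_⟩
      have h0 := congrFun h' 0
      have h1 := congrFun h' 1
      simp at h0 h1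
      exact ⟨h1, h0⟩
  refine ⟨_, frame_mem_SO3 (normalize_dot_self hz0) hd (by rw [smul_dotProduct, hz, smul_zero]), ?_⟩
  rw [frame, colMat_mulVec]
  simp

end Chaplygin

/-! ### Regular levels are those with a nondegenerate ellipse. -/

namespace Chaplygin

section Regular

variable {a k m r : ℝ} {d : Vec} {x : Mat × Vec}

/-- The values for which the spin vectors form a nondegenerate ellipse. -/
def ellipticValues (a k μ : ℝ) : Set (Vec × ℝ) :=
  {c | 0 < spinConst a k μ c ∧
    spinConst a k μ c < dualForm (horWeight a k μ) (verWeight a k) (spinlessVelocity a μ c.1)}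

theorem mulVec_eq_zero_iff {A : Mat} (hA : A ∈ SO3) {v : Vec} : A *ᵥ v = 0 ↔ v = 0 :=
  ⟨fun h => by rw [← transpose_mulVec_mulVec hA v, h, mulVec_zero], fun h => by rw [h, mulVec_zero]⟩

theorem transverse_spin (ha : 0 < a) (hμ : 0 < m * r ^ 2) (hx : x ∈ phaseSpace) :
    transverse (horWeight a k (m * r ^ 2)) (verWeight a k)
      (spinlessVelocity a (m * r ^ 2) (moment (axialInertia a k d) m r x)) (spin d x) =
    x.1 *ᵥ (x.2 - (d ⬝ᵥ x.2) • d) := by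
  rw [mulVec_sub, mulVec_smul, ← spin, velocity_eq (k := k) (d := d) ha hμ hx, transverse]
  abel

/-- Nonzero spin means ⟨N, C N⟩ = c > 0. By `transverse_form`, d × ω ≠ 0 means H - c > 0. Regularity
thus depends only on the values of j and T. -/
theorem isRegularPoint_iff_mem_ellipticValues (ha : 0 < a) (hb : 0 < a + k) (hk : k ≠ 0)
    (hμ : 0 < m * r ^ 2) (hd : d ⬝ᵥ d = 1) (hx : x ∈ phaseSpace) :
    IsRegularPoint (axialInertia a k d) m r x ↔
      momentEnergy (axialInertia a k d) m r x ∈ ellipticValues a k (m * r ^ 2) := by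
  have hα := horWeight_pos ha hμ hb
  have hγ := verWeight_pos ha hb
  have h1 := spinConst_eq (d := d) hk ha hμ hx
  have h2 := spin_dot_diagMul_spin (k := k) hd ha hμ hx
  have h3 := transverse_form hα hγ h1.symm (h2.trans h1.symm)
  have h4 := transverse_spin (k := k) (d := d) ha hμ hx
  have hn : x.1 *ᵥ d ≠ 0 := by
    rw [Ne, mulVec_eq_zero_iff hx]; rintro rfl; simp at hd
  have hcross : d ⨯₃ x.2 ≠ 0 ↔ x.1 *ᵥ (x.2 - (d ⬝ᵥ x.2) • d) ≠ 0 := by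
    rw [Ne, Ne, mulVec_eq_zero_iff hx, not_iff_not]
    have h5 := double_cross d x.2
    rw [hd, one_smul] at h5
    rw [← h5]
    constructor
    · intro h
      rw [← cross_anticomm d x.2, h, neg_zero, map_zero]
    · intro h
      rw [h5, sub_eq_zero] at h
      rw [h, map_smul, cross_self, smul_zero]
  rw [isRegularPoint_iff ha hb hμ hd hx, hcross, ← h4]
  have hspin : d ⬝ᵥ x.2 ≠ 0 ↔ spin d x ≠ 0 := by
    rw [spin, Ne, Ne, smul_eq_zero, not_or]
    exact ⟨fun h => ⟨h, hn⟩, fun h => h.1⟩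
  rw [hspin]
  simp only [ellipticValues, Set.mem_ofPred_eq]
  change _ ↔ _ ∧ _ < dualForm _ _ (spinlessVelocity a _ (moment _ m r x))
  rw [← sub_pos (b := spinConst _ _ _ _), ← h3]
  have hform : ∀ {p q : ℝ} (_ : 0 < p) (_ : 0 < q) (v : Vec), v ≠ 0 ↔ 0 < v ⬝ᵥ diagMul p q v :=
    fun hp hq v => ⟨diagMul_form_pos hp hq, fun h hv => by simp [hv] at h⟩
  rw [hform hα hγ (spin d x), h2.trans h1.symm,
    hform (inv_pos.2 hα) (inv_pos.2 hγ) (transverse _ _ _ _)]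
  simp [hk, transverse]

theorem regularValues_subset (ha : 0 < a) (hb : 0 < a + k) (hμ : 0 < m * r ^ 2)
    (hd : d ⬝ᵥ d = 1) : ∀ c ∈ regularValues (axialInertia a k d) m r,
      k ≠ 0 ∧ c ∈ ellipticValues a k (m * r ^ 2) := by
  rintro c ⟨⟨x, hx, rfl⟩, hreg⟩
  have h := hreg x hx rfl
  have hk := ((isRegularPoint_iff ha hb hμ hd hx).1 h).1
  exact ⟨hk, (isRegularPoint_iff_mem_ellipticValues ha hb hk hμ hd hx).1 h⟩

end Regular

/-! ### Uniqueness of the rotational motion. -/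

section Uniqueness

theorem isCompact_SO3 : IsCompact SO3 := by
  have hclosed : IsClosed SO3 := by
    have h1 : Continuous fun A : Mat => A * Aᵀ := by fun_prop
    have h2 : Continuous fun A : Mat => A.det := by fun_prop
    exact (isClosed_singleton.preimage h1).inter (isClosed_singleton.preimage h2)
  have : ProperSpace Mat := FiniteDimensional.proper ℝ Mat
  refine Metric.isCompact_of_isClosed_isBounded hclosed ?_
  refine (Metric.isBounded_closedBall (x := (0 : Mat)) (r := 1)).subset fun A hA => ?_
  rw [mem_closedBall_zero_iff, Matrix.norm_le_iff zero_le_one]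
  intro i j
  have h := congrFun (congrFun hA.1 i) i
  rw [Matrix.mul_apply, Matrix.one_apply_eq] at h
  have h1 : A i j * A i j ≤ 1 := by
    rw [← h]
    exact Finset.single_le_sum (f := fun l => A i l * Aᵀ l i)
      (fun l _ => mul_self_nonneg (A i l)) (Finset.mem_univ j)
  rw [Real.norm_eq_abs]
  exact abs_le_one_iff_mul_self_le_one.2 h1

/-- The spin vector as a function of the axis of the sphere. -/
noncomputable def spinOfAxis (α γ : ℝ) (J n : Vec) : Vec := (n ⬝ᵥ J / (n ⬝ᵥ diagMul α γ n)) • n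

variable {a k m r : ℝ} {d : Vec}

/-- Pairing `velocity_eq` with n = A d cancels ⟨d, ω⟩ on both sides and leaves ⟨d, ω⟩ ⟨n, C n⟩ = ⟨n,
J⟩. -/
theorem spin_eq_spinOfAxis (ha : 0 < a) (hb : 0 < a + k) (hμ : 0 < m * r ^ 2) (hd : d ⬝ᵥ d = 1)
    {x : Mat × Vec} (hx : x ∈ phaseSpace) :
    spin d x = spinOfAxis (horWeight a k (m * r ^ 2)) (verWeight a k)
      (spinlessVelocity a (m * r ^ 2) (moment (axialInertia a k d) m r x)) (x.1 *ᵥ d) := by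
  have hn : (x.1 *ᵥ d) ⬝ᵥ (x.1 *ᵥ d) = 1 := by rw [mulVec_dotProduct_mulVec hx, hd]
  have hn0 : x.1 *ᵥ d ≠ 0 := fun h => by simp [h] at hn
  have hpos := diagMul_form_pos (horWeight_pos ha hμ hb) (verWeight_pos ha hb) hn0
  have h1 : (x.1 *ᵥ d) ⬝ᵥ (x.1 *ᵥ x.2) = d ⬝ᵥ x.2 := mulVec_dotProduct_mulVec hx _ _
  rw [velocity_eq (k := k) (d := d) ha hμ hx, dotProduct_sub, dotProduct_add] at h1
  rw [spinOfAxis, spin]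
  rw [spin, dotProduct_smul, hn, diagMul_smul, dotProduct_smul, smul_eq_mul, smul_eq_mul] at h1
  congr 1
  rw [eq_div_iff hpos.ne']
  linarith

/-- A rotational motion is determined by its initial point. -/
theorem rotationalMotion_unique (ha : 0 < a) (hb : 0 < a + k) (hμ : 0 < m * r ^ 2)
    (hd : d ⬝ᵥ d = 1) {γ₁ γ₂ : ℝ → Mat × Vec}
    (h₁ : IsRotationalMotion (axialInertia a k d) m r γ₁)
    (h₂ : IsRotationalMotion (axialInertia a k d) m r γ₂) (h0 : γ₁ 0 = γ₂ 0) : γ₁ = γ₂ := by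
  have hα := horWeight_pos ha hμ hb
  have hγ := verWeight_pos ha hb
  set α := horWeight a k (m * r ^ 2)
  set γ := verWeight a k
  set j := moment (axialInertia a k d) m r (γ₁ 0) with hj
  set J := spinlessVelocity a (m * r ^ 2) j with hJ
  -- Once j is fixed, the angular velocity is a function of the attitude, which therefore satisfies
  -- an autonomous first-order equation on SO(3).
  let N : Mat → Vec := fun A => spinOfAxis α γ J (A *ᵥ d)
  let W : Mat → Vec := fun A => J + N A - diagMul α γ (N A)
  let v : Mat → Mat := fun A => hat (W A) * A
  have hsmooth : ∀ A ∈ SO3, ContDiffAt ℝ 1 v A := by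
    intro A hA
    have hn : ContDiffAt ℝ 1 (fun A : Mat => A *ᵥ d) A :=
      contDiffAt_mulVec contDiffAt_id contDiffAt_const
    have hn0 : A *ᵥ d ≠ 0 := by
      rw [Ne, mulVec_eq_zero_iff hA]; rintro rfl; simp at hd
    have hN : ContDiffAt ℝ 1 N A :=
      ((contDiffAt_dot hn contDiffAt_const).div (contDiffAt_dot hn
        (contDiffAt_diagMul contDiffAt_const contDiffAt_const hn))
        (diagMul_form_pos hα hγ hn0).ne').smul hn
    exact contDiffAt_mul (contDiffAt_hat ((contDiffAt_const.add hN).sub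
      (contDiffAt_diagMul contDiffAt_const contDiffAt_const hN))) contDiffAt_id
  -- Compactness of SO(3) turns the local Lipschitz bounds of a C¹ field into a single one.
  obtain ⟨K, hK⟩ : ∃ K, LipschitzOnWith K v SO3 := by
    refine LocallyLipschitzOn.exists_lipschitzOnWith_of_compact isCompact_SO3 fun A hA => ?_
    obtain ⟨K, t, ht, hL⟩ := (hsmooth A hA).exists_lipschitzOnWith
    exact ⟨K, t, mem_nhdsWithin_of_mem_nhds ht, hL⟩
  have hvel : ∀ γ' : ℝ → Mat × Vec, IsRotationalMotion (axialInertia a k d) m r γ' →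
      moment (axialInertia a k d) m r (γ' 0) = j → ∀ t,
        (γ' t).1 *ᵥ (γ' t).2 = W (γ' t).1 := by
    intro γ' h hj' t
    have h3 := (isRotationalMotion_iff.1 h).2.2.2 t
    have h4 := velocity_eq (k := k) (d := d) ha hμ (h.1 t)
    have h5 := spin_eq_spinOfAxis ha hb hμ hd (h.1 t)
    rw [h3, hj'] at h4 h5
    rw [h4, h5]
  have hode : ∀ γ' : ℝ → Mat × Vec, IsRotationalMotion (axialInertia a k d) m r γ' →
      moment (axialInertia a k d) m r (γ' 0) = j → ∀ t,
        HasDerivAt (fun t => (γ' t).1) (v (γ' t).1) t ∧ (γ' t).1 ∈ SO3 := by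
    intro γ' h hj' t
    refine ⟨(h.2.1 t).congr_deriv ?_, h.1 t⟩
    rw [mul_hat (h.1 t), hvel γ' h hj' t]
  have hj2 : moment (axialInertia a k d) m r (γ₂ 0) = j := by rw [← h0]
  have hA := ODE_solution_unique_univ (v := fun _ => v) (s := fun _ => SO3) (fun _ => hK)
    (hode γ₁ h₁ rfl) (hode γ₂ h₂ hj2) (t₀ := 0) (by rw [h0])
  funext t
  have hAt : (γ₁ t).1 = (γ₂ t).1 := congrFun hA t
  refine Prod.ext hAt ?_
  rw [← transpose_mulVec_mulVec (h₁.1 t) (γ₁ t).2, ← transpose_mulVec_mulVec (h₂.1 t) (γ₂ t).2,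
    hvel γ₁ h₁ rfl, hvel γ₂ h₂ hj2, hAt]

end Uniqueness

end Chaplygin

/-! ### Angle coordinates and the linear flow. -/

namespace Chaplygin

/-- The data for angle coordinates: the constants of the sphere, the vector `e` that fixes the
origin of the first angle, the sign `σ` of the spin and a body frame `Q` whose third vector spans
the axis of symmetry. -/
structure Chart where
  a : ℝ
  k : ℝ
  m : ℝ
  r : ℝ
  σ : ℝ
  e : Vec
  Q : Mat
  a_pos : 0 < a
  m_pos : 0 < m
  r_pos : 0 < r
  b_pos : 0 < a + k
  k_ne : k ≠ 0
  σ_sq : σ * σ = 1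
  Q_mem : Q ∈ SO3

namespace Chart

variable (S : Chart)

/-- The axis of symmetry. -/
def d : Vec := S.Q *ᵥ e₃

/-- The inertia tensor. -/
def I : Mat := axialInertia S.a S.k S.d

def μ : ℝ := S.m * S.r ^ 2

noncomputable def α : ℝ := horWeight S.a S.k S.μ

noncomputable def γ : ℝ := verWeight S.a S.k

noncomputable def J (ε : Vec × ℝ) : Vec := spinlessVelocity S.a S.μ ε.1

noncomputable def c (ε : Vec × ℝ) : ℝ := spinConst S.a S.k S.μ ε

/-- The set of values on which the angle coordinates are defined. -/
def dom : Set (Vec × ℝ) := {ε | ε ∈ ellipticValues S.a S.k S.μ ∧ S.J ε ⨯₃ S.e ≠ 0}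

/-- The spin vector as a function of the eccentric angle. -/
noncomputable def spinAt (y : ℝ × (Vec × ℝ)) : Vec := ellipse S.α S.γ S.e (S.J y.2) (S.c y.2) y.1

/-- The derivative of time with respect to the eccentric angle. -/
noncomputable def timeDensity (y : ℝ × (Vec × ℝ)) : ℝ :=
  S.c y.2 / (planeFrequency S.α S.γ (S.J y.2) * (S.spinAt y ⬝ᵥ S.spinAt y))

/-- The derivative of the phase of the transverse angular velocity with respect to the eccentric
angle. -/
noncomputable def phaseDensity (y : ℝ × (Vec × ℝ)) : ℝ :=
  precessionRate S.α S.γ S.σ (S.J y.2) (S.c y.2) (S.spinAt y) * S.timeDensity y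

/-- The eccentric angle as a function of the first angle coordinate. -/
noncomputable def eccentric (y : (Fin 2 → ℝ) × (Vec × ℝ)) : ℝ :=
  normalizedInverse S.timeDensity (y.1 0, y.2)

/-- The phase of the transverse angular velocity as a function of the angle coordinates. -/
noncomputable def phase (y : (Fin 2 → ℝ) × (Vec × ℝ)) : ℝ :=
  2 * Real.pi * y.1 1 + periodicPart S.timeDensity S.phaseDensity (S.eccentric y, y.2)

/-- The angle coordinates, on the universal covering of the torus. -/
noncomputable def lift (y : (Fin 2 → ℝ) × (Vec × ℝ)) : Mat × Vec :=
  statePoint S.α S.γ S.σ S.Q (S.J y.2) (S.spinAt (S.eccentric y, y.2)) (S.phase y)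

/-- The period of the reduced motion. -/
noncomputable def period : Vec × ℝ → ℝ := periodIntegral S.timeDensity

/-- The frequencies of the motion. -/
noncomputable def freq (ε : Vec × ℝ) : Fin 2 → ℝ :=
  ![1 / S.period ε, periodIntegral S.phaseDensity ε / (2 * Real.pi * S.period ε)]

variable {S}

theorem μ_pos : 0 < S.μ := mul_pos S.m_pos (pow_pos S.r_pos 2)

theorem α_pos : 0 < S.α := horWeight_pos S.a_pos μ_pos S.b_pos

theorem γ_pos : 0 < S.γ := verWeight_pos S.a_pos S.b_pos

theorem d_dot_self : S.d ⬝ᵥ S.d = 1 := by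
  rw [d, mulVec_dotProduct_mulVec S.Q_mem]; simp [dot_eq]

theorem contDiff_J {n : WithTop ℕ∞} : ContDiff ℝ n S.J :=
  contDiff_iff_contDiffAt.2 fun _ => contDiffAt_diagMul contDiffAt_const contDiffAt_const
    contDiffAt_fst

theorem contDiff_c {n : WithTop ℕ∞} : ContDiff ℝ n S.c :=
  contDiff_iff_contDiffAt.2 fun _ => ((contDiffAt_dot contDiffAt_fst contDiff_J.contDiffAt).sub
    (contDiffAt_const.mul contDiffAt_snd)).div_const _

theorem isOpen_dom : IsOpen S.dom := by
  have hJ : Continuous S.J := (contDiff_J (n := 0)).continuous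
  have hc : Continuous S.c := (contDiff_c (n := 0)).continuous
  have hH : Continuous fun ε => dualForm S.α S.γ (S.J ε) :=
    (contDiff_iff_contDiffAt.2 fun _ =>
      contDiffAt_dualForm (n := 0) contDiff_J.contDiffAt).continuous
  have hx : Continuous fun ε => S.J ε ⨯₃ S.e :=
    (contDiff_iff_contDiffAt.2 fun _ =>
      contDiffAt_cross (n := 0) contDiff_J.contDiffAt contDiffAt_const).continuous
  exact ((isOpen_lt continuous_const hc).inter (isOpen_lt hc hH)).inter
    (isOpen_ne_fun hx continuous_const)

section Point

variable {ε : Vec × ℝ}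

theorem c_pos (hε : ε ∈ S.dom) : 0 < S.c ε := hε.1.1

theorem J_ne_zero (hε : ε ∈ S.dom) : S.J ε ≠ 0 := ne_zero_of_cross_ne_zero hε.2

theorem spinAt_dot (hε : ε ∈ S.dom) (φ : ℝ) : S.spinAt (φ, ε) ⬝ᵥ S.J ε = S.c ε :=
  ellipse_dot α_pos γ_pos (J_ne_zero hε) φ

theorem spinAt_form (hε : ε ∈ S.dom) (φ : ℝ) :
    S.spinAt (φ, ε) ⬝ᵥ diagMul S.α S.γ (S.spinAt (φ, ε)) = S.c ε :=
  ellipse_form α_pos γ_pos hε.2 hε.1.1 hε.1.2 φ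

theorem spinAt_ne_zero (hε : ε ∈ S.dom) (φ : ℝ) : S.spinAt (φ, ε) ≠ 0 :=
  ellipse_ne_zero α_pos γ_pos (J_ne_zero hε) hε.1.1 φ

theorem transverse_ne_zero (hε : ε ∈ S.dom) {N : Vec} (h1 : N ⬝ᵥ S.J ε = S.c ε)
    (h2 : N ⬝ᵥ diagMul S.α S.γ N = S.c ε) : transverse S.α S.γ (S.J ε) N ≠ 0 := by
  intro h
  have h3 := transverse_form α_pos γ_pos h1 h2
  have h4 := hε.1.2
  rw [← transverse, h, zero_dotProduct] at h3
  exact (sub_pos.2 h4).ne h3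

theorem transverse_spinAt_ne_zero (hε : ε ∈ S.dom) (φ : ℝ) :
    transverse S.α S.γ (S.J ε) (S.spinAt (φ, ε)) ≠ 0 :=
  transverse_ne_zero hε (spinAt_dot hε φ) (spinAt_form hε φ)

theorem transverse_spinAt_dot (hε : ε ∈ S.dom) (φ : ℝ) :
    transverse S.α S.γ (S.J ε) (S.spinAt (φ, ε)) ⬝ᵥ S.spinAt (φ, ε) = 0 :=
  transverse_dot (spinAt_dot hε φ) (spinAt_form hε φ)

theorem spinAt_add_two_pi (φ : ℝ) : S.spinAt (φ + 2 * Real.pi, ε) = S.spinAt (φ, ε) :=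
  ellipse_periodic _ _ _ _ _ φ

theorem contDiffAt_spinAt (hε : ε ∈ S.dom) (φ : ℝ) : ContDiffAt ℝ ω S.spinAt (φ, ε) :=
  contDiffAt_ellipse α_pos γ_pos (contDiff_J.contDiffAt.comp _ contDiffAt_snd)
    (contDiff_c.contDiffAt.comp _ contDiffAt_snd) contDiffAt_fst hε.2 hε.1.1 hε.1.2

theorem timeDensity_pos (hε : ε ∈ S.dom) (φ : ℝ) : 0 < S.timeDensity (φ, ε) :=
  div_pos (c_pos hε) (mul_pos (planeFrequency_pos α_pos γ_pos (J_ne_zero hε))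
    (dot_self_pos (spinAt_ne_zero hε φ)))

theorem timeDensity_periodic :
    Function.Periodic (fun φ => S.timeDensity (φ, ε)) (2 * Real.pi) := fun φ => by
  simp only [timeDensity, spinAt_add_two_pi]

theorem phaseDensity_periodic :
    Function.Periodic (fun φ => S.phaseDensity (φ, ε)) (2 * Real.pi) := fun φ => by
  simp only [phaseDensity, timeDensity, spinAt_add_two_pi]

theorem contDiffAt_timeDensity (hε : ε ∈ S.dom) (φ : ℝ) :
    ContDiffAt ℝ ω S.timeDensity (φ, ε) := by
  have hN := contDiffAt_spinAt hε φ
  have hJ : ContDiffAt ℝ ω (fun y : ℝ × (Vec × ℝ) => S.J y.2) (φ, ε) :=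
    contDiff_J.contDiffAt.comp _ contDiffAt_snd
  have hc : ContDiffAt ℝ ω (fun y : ℝ × (Vec × ℝ) => S.c y.2) (φ, ε) :=
    contDiff_c.contDiffAt.comp _ contDiffAt_snd
  exact hc.div ((contDiffAt_planeFrequency α_pos γ_pos hJ (J_ne_zero hε)).mul
    (contDiffAt_dot hN hN)) (mul_pos (planeFrequency_pos α_pos γ_pos (J_ne_zero hε))
      (dot_self_pos (spinAt_ne_zero hε φ))).ne'

section

variable {F : Type*} [NormedAddCommGroup F] [NormedSpace ℝ F] {y : F} {N J : F → Vec}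
  {α γ σ : ℝ} {c : F → ℝ}

theorem contDiffAt_transverse (hJ : ContDiffAt ℝ ω J y) (hN : ContDiffAt ℝ ω N y) :
    ContDiffAt ℝ ω (fun x => transverse α γ (J x) (N x)) y :=
  hJ.sub (contDiffAt_diagMul contDiffAt_const contDiffAt_const hN)

theorem contDiffAt_spinSpeed (hN : ContDiffAt ℝ ω N y) (h : N y ≠ 0) :
    ContDiffAt ℝ ω (fun x => spinSpeed σ (N x)) y :=
  contDiffAt_const.mul ((contDiffAt_dot hN hN).sqrt (dot_self_pos h).ne')

theorem contDiffAt_precessionRate (hσ : σ * σ = 1) (hJ : ContDiffAt ℝ ω J y)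
    (hc : ContDiffAt ℝ ω c y) (hN : ContDiffAt ℝ ω N y) (hc0 : c y ≠ 0) (hN0 : N y ≠ 0)
    (hV0 : transverse α γ (J y) (N y) ≠ 0) :
    ContDiffAt ℝ ω (fun x => precessionRate α γ σ (J x) (c x) (N x)) y := by
  have hs := contDiffAt_spinSpeed (σ := σ) hN hN0
  have hV := contDiffAt_transverse (α := α) (γ := γ) hJ hN
  have hf : ContDiffAt ℝ ω (fun x => spinField α γ (J x) (c x) (N x)) y :=
    ((contDiffAt_dot hN hN).div hc hc0).smul (contDiffAt_cross hJ
      (contDiffAt_diagMul contDiffAt_const contDiffAt_const hN))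
  exact ((contDiffAt_dot hN (contDiffAt_cross hV
    (contDiffAt_diagMul contDiffAt_const contDiffAt_const hf).neg)).div
      (hs.mul (contDiffAt_dot hV hV))
      (mul_ne_zero (spinSpeed_ne_zero hσ hN0) (dot_self_pos hV0).ne')).sub hs

theorem contDiffAt_statePoint (hσ : σ * σ = 1) (Q : Mat) {ψ : F → ℝ} (hJ : ContDiffAt ℝ ω J y)
    (hN : ContDiffAt ℝ ω N y) (hψ : ContDiffAt ℝ ω ψ y) (hN0 : N y ≠ 0)
    (hV0 : transverse α γ (J y) (N y) ≠ 0) :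
    ContDiffAt ℝ ω (fun x => statePoint α γ σ Q (J x) (N x) (ψ x)) y := by
  have hs := contDiffAt_spinSpeed (σ := σ) hN hN0
  have hV := contDiffAt_transverse (α := α) (γ := γ) hJ hN
  have hVV := dot_self_pos hV0
  have hn := (hs.inv (spinSpeed_ne_zero hσ hN0)).smul hN
  have hv := (((contDiffAt_dot hV hV).sqrt hVV.ne').inv (Real.sqrt_pos.2 hVV).ne').smul hV
  have hA : ContDiffAt ℝ ω (fun x => attitude α γ σ Q (J x) (N x) (ψ x)) y :=
    contDiffAt_mul (contDiffAt_mul (contDiffAt_colMat hv (contDiffAt_cross hn hv) hn)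
      (contDiffAt_transpose (contDiffAt_zRot hψ))) contDiffAt_const
  exact hA.prodMk (contDiffAt_mulVec (contDiffAt_transpose hA) ((hJ.add hN).sub
    (contDiffAt_diagMul contDiffAt_const contDiffAt_const hN)))

end

theorem contDiffAt_phaseDensity (hε : ε ∈ S.dom) (φ : ℝ) :
    ContDiffAt ℝ ω S.phaseDensity (φ, ε) := by
  have hJ : ContDiffAt ℝ ω (fun y : ℝ × (Vec × ℝ) => S.J y.2) (φ, ε) :=
    contDiff_J.contDiffAt.comp _ contDiffAt_snd
  have hc : ContDiffAt ℝ ω (fun y : ℝ × (Vec × ℝ) => S.c y.2) (φ, ε) :=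
    contDiff_c.contDiffAt.comp _ contDiffAt_snd
  exact (contDiffAt_precessionRate S.σ_sq hJ hc (contDiffAt_spinAt hε φ) (c_pos hε).ne'
    (spinAt_ne_zero hε φ) (transverse_spinAt_ne_zero hε φ)).mul (contDiffAt_timeDensity hε φ)

theorem continuous_timeDensity (hε : ε ∈ S.dom) : Continuous fun φ => S.timeDensity (φ, ε) :=
  continuous_iff_continuousAt.2 fun φ =>
    ContinuousAt.comp (f := fun φ => (φ, ε)) (contDiffAt_timeDensity hε φ).continuousAt
      (Continuous.prodMk_left ε).continuousAt

theorem continuous_phaseDensity (hε : ε ∈ S.dom) : Continuous fun φ => S.phaseDensity (φ, ε) :=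
  continuous_iff_continuousAt.2 fun φ =>
    ContinuousAt.comp (f := fun φ => (φ, ε)) (contDiffAt_phaseDensity hε φ).continuousAt
      (Continuous.prodMk_left ε).continuousAt

theorem dom_eventually (hε : ε ∈ S.dom) : ∀ᶠ ε' in 𝓝 ε, ε' ∈ S.dom := isOpen_dom.mem_nhds hε

theorem period_pos (hε : ε ∈ S.dom) : 0 < S.period ε :=
  periodIntegral_pos (continuous_timeDensity hε) (timeDensity_pos hε)

theorem contDiffAt_period (hε : ε ∈ S.dom) : ContDiffAt ℝ ω S.period ε :=
  contDiffAt_periodIntegral (contDiffAt_timeDensity hε)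
    ((dom_eventually hε).mono fun _ h => continuous_timeDensity h)

theorem contDiffAt_freq (hε : ε ∈ S.dom) : ContDiffAt ℝ ω S.freq ε := by
  have h1 := contDiffAt_period hε
  have h2 : ContDiffAt ℝ ω (periodIntegral S.phaseDensity) ε :=
    contDiffAt_periodIntegral (contDiffAt_phaseDensity hε)
      ((dom_eventually hε).mono fun _ h => continuous_phaseDensity h)
  have h3 := (period_pos hε).ne'
  rw [contDiffAt_pi]
  intro i
  fin_cases i
  · exact contDiffAt_const.div h1 h3
  · exact h2.div (contDiffAt_const.mul h1) (mul_ne_zero Real.two_pi_pos.ne' h3)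

theorem contDiffAt_periodicPart (hε : ε ∈ S.dom) (φ : ℝ) :
    ContDiffAt ℝ ω (periodicPart S.timeDensity S.phaseDensity) (φ, ε) :=
  _root_.contDiffAt_periodicPart (contDiffAt_timeDensity hε)
    ((dom_eventually hε).mono fun _ h => continuous_timeDensity h) (timeDensity_pos hε)
    (contDiffAt_phaseDensity hε) ((dom_eventually hε).mono fun _ h => continuous_phaseDensity h) φ

theorem contDiffAt_lift (hε : ε ∈ S.dom) (x : Fin 2 → ℝ) : ContDiffAt ℝ ω S.lift (x, ε) := by
  have hx : ∀ i, ContDiffAt ℝ ω (fun y : (Fin 2 → ℝ) × (Vec × ℝ) => y.1 i) (x, ε) := fun i =>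
    (contDiffAt_pi.1 contDiffAt_fst) i
  have hφ : ContDiffAt ℝ ω S.eccentric (x, ε) :=
    ContDiffAt.comp (x, ε) (f := fun y : (Fin 2 → ℝ) × (Vec × ℝ) => (y.1 0, y.2))
      (contDiffAt_normalizedInverse isOpen_dom hε (contDiffAt_timeDensity hε)
        (fun _ h => continuous_timeDensity h) (fun _ h => timeDensity_pos h)
        timeDensity_periodic (x 0)) ((hx 0).prodMk contDiffAt_snd)
  have hφε : ContDiffAt ℝ ω (fun y => (S.eccentric y, y.2)) (x, ε) := hφ.prodMk contDiffAt_snd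
  have hψ : ContDiffAt ℝ ω S.phase (x, ε) :=
    (contDiffAt_const.mul (hx 1)).add (ContDiffAt.comp (x, ε)
      (g := periodicPart S.timeDensity S.phaseDensity)
      (contDiffAt_periodicPart hε _) hφε)
  have hN : ContDiffAt ℝ ω (fun y => S.spinAt (S.eccentric y, y.2)) (x, ε) :=
    ContDiffAt.comp (x, ε) (g := S.spinAt) (contDiffAt_spinAt hε _) hφε
  have hJ : ContDiffAt ℝ ω (fun y : (Fin 2 → ℝ) × (Vec × ℝ) => S.J y.2) (x, ε) :=
    contDiff_J.contDiffAt.comp _ contDiffAt_snd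
  exact contDiffAt_statePoint S.σ_sq S.Q hJ hN hψ (spinAt_ne_zero hε _)
    (transverse_spinAt_ne_zero hε _)

theorem lift_mem (hε : ε ∈ S.dom) (x : Fin 2 → ℝ) : S.lift (x, ε) ∈ phaseSpace :=
  attitude_mem S.Q_mem S.σ_sq (spinAt_ne_zero hε _) (transverse_spinAt_ne_zero hε _)
    (transverse_spinAt_dot hε _) _

theorem spin_lift (hε : ε ∈ S.dom) (x : Fin 2 → ℝ) :
    spin S.d (S.lift (x, ε)) = S.spinAt (S.eccentric (x, ε), ε) :=
  spin_statePoint S.Q_mem rfl S.σ_sq (spinAt_ne_zero hε _) (transverse_spinAt_dot hε _) _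

theorem axis_dot_lift (hε : ε ∈ S.dom) (x : Fin 2 → ℝ) :
    S.d ⬝ᵥ (S.lift (x, ε)).2 = spinSpeed S.σ (S.spinAt (S.eccentric (x, ε), ε)) :=
  axis_dot_statePoint S.Q_mem rfl S.σ_sq (spinAt_ne_zero hε _) (transverse_spinAt_dot hε _) _

theorem velocity_lift (hε : ε ∈ S.dom) (x : Fin 2 → ℝ) :
    (S.lift (x, ε)).1 *ᵥ (S.lift (x, ε)).2 = S.J ε + S.spinAt (S.eccentric (x, ε), ε) -
      diagMul S.α S.γ (S.spinAt (S.eccentric (x, ε), ε)) :=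
  statePoint_velocity S.Q_mem S.σ_sq (spinAt_ne_zero hε _) (transverse_spinAt_ne_zero hε _)
    (transverse_spinAt_dot hε _) _

theorem momentEnergy_lift (hε : ε ∈ S.dom) (x : Fin 2 → ℝ) :
    momentEnergy S.I S.m S.r (S.lift (x, ε)) = ε := by
  have h1 : moment S.I S.m S.r (S.lift (x, ε)) = ε.1 := by
    refine moment_of_velocity S.a_pos μ_pos (lift_mem hε x) ?_
    rw [velocity_lift hε, spin_lift hε]
    rfl
  refine energy_of_spinConst S.k_ne S.a_pos μ_pos (lift_mem hε x) h1 ?_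
  rw [spin_lift hε]
  exact spinAt_dot hε _

theorem eccentric_update_zero (hε : ε ∈ S.dom) (x : Fin 2 → ℝ) (n : ℤ) (x1 : ℝ) :
    S.eccentric (![x 0 + n, x1], ε) = S.eccentric (x, ε) + n * (2 * Real.pi) := by
  have key : ∀ z : ℝ, normalizedInverse S.timeDensity (z + 1, ε) =
      normalizedInverse S.timeDensity (z, ε) + 2 * Real.pi :=
    normalizedInverse_add_one (continuous_timeDensity hε) (timeDensity_pos hε)
      timeDensity_periodic
  simp only [eccentric, cons_val_zero]
  induction n with
  | zero => simp
  | succ n ih =>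
    push_cast at ih ⊢
    rw [← add_assoc, key, ih]; ring
  | pred n ih =>
    have := key (x 0 + (-(n : ℝ) - 1))
    push_cast at ih ⊢
    rw [show x 0 + (-(n : ℝ) - 1) + 1 = x 0 + -(n : ℝ) by ring, ih] at this
    linarith

theorem spinAt_add_int (φ : ℝ) (n : ℤ) :
    S.spinAt (φ + n * (2 * Real.pi), ε) = S.spinAt (φ, ε) :=
  (ellipse_periodic S.α S.γ S.e (S.J ε) (S.c ε)).int_mul n φ

theorem periodicPart_add_int (hε : ε ∈ S.dom) (φ : ℝ) (n : ℤ) :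
    periodicPart S.timeDensity S.phaseDensity (φ + n * (2 * Real.pi), ε) =
      periodicPart S.timeDensity S.phaseDensity (φ, ε) := by
  have h : Function.Periodic (fun φ => periodicPart S.timeDensity S.phaseDensity (φ, ε))
      (2 * Real.pi) :=
    periodicPart_add_two_pi (continuous_timeDensity hε) (timeDensity_pos hε) timeDensity_periodic
      (continuous_phaseDensity hε) phaseDensity_periodic
  exact h.int_mul n φ

theorem zRot_add_int (ψ : ℝ) (n : ℤ) : zRot (ψ + n * (2 * Real.pi)) = zRot ψ := by
  rw [zRot, zRot, Real.cos_add_int_mul_two_pi, Real.sin_add_int_mul_two_pi]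

/-- The lift descends to the torus. -/
theorem lift_eq_of_int (hε : ε ∈ S.dom) {x z : Fin 2 → ℝ} {n : Fin 2 → ℤ}
    (h : ∀ i, z i = x i + n i) : S.lift (z, ε) = S.lift (x, ε) := by
  have hz : z = ![x 0 + n 0, z 1] := by
    ext i; fin_cases i
    exacts [h 0, rfl]
  have h1 : S.eccentric (z, ε) = S.eccentric (x, ε) + n 0 * (2 * Real.pi) := by
    rw [hz]; exact eccentric_update_zero hε x (n 0) _
  have h2 : S.phase (z, ε) = S.phase (x, ε) + n 1 * (2 * Real.pi) := by
    simp only [phase]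
    rw [h1, periodicPart_add_int hε, h 1]
    ring
  simp only [lift, statePoint, attitude]
  rw [h1, spinAt_add_int, h2, zRot_add_int]

/-- The frequency 1 / period undoes the normalization of the primitive, so the eccentric angle runs
in true time. -/
theorem hasDerivAt_eccentric (hε : ε ∈ S.dom) (x : Fin 2 → ℝ) (t : ℝ) :
    HasDerivAt (fun t : ℝ => S.eccentric (x + t • S.freq ε, ε))
      (S.timeDensity (S.eccentric (x + t • S.freq ε, ε), ε))⁻¹ t := by
  have h1 := hasDerivAt_normalizedInverse (continuous_timeDensity hε) (timeDensity_pos hε)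
    timeDensity_periodic (x 0 + t * (1 / S.period ε))
  have h2 : HasDerivAt (fun t : ℝ => x 0 + t * (1 / S.period ε)) (1 / S.period ε) t := by
    simpa using ((hasDerivAt_id t).mul_const (1 / S.period ε)).const_add (x 0)
  have h3 := h1.comp t h2
  have h4 := (period_pos hε).ne'
  refine h3.congr_deriv ?_
  rw [← period]
  simp only [eccentric, Pi.add_apply, Pi.smul_apply, freq, cons_val_zero, smul_eq_mul]
  field_simp

/-- By the chain rule the speed is the inverse of plane frequency times time density, which is |N|²
/ c as in `spinField`. -/
theorem hasDerivAt_spinAt (hε : ε ∈ S.dom) (x : Fin 2 → ℝ) (t : ℝ) :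
    HasDerivAt (fun t : ℝ => S.spinAt (S.eccentric (x + t • S.freq ε, ε), ε))
      (spinField S.α S.γ (S.J ε) (S.c ε) (S.spinAt (S.eccentric (x + t • S.freq ε, ε), ε))) t := by
  have h1 := hasDerivAt_eccentric hε x t
  have h2 := hasDerivAt_ellipse (c := S.c ε) (α_pos (S := S)) (γ_pos (S := S)) hε.2
    (S.eccentric (x + t • S.freq ε, ε))
  refine (h2.scomp t h1).congr_deriv ?_
  have h3 := (planeFrequency_pos (α_pos (S := S)) (γ_pos (S := S)) (J_ne_zero hε)).ne'
  have h4 := (c_pos hε).ne'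
  have h5 := (dot_self_pos (spinAt_ne_zero hε (S.eccentric (x + t • S.freq ε, ε)))).ne'
  rw [smul_smul, spinField, timeDensity]
  simp only
  rw [← spinAt.eq_def S (S.eccentric (x + t • S.freq ε, ε), ε)]
  congr 1
  field_simp

/-- The second frequency restores the mean rate that `periodicPart` subtracts; what is left is phase
density over time density. -/
theorem hasDerivAt_phase (hε : ε ∈ S.dom) (x : Fin 2 → ℝ) (t : ℝ) :
    HasDerivAt (fun t : ℝ => S.phase (x + t • S.freq ε, ε))
      (precessionRate S.α S.γ S.σ (S.J ε) (S.c ε)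
        (S.spinAt (S.eccentric (x + t • S.freq ε, ε), ε))) t := by
  have h1 := hasDerivAt_eccentric hε x t
  have h2 := hasDerivAt_periodicPart (continuous_timeDensity hε) (continuous_phaseDensity hε)
    (S.eccentric (x + t • S.freq ε, ε))
  have h3 := h2.comp t h1
  have h4 : HasDerivAt (fun t : ℝ => 2 * Real.pi * (x 1 + t * S.freq ε 1))
      (2 * Real.pi * S.freq ε 1) t := by
    simpa using (((hasDerivAt_id t).mul_const (S.freq ε 1)).const_add (x 1)).const_mul
      (2 * Real.pi)
  refine (h4.add h3).congr_deriv ?_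
  have h5 := (timeDensity_pos hε (S.eccentric (x + t • S.freq ε, ε))).ne'
  have h6 := (period_pos hε).ne'
  have h7 := Real.pi_pos.ne'
  have h8 : S.freq ε 1 = periodIntegral S.phaseDensity ε / (2 * Real.pi * S.period ε) := rfl
  rw [h8, ← period]
  simp only [phaseDensity]
  generalize S.eccentric (x + t • S.freq ε, ε) = φ at *
  field_simp
  ring

theorem hasDerivAt_lift_fst (hε : ε ∈ S.dom) (x : Fin 2 → ℝ) (t : ℝ) :
    HasDerivAt (fun t : ℝ => (S.lift (x + t • S.freq ε, ε)).1)
      ((S.lift (x + t • S.freq ε, ε)).1 * hat (S.lift (x + t • S.freq ε, ε)).2) t := by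
  rw [mul_hat (lift_mem hε _), velocity_lift hε]
  have h := hasDerivAt_attitude (Q := S.Q) (J := S.J ε) (c := S.c ε) (α := S.α) (γ := S.γ)
    (N := fun t : ℝ => S.spinAt (S.eccentric (x + t • S.freq ε, ε), ε))
    (ψ := fun t : ℝ => S.phase (x + t • S.freq ε, ε)) S.σ_sq (c_pos hε).ne'
    (fun _ => spinAt_ne_zero hε _) (fun _ => transverse_spinAt_ne_zero hε _)
    (fun _ => spinAt_dot hε _) (fun _ => spinAt_form hε _) (hasDerivAt_spinAt hε x t)
    (hasDerivAt_phase hε x t)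
  simpa only [lift, statePoint] using h

/-- By `isRotationalMotion_iff` only the kinematic equation, differentiability and constancy of the
moment are needed; the moment is constant because `S.lift` stays on its level. -/
theorem isRotationalMotion_lift (hε : ε ∈ S.dom) (x : Fin 2 → ℝ) :
    IsRotationalMotion S.I S.m S.r fun t => S.lift (x + t • S.freq ε, ε) := by
  rw [I, isRotationalMotion_iff, ← I]
  refine ⟨fun t => lift_mem hε _, hasDerivAt_lift_fst hε x, fun t => ?_, fun t => ?_⟩
  · have h1 : DifferentiableAt ℝ S.lift (x + t • S.freq ε, ε) :=
      (contDiffAt_lift hε _).differentiableAt (by simp)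
    have h2 : DifferentiableAt ℝ (fun t : ℝ => (x + t • S.freq ε, ε)) t := by fun_prop
    have h3 := DifferentiableAt.comp (f := fun t : ℝ => (x + t • S.freq ε, ε)) t h1 h2
    exact h3.snd
  · exact (congrArg Prod.fst (momentEnergy_lift hε (x + t • S.freq ε))).trans
      (congrArg Prod.fst (momentEnergy_lift hε (x + (0 : ℝ) • S.freq ε))).symm

end Point

end Chart

end Chaplygin

/-! ### Recovering the angle coordinates from a point. -/

namespace Chaplygin

theorem cos_sin_eq_iff {φ ψ : ℝ} :
    Real.cos φ = Real.cos ψ ∧ Real.sin φ = Real.sin ψ ↔ ∃ n : ℤ, φ = ψ + n * (2 * Real.pi) := by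
  constructor
  · rintro ⟨h1, h2⟩
    obtain ⟨n, hn⟩ := Real.Angle.angle_eq_iff_two_pi_dvd_sub.1 (Real.Angle.cos_sin_inj h1 h2)
    exact ⟨n, by linarith⟩
  · rintro ⟨n, rfl⟩
    exact ⟨Real.cos_add_int_mul_two_pi _ _, Real.sin_add_int_mul_two_pi _ _⟩

/-- Analytic choice of an angle with prescribed cosine and sine. -/
theorem exists_contDiffAt_angle {F : Type*} [NormedAddCommGroup F] [NormedSpace ℝ F] {y : F}
    {C D : F → ℝ} (hC : ContDiffAt ℝ ω C y) (hD : ContDiffAt ℝ ω D y)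
    (h : C y ^ 2 + D y ^ 2 = 1) :
    ∃ θ : F → ℝ, ContDiffAt ℝ ω θ y ∧
      ∀ x, C x ^ 2 + D x ^ 2 = 1 → Real.cos (θ x) = C x ∧ Real.sin (θ x) = D x := by
  obtain ⟨β, h1, h2⟩ := exists_cos_sin (x := C y) (y := D y) one_pos (by simpa using h)
  rw [one_mul] at h1 h2
  have hβ := Real.cos_sq_add_sin_sq β
  -- Rotation by -β brings the value at `y` to 1, where the logarithm is analytic; its imaginary
  -- part is the angle relative to β.
  let z : F → ℂ := fun x => ((C x * Real.cos β + D x * Real.sin β : ℝ) : ℂ) +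
    ((D x * Real.cos β - C x * Real.sin β : ℝ) : ℂ) * Complex.I
  have hzy : z y = 1 := by
    have e1 : C y * Real.cos β + D y * Real.sin β = 1 := by rw [h1, h2]; linarith
    have e2 : D y * Real.cos β - C y * Real.sin β = 0 := by rw [h1, h2]; ring
    simp only [z, e1, e2]; simp
  have hz : ContDiffAt ℝ ω z y := by
    have h3 : ContDiffAt ℝ ω (fun x => C x * Real.cos β + D x * Real.sin β) y :=
      (hC.mul contDiffAt_const).add (hD.mul contDiffAt_const)
    have h4 : ContDiffAt ℝ ω (fun x => D x * Real.cos β - C x * Real.sin β) y :=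
      (hD.mul contDiffAt_const).sub (hC.mul contDiffAt_const)
    exact (Complex.ofRealCLM.contDiff.contDiffAt.comp y h3).add
      ((Complex.ofRealCLM.contDiff.contDiffAt.comp y h4).mul contDiffAt_const)
  have hlog : ContDiffAt ℝ ω Complex.log (z y) := by
    rw [hzy]
    exact (Complex.contDiffAt_log Complex.one_mem_slitPlane).restrict_scalars ℝ
  refine ⟨fun x => β + Complex.arg (z x), contDiffAt_const.add ?_, fun x hx => ?_⟩
  · have := Complex.imCLM.contDiff.contDiffAt.comp y (hlog.comp y hz)
    simpa only [Function.comp_def, Complex.imCLM_apply, Complex.log_im] using this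
  · have hre : (z x).re = C x * Real.cos β + D x * Real.sin β := by
      simp [z, -Complex.ofReal_cos, -Complex.ofReal_sin]
    have him : (z x).im = D x * Real.cos β - C x * Real.sin β := by
      simp [z, -Complex.ofReal_cos, -Complex.ofReal_sin]
    have hn : ‖z x‖ = 1 := by
      have : ‖z x‖ ^ 2 = 1 := by
        rw [Complex.sq_norm, Complex.normSq_apply, hre, him]
        linear_combination hx + (C x ^ 2 + D x ^ 2) * hβ
      nlinarith [norm_nonneg (z x)]
    have hz0 : z x ≠ 0 := norm_ne_zero_iff.1 (by rw [hn]; exact one_ne_zero)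
    have hc : Real.cos (Complex.arg (z x)) = C x * Real.cos β + D x * Real.sin β := by
      rw [Complex.cos_arg hz0, hn, div_one, hre]
    have hs : Real.sin (Complex.arg (z x)) = D x * Real.cos β - C x * Real.sin β := by
      rw [Complex.sin_arg, hn, div_one, him]
    rw [Real.cos_add, Real.sin_add, hc, hs]
    constructor
    · linear_combination C x * hβ
    · linear_combination D x * hβ

namespace Chart

variable {S : Chart} {ε : Vec × ℝ}

/-- The set of the points of the phase space that have angle coordinates. -/
def region (S : Chart) : Set (Mat × Vec) :=
  {x | x ∈ phaseSpace ∧ momentEnergy S.I S.m S.r x ∈ S.dom ∧ 0 < S.σ * (S.d ⬝ᵥ x.2)}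

theorem lift_mem_region (hε : ε ∈ S.dom) (y : Fin 2 → ℝ) : S.lift (y, ε) ∈ S.region := by
  refine ⟨lift_mem hε y, by rwa [momentEnergy_lift hε], ?_⟩
  rw [axis_dot_lift hε, spinSpeed, ← mul_assoc, S.σ_sq, one_mul]
  exact Real.sqrt_pos.2 (dot_self_pos (spinAt_ne_zero hε _))

variable {x : Mat × Vec}

theorem spin_dot_J (hx : x ∈ phaseSpace) :
    spin S.d x ⬝ᵥ S.J (momentEnergy S.I S.m S.r x) = S.c (momentEnergy S.I S.m S.r x) :=
  (spinConst_eq S.k_ne S.a_pos μ_pos hx).symm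

theorem spin_form (hx : x ∈ phaseSpace) :
    spin S.d x ⬝ᵥ diagMul S.α S.γ (spin S.d x) = S.c (momentEnergy S.I S.m S.r x) :=
  (spin_dot_diagMul_spin d_dot_self S.a_pos μ_pos hx).trans (spin_dot_J hx)

theorem spin_dot_self (hx : x ∈ phaseSpace) :
    spin S.d x ⬝ᵥ spin S.d x = (S.d ⬝ᵥ x.2) ^ 2 := by
  rw [spin, smul_dotProduct, dotProduct_smul, mulVec_dotProduct_mulVec hx, d_dot_self]
  simp only [smul_eq_mul]; ring

theorem body_two (x : Mat × Vec) : (S.Qᵀ *ᵥ x.2) 2 = S.d ⬝ᵥ x.2 := by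
  rw [d, mulVec_dotProduct, dot_eq]
  simp [e₃]

theorem body_sq (hx : x ∈ phaseSpace) :
    (S.Qᵀ *ᵥ x.2) 0 ^ 2 + (S.Qᵀ *ᵥ x.2) 1 ^ 2 =
      transverse S.α S.γ (S.J (momentEnergy S.I S.m S.r x)) (spin S.d x) ⬝ᵥ
        transverse S.α S.γ (S.J (momentEnergy S.I S.m S.r x)) (spin S.d x) := by
  have h1 : transverse S.α S.γ (S.J (momentEnergy S.I S.m S.r x)) (spin S.d x) =
      x.1 *ᵥ (x.2 - (S.d ⬝ᵥ x.2) • S.d) := transverse_spin S.a_pos μ_pos hx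
  have h2 : (S.Qᵀ *ᵥ x.2) ⬝ᵥ (S.Qᵀ *ᵥ x.2) = x.2 ⬝ᵥ x.2 :=
    mulVec_dotProduct_mulVec (transpose_mem_SO3 S.Q_mem) _ _
  rw [dot_eq, body_two] at h2
  rw [h1, mulVec_dotProduct_mulVec hx]
  simp only [sub_dotProduct, dotProduct_sub, smul_dotProduct, dotProduct_smul, d_dot_self,
    dotProduct_comm x.2 S.d, smul_eq_mul]
  linear_combination h2

theorem spinSpeed_spin (hx : x ∈ phaseSpace) (h : 0 < S.σ * (S.d ⬝ᵥ x.2)) :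
    spinSpeed S.σ (spin S.d x) = S.d ⬝ᵥ x.2 := by
  have h1 : spin S.d x ⬝ᵥ spin S.d x = (S.σ * (S.d ⬝ᵥ x.2)) ^ 2 := by
    rw [spin_dot_self hx]; linear_combination -(S.d ⬝ᵥ x.2) ^ 2 * S.σ_sq
  rw [spinSpeed, h1, Real.sqrt_sq h.le, ← mul_assoc, S.σ_sq, one_mul]

/-- The point with prescribed eccentric angle and phase. -/
theorem eq_lift (hx : x ∈ S.region) {φ ψ : ℝ} (hε : momentEnergy S.I S.m S.r x = ε)
    (hφ : S.spinAt (φ, ε) = spin S.d x)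
    (h0 : (S.Qᵀ *ᵥ x.2) 0 = √(transverse S.α S.γ (S.J ε) (spin S.d x) ⬝ᵥ
      transverse S.α S.γ (S.J ε) (spin S.d x)) * Real.cos ψ)
    (h1 : (S.Qᵀ *ᵥ x.2) 1 = √(transverse S.α S.γ (S.J ε) (spin S.d x) ⬝ᵥ
      transverse S.α S.γ (S.J ε) (spin S.d x)) * Real.sin ψ) :
    x = S.lift (![normalizedPrimitive S.timeDensity (φ, ε),
      (ψ - periodicPart S.timeDensity S.phaseDensity (φ, ε)) / (2 * Real.pi)], ε) := by
  obtain ⟨hx1, hx2, hx3⟩ := hx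
  subst hε
  have h2 : S.eccentric (![normalizedPrimitive S.timeDensity (φ, momentEnergy S.I S.m S.r x),
      (ψ - periodicPart S.timeDensity S.phaseDensity (φ, momentEnergy S.I S.m S.r x)) /
        (2 * Real.pi)], momentEnergy S.I S.m S.r x) = φ := by
    simp only [eccentric, cons_val_zero]
    exact normalizedInverse_normalizedPrimitive (continuous_timeDensity hx2)
      (timeDensity_pos hx2) _
  have hN := spinAt_ne_zero hx2 φ
  have hV := transverse_spinAt_ne_zero hx2 φ
  rw [hφ] at hN hV
  rw [lift, phase, h2, hφ]
  refine eq_statePoint hx1 S.Q_mem (d := S.d) rfl S.σ_sq hN hV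
    (velocity_eq S.a_pos μ_pos hx1) rfl ?_
  have h3 : 2 * Real.pi * ((ψ - periodicPart S.timeDensity S.phaseDensity
      (φ, momentEnergy S.I S.m S.r x)) / (2 * Real.pi)) +
      periodicPart S.timeDensity S.phaseDensity (φ, momentEnergy S.I S.m S.r x) = ψ := by
    have := Real.pi_pos.ne'
    field_simp; ring
  simp only [cons_val_one, cons_val_zero, h3]
  exact vec_ext h0 h1 ((body_two x).trans (spinSpeed_spin hx1 hx3).symm)

theorem exists_spinAt_eq (hx : x ∈ phaseSpace) (hε : momentEnergy S.I S.m S.r x ∈ S.dom) :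
    ∃ φ, S.spinAt (φ, momentEnergy S.I S.m S.r x) = spin S.d x :=
  exists_ellipse_eq α_pos γ_pos hε.2 hε.1.1 hε.1.2 (spin_dot_J hx) (spin_form hx)

theorem exists_lift_eq (hx : x ∈ S.region) :
    ∃ y, S.lift (y, momentEnergy S.I S.m S.r x) = x := by
  obtain ⟨φ, hφ⟩ := exists_spinAt_eq hx.1 hx.2.1
  have hV := dot_self_pos (transverse_spinAt_ne_zero hx.2.1 φ)
  rw [hφ] at hV
  obtain ⟨ψ, h0, h1⟩ := exists_cos_sin (Real.sqrt_pos.2 hV)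
    ((body_sq hx.1).trans (Real.sq_sqrt hV.le).symm)
  exact ⟨_, (eq_lift hx rfl hφ h0.symm h1.symm).symm⟩

theorem spinAt_eq_iff (hε : ε ∈ S.dom) {φ φ' : ℝ} :
    S.spinAt (φ, ε) = S.spinAt (φ', ε) ↔ ∃ n : ℤ, φ = φ' + n * (2 * Real.pi) := by
  refine ⟨fun h => cos_sin_eq_iff.1
    (cos_sin_of_ellipse_eq α_pos γ_pos hε.2 hε.1.1 hε.1.2 h), ?_⟩
  rintro ⟨n, rfl⟩
  exact spinAt_add_int _ _

theorem eccentric_injective (hε : ε ∈ S.dom) {x z : Fin 2 → ℝ}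
    (h : S.eccentric (x, ε) = S.eccentric (z, ε)) : x 0 = z 0 := by
  have key := normalizedPrimitive_normalizedInverse (continuous_timeDensity hε)
    (timeDensity_pos hε) timeDensity_periodic
  rw [← key (x 0), ← key (z 0)]
  exact congrArg (fun φ => normalizedPrimitive S.timeDensity (φ, ε)) h

/-- The first angle is the only coordinate the spin vector sees, and it is seen modulo 1. This fixes
the minimal period. -/
theorem spin_lift_eq_iff (hε : ε ∈ S.dom) {x z : Fin 2 → ℝ} :
    spin S.d (S.lift (z, ε)) = spin S.d (S.lift (x, ε)) ↔ ∃ n : ℤ, z 0 = x 0 + n := by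
  rw [spin_lift hε, spin_lift hε, spinAt_eq_iff hε]
  refine exists_congr fun n => ?_
  rw [← eccentric_update_zero hε x n (z 1)]
  refine ⟨fun h => eccentric_injective hε h, fun h => ?_⟩
  simp only [eccentric, cons_val_zero, h]

/-- The spin vector gives the first angle modulo 1. The angular velocity in the body then gives the
phase modulo 2π, and the periodic parts cancel. -/
theorem lift_injective (hε : ε ∈ S.dom) {x z : Fin 2 → ℝ} (h : S.lift (z, ε) = S.lift (x, ε)) :
    ∃ n : Fin 2 → ℤ, ∀ i, z i = x i + n i := by
  obtain ⟨n, hn⟩ := (spin_lift_eq_iff hε).1 (congrArg (spin S.d) h)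
  have hecc : S.eccentric (z, ε) = S.eccentric (x, ε) + n * (2 * Real.pi) := by
    rw [← eccentric_update_zero hε x n (z 1)]
    simp only [eccentric, cons_val_zero, hn]
  have hspin : S.spinAt (S.eccentric (z, ε), ε) = S.spinAt (S.eccentric (x, ε), ε) := by
    rw [hecc, spinAt_add_int]
  have hb : ∀ y : Fin 2 → ℝ, S.Qᵀ *ᵥ (S.lift (y, ε)).2 = _ := fun y =>
    statePoint_bodyVelocity S.Q_mem S.σ_sq (spinAt_ne_zero hε _) (transverse_spinAt_ne_zero hε _)
      (transverse_spinAt_dot hε _) _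
  have h2 := (hb z).symm.trans ((congrArg (fun w => S.Qᵀ *ᵥ w) (congrArg Prod.snd h)).trans (hb x))
  simp only [hspin] at h2
  have hρ := (Real.sqrt_pos.2 (dot_self_pos
    (transverse_spinAt_ne_zero hε (S.eccentric (x, ε))))).ne'
  have hc := mul_left_cancel₀ hρ (congrFun h2 0)
  have hs := mul_left_cancel₀ hρ (congrFun h2 1)
  obtain ⟨l, hl⟩ := cos_sin_eq_iff.1 ⟨hc, hs⟩
  simp only [phase, hecc, periodicPart_add_int hε] at hl
  refine ⟨![n, l], fun i => ?_⟩
  fin_cases i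
  · exact hn
  · simp only [Fin.mk_one, cons_val_one, cons_val_zero]
    have h3 : 2 * Real.pi * (z 1 - x 1 - l) = 0 := by linarith
    have := (mul_eq_zero.1 h3).resolve_left Real.two_pi_pos.ne'
    linarith

end Chart

end Chaplygin

/-! ### The analytic diffeomorphism from the torus. -/

namespace Chaplygin

theorem toTorus_surjective : Function.Surjective toTorus := fun θ =>
  ⟨fun i => (QuotientAddGroup.mk_surjective (θ i)).choose,
    funext fun i => (QuotientAddGroup.mk_surjective (θ i)).choose_spec⟩

theorem toTorus_eq_iff {x z : Fin 2 → ℝ} :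
    toTorus z = toTorus x ↔ ∃ n : Fin 2 → ℤ, ∀ i, z i = x i + n i := by
  rw [← Classical.skolem (p := fun i (n : ℤ) => z i = x i + n), funext_iff]
  refine forall_congr' fun i => ?_
  rw [toTorus, toTorus, ← sub_eq_zero, ← AddCircle.coe_sub, AddCircle.coe_eq_zero_iff]
  refine exists_congr fun n => ?_
  rw [zsmul_one]
  exact ⟨fun h => by linarith, fun h => by linarith⟩

theorem toTorus_add (x z : Fin 2 → ℝ) : toTorus (x + z) = toTorus x + toTorus z := rfl

namespace Chart

variable {S : Chart} {ε : Vec × ℝ} {x : Mat × Vec}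

/-- The angle coordinates on the torus. -/
noncomputable def torusMap (S : Chart) (y : Torus × (Vec × ℝ)) : Mat × Vec :=
  S.lift (Function.surjInv toTorus_surjective y.1, y.2)

/-- The arbitrary choice of representatives in `torusMap` is harmless because `S.lift` is invariant
under integer shifts. -/
theorem torusMap_toTorus (hε : ε ∈ S.dom) (x : Fin 2 → ℝ) :
    S.torusMap (toTorus x, ε) = S.lift (x, ε) := by
  obtain ⟨n, hn⟩ := toTorus_eq_iff.1 (Function.surjInv_eq toTorus_surjective (toTorus x))
  exact lift_eq_of_int hε hn

theorem momentEnergy_torusMap (hε : ε ∈ S.dom) (θ : Torus) :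
    momentEnergy S.I S.m S.r (S.torusMap (θ, ε)) = ε := momentEnergy_lift hε _

theorem torusMap_injective (hε : ε ∈ S.dom) {θ θ' : Torus}
    (h : S.torusMap (θ, ε) = S.torusMap (θ', ε)) : θ = θ' := by
  rw [← Function.surjInv_eq toTorus_surjective θ, ← Function.surjInv_eq toTorus_surjective θ']
  exact toTorus_eq_iff.2 (lift_injective hε h)

theorem exists_torusMap_eq (hx : x ∈ S.region) :
    ∃ θ, S.torusMap (θ, momentEnergy S.I S.m S.r x) = x := by
  obtain ⟨y, hy⟩ := exists_lift_eq hx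
  exact ⟨toTorus y, (torusMap_toTorus hx.2.1 y).trans hy⟩

theorem bijOn_torusMap : Set.BijOn S.torusMap (Set.univ ×ˢ S.dom) S.region := by
  refine ⟨fun y hy => lift_mem_region hy.2 _, ?_, fun x hx => ?_⟩
  · rintro ⟨θ, ε⟩ ⟨-, h1⟩ ⟨θ', ε'⟩ ⟨-, h2⟩ h
    have h3 : ε = ε' := by
      exact (momentEnergy_torusMap h1 θ).symm.trans
        ((congrArg _ h).trans (momentEnergy_torusMap h2 θ'))
    subst h3
    rw [torusMap_injective h1 h]
  · obtain ⟨θ, hθ⟩ := exists_torusMap_eq hx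
    exact ⟨(θ, _), ⟨trivial, hx.2.1⟩, hθ⟩

/-- The angles of a point. -/
noncomputable def angles (S : Chart) (x : Mat × Vec) : Torus :=
  Function.invFun (fun θ => S.torusMap (θ, momentEnergy S.I S.m S.r x)) x

theorem torusMap_angles (hx : x ∈ S.region) :
    S.torusMap (S.angles x, momentEnergy S.I S.m S.r x) = x :=
  Function.invFun_eq (f := fun θ => S.torusMap (θ, momentEnergy S.I S.m S.r x))
    (exists_torusMap_eq hx)

theorem angles_eq (hx : x ∈ S.region) {y : Fin 2 → ℝ}
    (h : S.lift (y, momentEnergy S.I S.m S.r x) = x) : S.angles x = toTorus y :=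
  torusMap_injective hx.2.1
    ((torusMap_angles hx).trans (h.symm.trans (torusMap_toTorus hx.2.1 y).symm))

theorem angles_torusMap (hε : ε ∈ S.dom) (θ : Torus) : S.angles (S.torusMap (θ, ε)) = θ := by
  have hm : S.torusMap (θ, ε) ∈ S.region := lift_mem_region hε _
  have h := torusMap_angles hm
  rw [momentEnergy_torusMap hε] at h
  exact torusMap_injective hε h

/-- This gives analyticity of the inverse. The eccentric angle comes from the coordinates of the
spin vector along the axes of the ellipse, and the phase from the angular velocity in the body;
explicit primitives convert them. The identity holds on the whole region, analyticity at the chosen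
point. -/
theorem exists_local_coordinates (hx : x ∈ S.region) :
    ∃ y : Fin 2 → Mat × Vec → ℝ, (∀ i, ContDiffAt ℝ ω (y i) x) ∧
      ∀ z ∈ S.region, S.lift (fun i => y i z, momentEnergy S.I S.m S.r z) = z := by
  have hε := hx.2.1
  let V : Mat × Vec → Vec := fun z =>
    transverse S.α S.γ (S.J (momentEnergy S.I S.m S.r z)) (spin S.d z)
  have hm : ContDiffAt ℝ ω (momentEnergy S.I S.m S.r) x := (contDiff_momentEnergy _ _ _).contDiffAt
  have hJ : ContDiffAt ℝ ω (fun z => S.J (momentEnergy S.I S.m S.r z)) x :=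
    contDiff_J.contDiffAt.comp x hm
  have hc : ContDiffAt ℝ ω (fun z => S.c (momentEnergy S.I S.m S.r z)) x :=
    contDiff_c.contDiffAt.comp x hm
  have hN : ContDiffAt ℝ ω (spin S.d) x :=
    (contDiffAt_dot contDiffAt_const contDiffAt_snd).smul
      (contDiffAt_mulVec contDiffAt_fst contDiffAt_const)
  have hV : ContDiffAt ℝ ω V x := contDiffAt_transverse hJ hN
  have hV0 : ∀ z ∈ S.region, 0 < V z ⬝ᵥ V z := fun z hz =>
    dot_self_pos (transverse_ne_zero hz.2.1 (spin_dot_J hz.1) (spin_form hz.1))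
  have hR0 : ∀ z ∈ S.region, 0 < ellipseRadius S.α S.γ (S.J (momentEnergy S.I S.m S.r z))
      (S.c (momentEnergy S.I S.m S.r z)) := fun z hz =>
    (ellipseRadius_sq α_pos γ_pos (J_ne_zero hz.2.1) hz.2.1.1.1 hz.2.1.1.2).1
  have hR := contDiffAt_ellipseRadius α_pos γ_pos hJ hc (J_ne_zero hε) hε.1.1 hε.1.2
  have key : ∀ z ∈ S.region, ∃ φ, S.spinAt (φ, momentEnergy S.I S.m S.r z) = spin S.d z ∧
      spin S.d z ⬝ᵥ diagMul S.α S.γ (axisOne S.α S.γ S.e (S.J (momentEnergy S.I S.m S.r z))) /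
        ellipseRadius S.α S.γ (S.J (momentEnergy S.I S.m S.r z))
          (S.c (momentEnergy S.I S.m S.r z)) = Real.cos φ ∧
      spin S.d z ⬝ᵥ diagMul S.α S.γ (axisTwo S.α S.γ S.e (S.J (momentEnergy S.I S.m S.r z))) /
        ellipseRadius S.α S.γ (S.J (momentEnergy S.I S.m S.r z))
          (S.c (momentEnergy S.I S.m S.r z)) = Real.sin φ := by
    intro z hz
    obtain ⟨φ, hφ⟩ := exists_spinAt_eq hz.1 hz.2.1
    have h1 := ellipse_axisOne (c := S.c (momentEnergy S.I S.m S.r z)) (α_pos (S := S))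
      (γ_pos (S := S)) hz.2.1.2 φ
    have h2 := ellipse_axisTwo (c := S.c (momentEnergy S.I S.m S.r z)) (α_pos (S := S))
      (γ_pos (S := S)) hz.2.1.2 φ
    have hφ' := hφ
    rw [spinAt] at hφ'
    rw [hφ'] at h1 h2
    exact ⟨φ, hφ, by rw [h1, mul_div_cancel_left₀ _ (hR0 z hz).ne'],
      by rw [h2, mul_div_cancel_left₀ _ (hR0 z hz).ne']⟩
  have hD : ∀ {w : Mat × Vec → Vec}, ContDiffAt ℝ ω w x →
      ContDiffAt ℝ ω (fun z => diagMul S.α S.γ (w z)) x := fun h =>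
    contDiffAt_diagMul contDiffAt_const contDiffAt_const h
  have hsum : ∀ {u v φ : ℝ}, u = Real.cos φ → v = Real.sin φ → u ^ 2 + v ^ 2 = 1 := by
    rintro u v φ rfl rfl
    exact Real.cos_sq_add_sin_sq φ
  obtain ⟨φ, hφ, hφ'⟩ := exists_contDiffAt_angle
    ((contDiffAt_dot hN (hD (contDiffAt_axisOne α_pos γ_pos hJ hε.2))).div hR (hR0 x hx).ne')
    ((contDiffAt_dot hN (hD (contDiffAt_axisTwo α_pos γ_pos hJ hε.2))).div hR (hR0 x hx).ne')
    (by obtain ⟨φ, -, h1, h2⟩ := key x hx; exact hsum h1 h2)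
  have hb : ∀ i, ContDiffAt ℝ ω (fun z : Mat × Vec => (S.Qᵀ *ᵥ z.2) i) x :=
    contDiffAt_pi.1 (contDiffAt_mulVec contDiffAt_const contDiffAt_snd)
  have hρ : ContDiffAt ℝ ω (fun z => √(V z ⬝ᵥ V z)) x :=
    (contDiffAt_dot hV hV).sqrt (hV0 x hx).ne'
  have hρ0 : ∀ z ∈ S.region, √(V z ⬝ᵥ V z) ≠ 0 := fun z hz => (Real.sqrt_pos.2 (hV0 z hz)).ne'
  have key' : ∀ z ∈ S.region, ((S.Qᵀ *ᵥ z.2) 0 / √(V z ⬝ᵥ V z)) ^ 2 +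
      ((S.Qᵀ *ᵥ z.2) 1 / √(V z ⬝ᵥ V z)) ^ 2 = 1 := fun z hz => by
    rw [div_pow, div_pow, ← add_div, body_sq hz.1, Real.sq_sqrt (hV0 z hz).le]
    exact div_self (hV0 z hz).ne'
  obtain ⟨ψ, hψ, hψ'⟩ := exists_contDiffAt_angle ((hb 0).div hρ (hρ0 x hx))
    ((hb 1).div hρ (hρ0 x hx)) (key' x hx)
  refine ⟨![fun z => normalizedPrimitive S.timeDensity (φ z, momentEnergy S.I S.m S.r z),
    fun z => (ψ z - periodicPart S.timeDensity S.phaseDensity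
      (φ z, momentEnergy S.I S.m S.r z)) / (2 * Real.pi)], fun i => ?_, fun z hz => ?_⟩
  · have h1 := hφ.prodMk hm
    fin_cases i
    · exact ContDiffAt.comp x (g := normalizedPrimitive S.timeDensity)
        (contDiffAt_normalizedPrimitive (contDiffAt_timeDensity hε)
          ((dom_eventually hε).mono fun _ h => continuous_timeDensity h)
          (timeDensity_pos hε) _) h1
    · exact (hψ.sub (ContDiffAt.comp x (g := periodicPart S.timeDensity S.phaseDensity)
        (contDiffAt_periodicPart hε _) h1)).div_const _
  · obtain ⟨φ₁, h0, h1, h2⟩ := key z hz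
    -- The chosen analytic angle may differ from `φ₁` by full turns, which the ellipse does not
    -- notice.
    obtain ⟨n, hn⟩ := cos_sin_eq_iff.1 ⟨(hφ' z (hsum h1 h2)).1.trans h1,
      (hφ' z (hsum h1 h2)).2.trans h2⟩
    have h3 : S.spinAt (φ z, momentEnergy S.I S.m S.r z) = spin S.d z := by
      rw [hn, spinAt_add_int, h0]
    obtain ⟨h4, h5⟩ := hψ' z (key' z hz)
    have := eq_lift (ψ := ψ z) hz rfl h3
      (by rw [h4]; exact (mul_div_cancel₀ _ (hρ0 z hz)).symm)
      (by rw [h5]; exact (mul_div_cancel₀ _ (hρ0 z hz)).symm)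
    conv_rhs => rw [this]
    congr 2
    ext i
    fin_cases i <;> rfl

theorem isTorusDiffeo_torusMap : IsTorusDiffeo S.dom S.region S.torusMap := by
  refine ⟨bijOn_torusMap, ?_, S.angles, momentEnergy S.I S.m S.r,
    fun θ ε hε => ⟨angles_torusMap hε θ, momentEnergy_torusMap hε θ⟩, fun i x hx => ?_,
    fun x _ => (contDiff_momentEnergy _ _ _).contDiffAt.analyticAt.analyticWithinAt⟩
  · rintro ⟨y, ε⟩ ⟨-, hε⟩
    refine (contDiffAt_lift hε y).analyticAt.congr ?_
    have : ∀ᶠ z : (Fin 2 → ℝ) × (Vec × ℝ) in 𝓝 (y, ε), z.2 ∈ S.dom :=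
      continuousAt_snd.eventually (dom_eventually hε)
    filter_upwards [this] with z hz
    exact (torusMap_toTorus hz z.1).symm
  · obtain ⟨y, hy, hy'⟩ := exists_local_coordinates hx
    have h1 : ContDiffAt ℝ ω (fun z => Complex.exp ((2 * Real.pi * y i z : ℝ) * Complex.I)) x := by
      have h2 : ContDiffAt ℝ ω (fun z => 2 * Real.pi * y i z) x := contDiffAt_const.mul (hy i)
      have h3 : ContDiffAt ℝ ω (fun z => ((2 * Real.pi * y i z : ℝ) * Complex.I : ℂ)) x :=
        (Complex.ofRealCLM.contDiff.contDiffAt.comp x h2).mul contDiffAt_const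
      have h4 : ContDiff ℝ ω Complex.exp :=
        (Complex.contDiff_exp (𝕜 := ℂ) (n := ω)).restrict_scalars ℝ
      exact h4.contDiffAt.comp x h3
    refine h1.analyticAt.analyticWithinAt.congr (fun z hz => ?_) ?_ <;>
    · rw [angles_eq ‹_› (hy' _ ‹_›), toTorus, AddCircle.toCircle_apply_mk, Circle.coe_exp, div_one]

theorem dom_subset_regularValues : S.dom ⊆ regularValues S.I S.m S.r := fun ε hε =>
  ⟨⟨_, lift_mem hε 0, momentEnergy_lift hε 0⟩, fun x hx hxε =>
    (isRegularPoint_iff_mem_ellipticValues S.a_pos S.b_pos S.k_ne μ_pos d_dot_self hx).2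
      (by rw [← I, hxε]; exact hε.1)⟩

theorem eq_lift_of_isRotationalMotion {γ : ℝ → Mat × Vec}
    (hγ : IsRotationalMotion S.I S.m S.r γ) (hε : ε ∈ S.dom) {y : Fin 2 → ℝ}
    (h0 : γ 0 = S.lift (y, ε)) : γ = fun t => S.lift (y + t • S.freq ε, ε) :=
  rotationalMotion_unique S.a_pos S.b_pos μ_pos d_dot_self hγ (isRotationalMotion_lift hε y)
    (by simpa using h0)

theorem isOpen_region : ∃ U : Set (Mat × Vec), IsOpen U ∧ S.region = U ∩ phaseSpace := by
  refine ⟨{x | momentEnergy S.I S.m S.r x ∈ S.dom} ∩ {x | 0 < S.σ * (S.d ⬝ᵥ x.2)}, ?_, ?_⟩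
  · have h1 : Continuous (momentEnergy S.I S.m S.r) :=
      (contDiff_momentEnergy (n := 0) _ _ _).continuous
    have h2 : Continuous fun x : Mat × Vec => S.σ * (S.d ⬝ᵥ x.2) :=
      (contDiff_iff_contDiffAt.2 fun _ => contDiffAt_const.mul
        (contDiffAt_dot (n := 0) contDiffAt_const contDiffAt_snd)).continuous
    exact (isOpen_dom.preimage h1).inter (isOpen_lt continuous_const h2)
  · ext x
    exact ⟨fun h => ⟨⟨h.2.1, h.2.2⟩, h.1⟩, fun h => ⟨h.2, h.1.1, h.1.2⟩⟩

theorem isQuasiperiodicNear (hx : x ∈ S.region) : IsQuasiperiodicNear S.I S.m S.r x := by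
  refine ⟨S.dom, S.region, S.torusMap, S.freq, isOpen_dom, dom_subset_regularValues,
    isOpen_region, hx, isTorusDiffeo_torusMap, fun ε hε => (contDiffAt_freq hε).analyticAt,
    fun θ ε hε => momentEnergy_torusMap hε θ, fun θ ε hε γ h0 => ?_⟩
  obtain ⟨y, rfl⟩ := toTorus_surjective θ
  have h1 : ∀ t : ℝ, S.torusMap (toTorus y + toTorus (t • S.freq ε), ε) =
      S.lift (y + t • S.freq ε, ε) := fun t => by
    rw [← toTorus_add, torusMap_toTorus hε]
  simp only [h1]
  rw [torusMap_toTorus hε] at h0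
  constructor
  · intro h t
    rw [eq_lift_of_isRotationalMotion h hε h0]
  · intro h
    rw [funext h]
    exact isRotationalMotion_lift hε y

end Chart

end Chaplygin

/-! ### The period of the reduced motion and the drift of the point of contact. -/

namespace Chaplygin

/-- A periodic velocity makes the increment over one period constant; `w` is this increment divided
by `T`. -/
theorem exists_linear_add_periodic {p v : ℝ → Vec} {T : ℝ} (hp : ∀ t, HasDerivAt p (v t) t)
    (hv : Function.Periodic v T) (hT : T ≠ 0) :
    ∃ (w : Vec) (q : ℝ → Vec), Function.Periodic q T ∧ ∀ t, p t = t • w + q t := by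
  have hd : ∀ t, HasDerivAt (fun t => p (t + T) - p t) 0 t := fun t => by
    have h := ((hp (t + T)).comp_add_const t T).sub (hp t)
    rwa [hv t, sub_self] at h
  have hc : ∀ t, p (t + T) - p t = p (0 + T) - p 0 := fun t =>
    is_const_of_deriv_eq_zero (fun t => (hd t).differentiableAt) (fun t => (hd t).deriv) t 0
  refine ⟨T⁻¹ • (p (0 + T) - p 0), fun t => p t - t • T⁻¹ • (p (0 + T) - p 0), fun t => ?_,
    fun t => (add_sub_cancel _ _).symm⟩
  simp only
  rw [add_smul, smul_inv_smul₀ hT, ← hc t]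
  abel

namespace Chart

variable {S : Chart} {ε : Vec × ℝ} {x : Mat × Vec} {d : Vec} {γ : ℝ → Mat × Vec}

theorem reducedMotion_lift_eq_iff (hε : ε ∈ S.dom) (hd : rotationsAbout S.d = rotationsAbout d)
    (y : Fin 2 → ℝ) (s t : ℝ) :
    reducedMotion d (fun t => S.lift (y + t • S.freq ε, ε)) s =
      reducedMotion d (fun t => S.lift (y + t • S.freq ε, ε)) t ↔
        ∃ n : ℤ, s = t + n * S.period ε := by
  have hτ := (period_pos hε).ne'
  have hmem : ∀ t : ℝ, S.lift (y + t • S.freq ε, ε) ∈ phaseSpace := fun t => lift_mem hε _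
  rw [reducedMotion_eq_iff hd hmem]
  -- On one level and for one sign of the spin, the orbit invariants A d and A ω determine the spin
  -- vector and are determined by it.
  trans spin S.d (S.lift (y + s • S.freq ε, ε)) = spin S.d (S.lift (y + t • S.freq ε, ε))
  · constructor
    · rintro ⟨h1, h2⟩
      have h3 : ∀ t : ℝ, S.d ⬝ᵥ (S.lift (y + t • S.freq ε, ε)).2 = _ := fun t =>
        (mulVec_dotProduct_mulVec (hmem t) S.d (S.lift (y + t • S.freq ε, ε)).2).symm
      rw [spin, spin, h3 s, h3 t, h1, h2]
    · intro h
      rw [spin_lift hε, spin_lift hε] at h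
      rw [velocity_lift hε, velocity_lift hε, h]
      refine ⟨?_, rfl⟩
      rw [lift, lift, statePoint, statePoint]
      simp only
      rw [attitude_mulVec_axis (d := S.d) S.Q_mem rfl, attitude_mulVec_axis (d := S.d) S.Q_mem rfl,
        h]
  · rw [spin_lift_eq_iff hε]
    refine exists_congr fun n => ?_
    simp only [Pi.add_apply, Pi.smul_apply, freq, cons_val_zero, smul_eq_mul]
    constructor
    · intro h; field_simp at h; linarith
    · rintro rfl; field_simp; ring

theorem isMinimalPeriod_of_mem_region (hd : rotationsAbout S.d = rotationsAbout d)
    (hγ : IsRotationalMotion S.I S.m S.r γ) (h0 : γ 0 ∈ S.region) :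
    IsMinimalPeriod (reducedMotion d γ) (S.period (momentEnergy S.I S.m S.r (γ 0))) := by
  have hε := h0.2.1
  obtain ⟨y, hy⟩ := exists_lift_eq h0
  generalize momentEnergy S.I S.m S.r (γ 0) = ε at *
  rw [eq_lift_of_isRotationalMotion hγ hε hy.symm]
  have hτ := period_pos hε
  refine ⟨hτ, fun t => (reducedMotion_lift_eq_iff hε hd y _ _).2 ⟨1, by simp⟩,
    fun s hs h => ?_⟩
  obtain ⟨n, hn⟩ := (reducedMotion_lift_eq_iff hε hd y _ _).1 (h 0)
  simp only [zero_add] at hn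
  subst hn
  have h1 : (0 : ℝ) < n := pos_of_mul_pos_left hs hτ.le
  have h2 : (1 : ℝ) ≤ n := by exact_mod_cast h1
  nlinarith

/-- The chart for the opposite spin. -/
def neg (S : Chart) : Chart := { S with σ := -S.σ, σ_sq := by rw [neg_mul_neg, S.σ_sq] }

/-- Zero spin would contradict ⟨N, J⟩ = c > 0, so one of the two signs applies. -/
theorem mem_region_or (hx : x ∈ phaseSpace) (hε : momentEnergy S.I S.m S.r x ∈ S.dom) :
    x ∈ S.region ∨ x ∈ S.neg.region := by
  have h0 : S.d ⬝ᵥ x.2 ≠ 0 := fun h => by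
    have h1 := spin_dot_J (S := S) hx
    rw [spin, h, zero_smul, zero_dotProduct] at h1
    exact (c_pos hε).ne h1
  have h1 : S.σ ≠ 0 := fun h => by simpa [h] using S.σ_sq
  rcases (mul_ne_zero h1 h0).lt_or_gt with h | h
  · exact Or.inr ⟨hx, hε, show 0 < -S.σ * (S.d ⬝ᵥ x.2) by linarith⟩
  · exact Or.inl ⟨hx, hε, h⟩

theorem isMinimalPeriod (hd : rotationsAbout S.d = rotationsAbout d)
    (hγ : IsRotationalMotion S.I S.m S.r γ) (hε : momentEnergy S.I S.m S.r (γ 0) ∈ S.dom) :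
    IsMinimalPeriod (reducedMotion d γ) (S.period (momentEnergy S.I S.m S.r (γ 0))) := by
  rcases mem_region_or (hγ.1 0) hε with h | h
  · exact isMinimalPeriod_of_mem_region hd hγ h
  -- The time density does not involve `σ`, so both signs have the same period.
  · exact isMinimalPeriod_of_mem_region (S := S.neg) hd hγ h

end Chart

theorem IsMinimalPeriod.unique {α : Type*} {f : ℝ → α} {s t : ℝ} (hs : IsMinimalPeriod f s)
    (ht : IsMinimalPeriod f t) : s = t :=
  le_antisymm (hs.2.2 t ht.1 ht.2.1) (ht.2.2 s hs.1 hs.2.1)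

/-- The period of the reduced motions with a given value of moment and energy. -/
noncomputable def reducedPeriod (I : Mat) (m r : ℝ) (d : Vec) (c : Vec × ℝ) : ℝ :=
  sInf {T | ∃ γ, IsRotationalMotion I m r γ ∧ momentEnergy I m r (γ 0) = c ∧
    IsMinimalPeriod (reducedMotion d γ) T}

/-- The formula for `S.period` contains the auxiliary vector `e`, which is suitable only for part of
the levels. The infimum is intrinsic and runs over a singleton, so it inherits analyticity from
every chart. -/
theorem Chart.reducedPeriod_eq {S : Chart} {d : Vec} {ε : Vec × ℝ}
    (hd : rotationsAbout S.d = rotationsAbout d) (hε : ε ∈ S.dom) :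
    reducedPeriod S.I S.m S.r d ε = S.period ε := by
  rw [reducedPeriod, ← csInf_singleton (S.period ε)]
  congr 1
  ext T
  rw [Set.mem_singleton_iff]
  constructor
  · rintro ⟨γ, h1, rfl, h3⟩
    exact h3.unique (isMinimalPeriod hd h1 hε)
  · rintro rfl
    have h1 := isRotationalMotion_lift hε 0
    have h2 := momentEnergy_lift hε (0 + (0 : ℝ) • S.freq ε)
    refine ⟨_, h1, h2, ?_⟩
    have h3 := isMinimalPeriod hd h1 (by simp only [h2]; exact hε)
    simpa only [h2] using h3

theorem exists_cross_ne_zero {J : Vec} (hJ : J ≠ 0) : ∃ e : Vec, J ⨯₃ e ≠ 0 := by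
  by_contra! h
  apply hJ
  have h1 := h ![1, 0, 0]
  have h2 := h ![0, 1, 0]
  have h3 := congrFun h1 1
  have h4 := congrFun h1 2
  have h5 := congrFun h2 2
  rw [cross_one] at h3
  rw [cross_two] at h4 h5
  simp at h3 h4 h5
  exact vec_ext h5 h4 h3

theorem exists_chart {a k m r : ℝ} {n : Vec} (ha : 0 < a) (hb : 0 < a + k) (hm : 0 < m)
    (hr : 0 < r) (hn : n ⬝ᵥ n = 1) {x : Mat × Vec} (hx : x ∈ phaseSpace)
    (hreg : momentEnergy (axialInertia a k n) m r x ∈ regularValues (axialInertia a k n) m r) :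
    ∃ S : Chart, S.d = n ∧ S.I = axialInertia a k n ∧ S.m = m ∧ S.r = r ∧ x ∈ S.region := by
  obtain ⟨Q, hQ, rfl⟩ := exists_frame hn
  obtain ⟨hk, hell⟩ := regularValues_subset ha hb (mul_pos hm (pow_pos hr 2)) hn _ hreg
  -- From 0 < c < H = ⟨J, C⁻¹ J⟩ it follows that J is nonzero, so some `e` is not parallel to it.
  have hJ : spinlessVelocity a (m * r ^ 2)
      (momentEnergy (axialInertia a k (Q *ᵥ e₃)) m r x).1 ≠ 0 := fun h => by
    have := hell.1.trans hell.2
    rw [h, dualForm, zero_dotProduct] at this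
    exact this.false
  obtain ⟨e, he⟩ := exists_cross_ne_zero hJ
  let S : Chart := ⟨a, k, m, r, 1, e, Q, ha, hm, hr, hb, hk, one_mul 1, hQ⟩
  rcases Chart.mem_region_or (S := S) hx ⟨hell, he⟩ with h | h
  · exact ⟨S, rfl, rfl, rfl, rfl, h⟩
  · exact ⟨S.neg, rfl, rfl, rfl, rfl, h⟩

end Chaplygin

theorem mainTheorem11 (I : Chaplygin.Mat) (hI : I.PosDef) (m r : ℝ) (hm : 0 < m) (hr : 0 < r)
    (htwo : ∃ i k : Fin 3, i ≠ k ∧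
      hI.isHermitian.eigenvalues i = hI.isHermitian.eigenvalues k) :
    (∃ d : Chaplygin.Vec, Chaplygin.IsSymmetryAxis I d) ∧
    ∀ d : Chaplygin.Vec, Chaplygin.IsSymmetryAxis I d →
      (∃ τ : Chaplygin.Vec × ℝ → ℝ,
        AnalyticOnNhd ℝ τ (Chaplygin.regularValues I m r) ∧
        ∀ c ∈ Chaplygin.regularValues I m r, ∀ γ : ℝ → Chaplygin.Mat × Chaplygin.Vec,
          Chaplygin.IsRotationalMotion I m r γ → Chaplygin.momentEnergy I m r (γ 0) = c →
            Chaplygin.IsMinimalPeriod (Chaplygin.reducedMotion d γ) (τ c) ∧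
            Function.Periodic (fun t => (γ t).1 *ᵥ (γ t).2) (τ c) ∧
            ∀ p : ℝ → Chaplygin.Vec, Chaplygin.IsContactMotion r γ p →
              Function.Periodic (deriv p) (τ c) ∧
              ∃ (w : Chaplygin.Vec) (q : ℝ → Chaplygin.Vec),
                Function.Periodic q (τ c) ∧ ∀ t, p t = t • w + q t) ∧
      ∀ x₀ ∈ Chaplygin.phaseSpace,
        Chaplygin.momentEnergy I m r x₀ ∈ Chaplygin.regularValues I m r →
          Chaplygin.IsQuasiperiodicNear I m r x₀ := by
  refine ⟨?_, fun d hd => ?_⟩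
  · obtain ⟨i, k, hik, h⟩ := htwo
    obtain ⟨a, b, d, hd, rfl⟩ := Chaplygin.eq_axialInertia_of_eigenvalues hI.isHermitian hik h
    exact ⟨d, Chaplygin.isSymmetryAxis_axialInertia a b hd⟩
  clear htwo
  obtain ⟨a, k, n, hn, ha, hb, rfl, hrot⟩ := Chaplygin.exists_axialInertia hI hd
  refine ⟨⟨Chaplygin.reducedPeriod (Chaplygin.axialInertia a k n) m r d, ?_, ?_⟩, ?_⟩
  · intro c hc
    obtain ⟨x, hx, rfl⟩ := hc.1
    obtain ⟨S, rfl, hS, rfl, rfl, hx'⟩ := Chaplygin.exists_chart ha hb hm hr hn hx hc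
    rw [← hS]
    have hdom := hx'.2.1
    refine (Chaplygin.Chart.contDiffAt_period hdom).analyticAt.congr ?_
    filter_upwards [Chaplygin.Chart.dom_eventually hdom] with c hc
    exact (Chaplygin.Chart.reducedPeriod_eq hrot hc).symm
  · rintro c hc γ hγ rfl
    obtain ⟨S, rfl, hS, rfl, rfl, hx'⟩ := Chaplygin.exists_chart ha hb hm hr hn (hγ.1 0) hc
    have hmin : Chaplygin.IsMinimalPeriod (Chaplygin.reducedMotion d γ)
        (Chaplygin.reducedPeriod (Chaplygin.axialInertia a k S.d) S.m S.r d
          (Chaplygin.momentEnergy (Chaplygin.axialInertia a k S.d) S.m S.r (γ 0))) := by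
      rw [← hS] at hγ ⊢
      rw [Chaplygin.Chart.reducedPeriod_eq hrot hx'.2.1]
      exact Chaplygin.Chart.isMinimalPeriod hrot hγ hx'.2.1
    have hvel : Function.Periodic (fun t => (γ t).1 *ᵥ (γ t).2) _ := fun t =>
      ((Chaplygin.reducedMotion_eq_iff hrot hγ.1 _ _).1 (hmin.2.1 t)).2
    refine ⟨hmin, hvel, fun p hp => ?_⟩
    -- The velocity of the point of contact depends on A ω alone and inherits its period.
    have hv := Function.Periodic.comp hvel fun w => S.r • (crossProduct w Chaplygin.e₃)
    refine ⟨?_, Chaplygin.exists_linear_add_periodic hp hv hmin.1.ne'⟩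
    rw [funext fun t => (hp t).deriv]
    exact hv
  · intro x hx hc
    obtain ⟨S, rfl, hS, rfl, rfl, hx'⟩ := Chaplygin.exists_chart ha hb hm hr hn hx hc
    rw [← hS]
    exact Chaplygin.Chart.isQuasiperiodicNear hx'
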